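/- **Theorem.** For $\beta\in(0,1)$, a $\beta$-stable subordinator is a nondecreasing, right-continuous process $(X_t)_{t\ge 0}$ with $X_0=0$ and stationary independent increments such that, for some $c>0$, $\mathbb E\,e^{-\lambda X_t}=e^{-ct\lambda^\beta}$ for all $t,\lambda\ge 0$. A $\beta$-stable regenerative set $R^{(\beta)}$ is a random closed set with the law of the closure of the range of such a process (with respect to the Borel $\sigma$-algebra of the Fell topology on closed sets). For $a>0$ let $B_{a,\beta}$ denote a random variable with the law of the overshoot $X_{T_a}-a$, where $T_a=\inf\{t: X_t>a\}$. Let $\beta_1,\beta_2\in(0,1)$ satisfy $\beta_{1,2}:=\beta_1+\beta_2-1>0$, let $R^{(\beta_1)}$ and $R^{(\beta_2)}$ be independent stable regenerative sets with indices $\beta_1$ and $\beta_2$, and for $a>0$ put $$D_{a,\beta_1,\beta_2}:=\min\bigl\{R^{(\beta_1)}\cap\bigl(a+R^{(\beta_2)}\bigr)\bigr\}-a .$$ For every $a>0$ this minimum almost surely exists, and the following hold. 1. Recursion: $D_{1,\beta_1,\beta_2}\stackrel{d}{=}B_{1,\beta_1}\,(1+D_{1,\beta_2,\beta_1})$, where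 $B_{1,\beta_1}$ and $D_{1,\beta_2,\beta_1}$ on the right-hand side are independent. 2. Scaling: $D_{a,\beta_1,\beta_2}/a\stackrel{d}{=}D_{1,\beta_1,\beta_2}$ for all $a>0$. 3. Distribution function: $\mathbb P(D_{1,\beta_1,\beta_2}\le x)=P_D^{\beta_1,\beta_2}(x\mid 1)$ for all $x>0$, where for $a,x>0$ $$P_D^{\beta_1,\beta_2}(x\mid a)=\frac{1}{\Gamma(\beta_{1,2})\Gamma(1-\beta_{1,2})}\int_0^1\Bigl(\frac ax+y\Bigr)^{\beta_1-1}y^{\beta_2-1}(1-y)^{-\beta_{1,2}}\,dy .$$ 4. Hypergeometric form: for all $a,x>0$, $$P_D^{\beta_1,\beta_2}(x\mid a)=\frac{\Gamma(\beta_2)}{\Gamma(\beta_{1,2})\Gamma(2-\beta_1)}\Bigl(\frac ax\Bigr)^{\beta_1-1}{}_2F_1\Bigl(1-\beta_1,\beta_2;2-\beta_1;-\frac xa\Bigr),$$ where ${}_2F_1$ is the holomorphic continuation to $\mathbb C\setminus[1,\infty)$ of the Gauss hypergeometric series. -/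

import Mathlib

open MeasureTheory ProbabilityTheory
open scoped NNReal

/-- A (strictly) `β`-stable subordinator: independent and stationary increments, almost surely
nondecreasing right-continuous paths started at `0`, and Laplace exponent `c * l ^ β` for some
scale `c > 0`. -/
structure IsStableSubordinator {Ω : Type*} [MeasurableSpace Ω] (β : ℝ) (X : ℝ≥0 → Ω → ℝ)
    (P : Measure Ω) : Prop where
  measurable : ∀ t, Measurable (X t)
  start_zero : ∀ᵐ ω ∂P, X 0 ω = 0
  monotone : ∀ᵐ ω ∂P, Monotone (fun t => X t ω)
  right_continuous : ∀ᵐ ω ∂P, ∀ t, ContinuousWithinAt (fun s => X s ω) (Set.Ici t) t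
  indep_increments : HasIndepIncrements X P
  stationary_increments : ∀ s t : ℝ≥0, IdentDistrib (fun ω => X (s + t) ω - X s ω) (X t) P P
  laplace : ∃ c : ℝ, 0 < c ∧ ∀ (t : ℝ≥0) (l : ℝ), 0 ≤ l →
    ∫ ω, Real.exp (-l * X t ω) ∂P = Real.exp (-c * t * l ^ β)

/-- The σ-algebra on the closed subsets of `ℝ` generated by the events that the closed set hits a
given compact set; it is the Borel σ-algebra of the Fell topology. -/
instance instMeasurableSpaceClosedsReal : MeasurableSpace (TopologicalSpace.Closeds ℝ) :=
  MeasurableSpace.generateFrom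
    {A | ∃ K : Set ℝ, IsCompact K ∧
      A = {F : TopologicalSpace.Closeds ℝ | ((F : Set ℝ) ∩ K).Nonempty}}

/-- The closure of the range of a real-valued process. -/
def closedRange {Ω : Type*} (X : ℝ≥0 → Ω → ℝ) (ω : Ω) : TopologicalSpace.Closeds ℝ :=
  TopologicalSpace.Closeds.closure (Set.range fun t => X t ω)

/-- The overshoot of a process over the level `a`: its value at the first passage time
`inf {t | X t > a}`, minus `a`. -/
noncomputable def overshoot {Ω : Type*} (X : ℝ≥0 → Ω → ℝ) (a : ℝ) (ω : Ω) : ℝ :=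
  X (sInf {t : ℝ≥0 | a < X t ω}) ω - a

/-- `R` is a `β`-stable regenerative set: a random closed set with the law of the closure of the
range of a `β`-stable subordinator. -/
def IsStableRegenerativeSet {Ω : Type*} [MeasurableSpace Ω] (β : ℝ)
    (R : Ω → TopologicalSpace.Closeds ℝ) (P : Measure Ω) : Prop :=
  ∃ (Ω₀ : Type) (_ : MeasurableSpace Ω₀) (P₀ : Measure Ω₀) (X : ℝ≥0 → Ω₀ → ℝ),
    IsProbabilityMeasure P₀ ∧ IsStableSubordinator β X P₀ ∧ IdentDistrib R (closedRange X) P P₀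

/-- `B` is a random variable with the law of the overshoot over the level `a` of a `β`-stable
subordinator. -/
def IsStableOvershoot {Ω : Type*} [MeasurableSpace Ω] (β a : ℝ) (B : Ω → ℝ) (P : Measure Ω) :
    Prop :=
  ∃ (Ω₀ : Type) (_ : MeasurableSpace Ω₀) (P₀ : Measure Ω₀) (X : ℝ≥0 → Ω₀ → ℝ),
    IsProbabilityMeasure P₀ ∧ IsStableSubordinator β X P₀ ∧ IdentDistrib B (overshoot X a) P P₀

/-- The intersection of `R₁` with the shift `a + R₂`. -/
def shiftedIntersection {Ω : Type*} (R₁ R₂ : Ω → TopologicalSpace.Closeds ℝ) (a : ℝ) (ω : Ω) :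
    Set ℝ :=
  (R₁ ω : Set ℝ) ∩ (fun r => a + r) '' (R₂ ω : Set ℝ)

/-- The first intersection time of `R₁` and `a + R₂`, measured from `a`. -/
noncomputable def firstIntersectionTime {Ω : Type*} (R₁ R₂ : Ω → TopologicalSpace.Closeds ℝ)
    (a : ℝ) (ω : Ω) : ℝ :=
  sInf (shiftedIntersection R₁ R₂ a ω) - a

/-- The function `P_D(x | a)` with indices `β₁`, `β₂`. -/
noncomputable def intersectionCDF (β₁ β₂ x a : ℝ) : ℝ :=
  1 / (Real.Gamma (β₁ + β₂ - 1) * Real.Gamma (1 - (β₁ + β₂ - 1))) *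
    ∫ y in (0 : ℝ)..1, (a / x + y) ^ (β₁ - 1) * y ^ (β₂ - 1) * (1 - y) ^ (-(β₁ + β₂ - 1))

/-- `F` is the Gauss hypergeometric function with parameters `a, b; c` on `ℂ \ [1, ∞)`: the
holomorphic continuation (necessarily unique there) of the hypergeometric series, which converges
in the open unit disc. -/
def IsGaussHypergeometric (a b c : ℂ) (F : ℂ → ℂ) : Prop :=
  DifferentiableOn ℂ F {z | 1 - z ∈ Complex.slitPlane} ∧
    ∀ z : ℂ, ‖z‖ < 1 → F z = ordinaryHypergeometric a b c z

open scoped ENNReal BoundedContinuousFunction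

/-!
Start at distance `a` from the first set and let the two sets leap in turn to the first point that
is not before the other one. By regeneration the leaps are products of independent overshoots over
the level `1`, of alternating indices, and the leaping position increases to the first common point.

The overshoot law is found from the renewal identity `(δ₁ * ν) * U = U` on `(1, ∞)`, where `U` is
the potential measure, with density proportional to `x ^ (β - 1)`: its solution `ν` is the
generalized arcsine law. For `0 < r < β₁ + β₂ - 1` the `r`-th moments of the two overshoot laws have
a product less than `1`, so that the leaps are almost surely summable.

A Beta integral shows that the claimed distribution functions satisfy the recursion
`F₁₂ x = 𝔼 [F₂₁ (x / B₁ - 1)]`. Along the leaps this makes the claimed conditional probability a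
martingale, which converges to the indicator of the event that the limit is at most `z`, so that its
initial value is the probability of that event. The recursion, the scaling relation and, through
Euler's integral, the hypergeometric form follow from the distribution function.
-/

/-! ### Uniqueness of Laplace transforms -/

theorem eqOn_complexMGF_of_mgf_eqOn {Ω Ω' : Type*} {_ : MeasurableSpace Ω}
    {_ : MeasurableSpace Ω'} {μ : Measure Ω} {ν : Measure Ω'} {X : Ω → ℝ} {Y : Ω' → ℝ} {S : Set ℝ}
    (hS : IsOpen S) (hS' : Convex ℝ S) (hX : S ⊆ integrableExpSet X μ)
    (hY : S ⊆ integrableExpSet Y ν) (h : Set.EqOn (mgf X μ) (mgf Y ν) S) :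
    Set.EqOn (complexMGF X μ) (complexMGF Y ν) {z | z.re ∈ S} := by
  rcases S.eq_empty_or_nonempty with rfl | ⟨s, hs⟩
  · simp
  refine AnalyticOnNhd.eqOn_of_preconnected_of_frequently_eq
    (analyticOnNhd_complexMGF.mono fun z hz => interior_maximal hX hS hz)
    (analyticOnNhd_complexMGF.mono fun z hz => interior_maximal hY hS hz)
    (hS'.linear_preimage Complex.reLm).isPreconnected (z₀ := (s : ℂ)) (by simpa using hs) ?_
  have h_real : ∃ᶠ x : ℝ in nhdsWithin s {s}ᶜ, complexMGF X μ x = complexMGF Y ν x := by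
    refine Filter.Eventually.frequently ?_
    filter_upwards [mem_nhdsWithin_of_mem_nhds (hS.mem_nhds hs)] with x hx
    rw [complexMGF_ofReal, complexMGF_ofReal, h hx]
  have h_tendsto :
      Filter.Tendsto ((↑) : ℝ → ℂ) (nhdsWithin s {s}ᶜ) (nhdsWithin (s : ℂ) {(s : ℂ)}ᶜ) :=
    Complex.continuous_ofReal.continuousWithinAt.tendsto_nhdsWithin fun x hx => by simpa using hx
  exact h_tendsto.frequently h_real

theorem measure_eq_of_mgf_eqOn {μ ν : Measure ℝ} [IsFiniteMeasure μ] [IsFiniteMeasure ν]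
    {S : Set ℝ} (hS : IsOpen S) (hS' : Convex ℝ S) (hS₀ : 0 ∈ S) (hμ : S ⊆ integrableExpSet id μ)
    (hν : S ⊆ integrableExpSet id ν) (h : Set.EqOn (mgf id μ) (mgf id ν) S) : μ = ν := by
  refine Measure.ext_of_charFun (funext fun t => ?_)
  rw [← complexMGF_id_mul_I, ← complexMGF_id_mul_I]
  exact eqOn_complexMGF_of_mgf_eqOn hS hS' hμ hν h (by simpa using hS₀)

theorem lintegral_exp_mul_withDensity_exp_neg (μ : Measure ℝ) (t : ℝ) :
    ∫⁻ x, ENNReal.ofReal (Real.exp (t * x))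
        ∂(μ.withDensity fun x => ENNReal.ofReal (Real.exp (-x))) =
      ∫⁻ x, ENNReal.ofReal (Real.exp (-(1 - t) * x)) ∂μ := by
  rw [lintegral_withDensity_eq_lintegral_mul _ (by fun_prop) (by fun_prop)]
  refine lintegral_congr fun x => ?_
  rw [Pi.mul_apply, ← ENNReal.ofReal_mul (Real.exp_pos _).le, ← Real.exp_add]
  ring_nf

theorem mgf_id_withDensity_exp_neg (μ : Measure ℝ) (t : ℝ) :
    mgf id (μ.withDensity fun x => ENNReal.ofReal (Real.exp (-x))) t =
      (∫⁻ x, ENNReal.ofReal (Real.exp (-(1 - t) * x)) ∂μ).toReal := by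
  rw [← lintegral_exp_mul_withDensity_exp_neg]
  exact integral_eq_lintegral_of_nonneg_ae
    (Filter.Eventually.of_forall fun x => (Real.exp_pos _).le) (by fun_prop)

theorem withDensity_exp_neg_injective :
    Function.Injective fun μ : Measure ℝ =>
      μ.withDensity fun x => ENNReal.ofReal (Real.exp (-x)) := by
  refine Function.LeftInverse.injective
    (g := fun μ => μ.withDensity (fun x => ENNReal.ofReal (Real.exp (-x)))⁻¹) fun μ =>
    withDensity_inv_same (by fun_prop) (Filter.Eventually.of_forall fun x => ?_)
      (Filter.Eventually.of_forall fun x => ENNReal.ofReal_ne_top)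
  simpa using Real.exp_pos (-x)

-- The density `exp (-x)` makes both measures finite, with moment generating functions on `(-∞, 1)`.
theorem measure_eq_of_laplace_eq {μ ν : Measure ℝ}
    (hfin : ∀ l : ℝ, 0 < l → ∫⁻ x, ENNReal.ofReal (Real.exp (-l * x)) ∂μ ≠ ∞)
    (h : ∀ l : ℝ, 0 < l → ∫⁻ x, ENNReal.ofReal (Real.exp (-l * x)) ∂μ =
      ∫⁻ x, ENNReal.ofReal (Real.exp (-l * x)) ∂ν) : μ = ν := by
  have hfinite : ∀ κ : Measure ℝ,
      (∀ l : ℝ, 0 < l → ∫⁻ x, ENNReal.ofReal (Real.exp (-l * x)) ∂κ ≠ ∞) →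
      IsFiniteMeasure (κ.withDensity fun x => ENNReal.ofReal (Real.exp (-x))) := fun κ hκ =>
    isFiniteMeasure_withDensity (by simpa using hκ 1 one_pos)
  have hint : ∀ κ : Measure ℝ,
      (∀ l : ℝ, 0 < l → ∫⁻ x, ENNReal.ofReal (Real.exp (-l * x)) ∂κ ≠ ∞) →
      Set.Iio 1 ⊆
        integrableExpSet id (κ.withDensity fun x => ENNReal.ofReal (Real.exp (-x))) := by
    refine fun κ hκ t ht => ⟨by fun_prop, ?_⟩
    rw [hasFiniteIntegral_iff_ofReal (Filter.Eventually.of_forall fun x => (Real.exp_pos _).le)]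
    exact (lintegral_exp_mul_withDensity_exp_neg κ t).trans_lt
      (hκ _ (sub_pos.mpr ht)).lt_top
  have hfinν := fun l hl => h l hl ▸ hfin l hl
  have := hfinite μ hfin
  have := hfinite ν hfinν
  refine withDensity_exp_neg_injective (measure_eq_of_mgf_eqOn isOpen_Iio (convex_Iio 1)
    (Set.mem_Iio.mpr one_pos) (hint μ hfin) (hint ν hfinν) fun t ht => ?_)
  rw [mgf_id_withDensity_exp_neg, mgf_id_withDensity_exp_neg, h _ (sub_pos.mpr ht)]

/-! ### Changes of variables and Beta integrals -/

theorem setLIntegral_image_mul_left {c : ℝ} (hc : 0 < c) {s : Set ℝ} (hs : MeasurableSet s)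
    (g : ℝ → ℝ≥0∞) :
    ∫⁻ y in (fun y => c * y) '' s, g y = ENNReal.ofReal c * ∫⁻ y in s, g (c * y) := by
  rw [lintegral_image_eq_lintegral_abs_deriv_mul (f' := fun _ => c) hs
    (fun y _ => by simpa using ((hasDerivAt_id y).const_mul c).hasDerivWithinAt)
    (mul_right_injective₀ hc.ne').injOn,
    lintegral_const_mul' _ _ ENNReal.ofReal_ne_top, abs_of_pos hc]

theorem setLIntegral_Ioo_mul_left {c : ℝ} (hc : 0 < c) (x : ℝ) (g : ℝ → ℝ≥0∞) :
    ∫⁻ y in Set.Ioo 0 (c * x), g y = ENNReal.ofReal c * ∫⁻ y in Set.Ioo 0 x, g (c * y) := by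
  rw [← setLIntegral_image_mul_left hc measurableSet_Ioo, Set.image_mul_left_Ioo hc, mul_zero]

theorem setLIntegral_Ioi_mul_left {c : ℝ} (hc : 0 < c) (g : ℝ → ℝ≥0∞) :
    ∫⁻ y in Set.Ioi 0, g y = ENNReal.ofReal c * ∫⁻ y in Set.Ioi (0 : ℝ), g (c * y) := by
  rw [← setLIntegral_image_mul_left hc measurableSet_Ioi, Set.image_mul_left_Ioi hc, mul_zero]

theorem setLIntegral_Ioi_add_left (μ : Measure ℝ) [μ.IsAddLeftInvariant] (c a : ℝ)
    (g : ℝ → ℝ≥0∞) :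
    ∫⁻ y in Set.Ioi a, g (c + y) ∂μ = ∫⁻ y in Set.Ioi (c + a), g y ∂μ := by
  rw [← (measurePreserving_add_left μ c).setLIntegral_comp_preimage_emb
    (measurableEmbedding_addLeft c) g (Set.Ioi (c + a))]
  simp

theorem setLIntegral_Ioi_Ioi_swap (μ : Measure ℝ) [SFinite μ] {f : ℝ → ℝ → ℝ≥0∞}
    (hf : Measurable (Function.uncurry f)) (a : ℝ) :
    ∫⁻ u in Set.Ioi a, ∫⁻ t in Set.Ioi u, f u t ∂μ ∂μ =
      ∫⁻ t in Set.Ioi a, ∫⁻ u in Set.Ioo a t, f u t ∂μ ∂μ := by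
  have hmeas : Measurable (Function.uncurry fun u => (Set.Ioi u).indicator (f u)) :=
    hf.indicator (measurableSet_lt measurable_fst measurable_snd)
  calc ∫⁻ u in Set.Ioi a, ∫⁻ t in Set.Ioi u, f u t ∂μ ∂μ
      = ∫⁻ u in Set.Ioi a, ∫⁻ t in Set.Ioi a, (Set.Ioi u).indicator (f u) t ∂μ ∂μ := by
        refine setLIntegral_congr_fun measurableSet_Ioi fun u hu => ?_
        rw [setLIntegral_indicator measurableSet_Ioi,
          Set.inter_eq_left.mpr (Set.Ioi_subset_Ioi (le_of_lt hu))]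
    _ = ∫⁻ t in Set.Ioi a, ∫⁻ u in Set.Ioi a, (Set.Iio t).indicator (fun u => f u t) u ∂μ ∂μ :=
        lintegral_lintegral_swap hmeas.aemeasurable
    _ = ∫⁻ t in Set.Ioi a, ∫⁻ u in Set.Ioo a t, f u t ∂μ ∂μ := by
        refine lintegral_congr fun t => ?_
        rw [setLIntegral_indicator measurableSet_Iio, Set.Iio_inter_Ioi]

theorem lintegral_Ioo_zero_one_beta {p q : ℝ} (hp : 0 < p) (hq : 0 < q) :
    ∫⁻ y in Set.Ioo (0 : ℝ) 1, ENNReal.ofReal (y ^ (p - 1) * (1 - y) ^ (q - 1)) =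
      ENNReal.ofReal (beta p q) := by
  have hb := beta_pos hp hq
  have h := lintegral_betaPDF_eq_one hp hq
  simp_rw [lintegral_betaPDF, mul_assoc, ENNReal.ofReal_mul (one_div_pos.mpr hb).le] at h
  rw [lintegral_const_mul' _ _ ENNReal.ofReal_ne_top, mul_comm, one_div,
    ENNReal.ofReal_inv_of_pos hb] at h
  exact (ENNReal.eq_inv_of_mul_eq_one_left h).trans (inv_inv _)

theorem lintegral_Ioo_beta {p q x : ℝ} (hp : 0 < p) (hq : 0 < q) (hx : 0 < x) :
    ∫⁻ y in Set.Ioo 0 x, ENNReal.ofReal (y ^ (p - 1) * (x - y) ^ (q - 1)) =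
      ENNReal.ofReal (x ^ (p + q - 1) * beta p q) := by
  rw [← mul_one x, setLIntegral_Ioo_mul_left hx, mul_one, ENNReal.ofReal_mul (by positivity),
    ← lintegral_Ioo_zero_one_beta hp hq, ← lintegral_const_mul' _ _ ENNReal.ofReal_ne_top,
    ← lintegral_const_mul' _ _ ENNReal.ofReal_ne_top]
  refine setLIntegral_congr_fun measurableSet_Ioo fun y hy => ?_
  rw [← ENNReal.ofReal_mul hx.le, ← ENNReal.ofReal_mul (by positivity)]
  congr 1
  rw [← mul_one_sub, Real.mul_rpow hx.le hy.1.le, Real.mul_rpow hx.le (by linarith [hy.2]),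
    show p + q - 1 = 1 + (p - 1) + (q - 1) by ring, Real.rpow_add hx, Real.rpow_add hx,
    Real.rpow_one]
  ring

theorem bijOn_div_one_sub :
    Set.BijOn (fun v : ℝ => v / (1 - v)) (Set.Ioo 0 1) (Set.Ioi 0) := by
  refine Set.InvOn.bijOn (f' := fun u => u / (1 + u)) ⟨fun v hv => ?_, fun u hu => ?_⟩
    (fun v hv => div_pos hv.1 (sub_pos.mpr hv.2)) fun u (hu : 0 < u) => ⟨by positivity, ?_⟩
  · have : 0 < 1 - v := sub_pos.mpr hv.2
    simp only; field_simp; ring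
  · have : 0 < u := hu
    simp only; field_simp; ring
  · rw [div_lt_one (by positivity)]; linarith

theorem lintegral_Ioi_beta {p q : ℝ} (hp : 0 < p) (hq : 0 < q) :
    ∫⁻ u in Set.Ioi (0 : ℝ), ENNReal.ofReal (u ^ (p - 1) * (1 + u) ^ (-(p + q))) =
      ENNReal.ofReal (beta p q) := by
  have hderiv : ∀ v ∈ Set.Ioo (0 : ℝ) 1,
      HasDerivWithinAt (fun v : ℝ => v / (1 - v)) ((1 - v) ^ (-2 : ℝ)) (Set.Ioo 0 1) v := by
    intro v hv
    have hv1 : 0 < 1 - v := sub_pos.mpr hv.2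
    refine (((hasDerivAt_id v).div ((hasDerivAt_id v).const_sub 1)
      hv1.ne').hasDerivWithinAt).congr_deriv ?_
    rw [Real.rpow_neg hv1.le, Real.rpow_two]
    simp only [id]; field_simp; ring
  rw [← bijOn_div_one_sub.image_eq, lintegral_image_eq_lintegral_abs_deriv_mul measurableSet_Ioo
    hderiv bijOn_div_one_sub.injOn, ← lintegral_Ioo_zero_one_beta hp hq]
  refine setLIntegral_congr_fun measurableSet_Ioo fun v hv => ?_
  have hv0 := hv.1
  have hv1 : 0 < 1 - v := sub_pos.mpr hv.2
  have hone_add : 1 + v / (1 - v) = (1 - v)⁻¹ := by field_simp; ring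
  have hpow : (1 - v) ^ (q - 1) = (1 - v) ^ (-2 : ℝ) * (1 - v) ^ (p + q) / (1 - v) ^ (p - 1) := by
    rw [← Real.rpow_add hv1, ← Real.rpow_sub hv1]; ring_nf
  rw [abs_of_pos (by positivity), ← ENNReal.ofReal_mul (by positivity), hone_add,
    Real.inv_rpow hv1.le, Real.rpow_neg hv1.le (p + q), inv_inv, Real.div_rpow hv0.le hv1.le, hpow]
  ring_nf

theorem bijOn_mul_div_one_add_sub_mul {t : ℝ} (ht : 0 < t) :
    Set.BijOn (fun w : ℝ => t * w / (1 + t - t * w)) (Set.Ioo 0 1) (Set.Ioo 0 t) := by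
  refine Set.InvOn.bijOn (f' := fun u => u * (1 + t) / (t * (1 + u)))
    ⟨fun w hw => ?_, fun u hu => ?_⟩ (fun w hw => ?_) fun u hu => ?_
  · have hE : 0 < 1 + t - t * w := by nlinarith [hw.2]
    have : 1 + t * w / (1 + t - t * w) = (1 + t) / (1 + t - t * w) := by field_simp; ring
    simp only [this]; field_simp
  · have := hu.1
    have : 1 + t - t * (u * (1 + t) / (t * (1 + u))) = (1 + t) / (1 + u) := by field_simp; ring
    simp only [this]; field_simp
  · have := hw.1
    have : 0 < 1 + t - t * w := by nlinarith [hw.2]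
    exact ⟨by positivity, by rw [div_lt_iff₀ this]; nlinarith [hw.2, mul_pos ht ht]⟩
  · have := hu.1
    exact ⟨by positivity, by rw [div_lt_one (by positivity)]; nlinarith [hu.2]⟩

theorem lintegral_Ioo_rpow_mul_sub_rpow_mul_one_add_rpow {p q t : ℝ} (hp : 0 < p) (hq : 0 < q)
    (ht : 0 < t) :
    ∫⁻ u in Set.Ioo 0 t,
        ENNReal.ofReal (u ^ (p - 1) * (t - u) ^ (q - 1) * (1 + u) ^ (-(p + q))) =
      ENNReal.ofReal (t ^ (p + q - 1) * (1 + t) ^ (-p) * beta p q) := by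
  have hpos : ∀ w ∈ Set.Ioo (0 : ℝ) 1, 0 < 1 + t - t * w := fun w hw => by nlinarith [hw.2]
  have hderiv : ∀ w ∈ Set.Ioo (0 : ℝ) 1,
      HasDerivWithinAt (fun w : ℝ => t * w / (1 + t - t * w))
        (t * (1 + t) / (1 + t - t * w) ^ 2) (Set.Ioo 0 1) w := by
    intro w hw
    have hmul : HasDerivAt (fun w : ℝ => t * w) t w := by
      simpa using (hasDerivAt_id w).const_mul t
    refine ((hmul.div (hmul.const_sub (1 + t)) (hpos w hw).ne').hasDerivWithinAt).congr_deriv ?_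
    congr 1; ring
  rw [← (bijOn_mul_div_one_add_sub_mul ht).image_eq, lintegral_image_eq_lintegral_abs_deriv_mul
    measurableSet_Ioo hderiv (bijOn_mul_div_one_add_sub_mul ht).injOn,
    ENNReal.ofReal_mul (by positivity), ← lintegral_Ioo_zero_one_beta hp hq,
    ← lintegral_const_mul' _ _ ENNReal.ofReal_ne_top]
  refine setLIntegral_congr_fun measurableSet_Ioo fun w hw => ?_
  have hw0 := hw.1
  have hw1 : 0 < 1 - w := sub_pos.mpr hw.2
  have hE := hpos w hw
  have hone_add : 1 + t * w / (1 + t - t * w) = (1 + t) / (1 + t - t * w) := by field_simp; ring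
  have hsub : t - t * w / (1 + t - t * w) = t * (1 + t) * (1 - w) / (1 + t - t * w) := by
    field_simp; ring
  rw [abs_of_pos (by positivity), ← ENNReal.ofReal_mul (by positivity),
    ← ENNReal.ofReal_mul (by positivity), hone_add, hsub]
  congr 1
  generalize 1 + t - t * w = E at hE
  rw [Real.div_rpow (by positivity) hE.le, Real.div_rpow (by positivity) hE.le,
    Real.div_rpow (by positivity) hE.le, Real.mul_rpow (by positivity) hw1.le,
    Real.mul_rpow ht.le hw0.le,
    Real.mul_rpow ht.le (by positivity : (0 : ℝ) ≤ 1 + t), neg_add,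
    Real.rpow_add hE, Real.rpow_add (by positivity : 0 < 1 + t), Real.rpow_neg hE.le q,
    Real.rpow_neg (by positivity : 0 ≤ 1 + t) q, add_sub_assoc, Real.rpow_add ht p,
    Real.rpow_neg hE.le p, Real.rpow_sub hE, Real.rpow_sub hE, Real.rpow_sub ht,
    Real.rpow_sub (by positivity : 0 < 1 + t), Real.rpow_one, Real.rpow_one, Real.rpow_one]
  field_simp

theorem beta_one_sub (β : ℝ) : beta β (1 - β) = Real.pi / Real.sin (Real.pi * β) := by
  rw [beta, Real.Gamma_mul_Gamma_one_sub]; simp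

theorem sin_pi_mul_pos {β : ℝ} (h0 : 0 < β) (h1 : β < 1) : 0 < Real.sin (Real.pi * β) :=
  Real.sin_pos_of_pos_of_lt_pi (by positivity) (by nlinarith [Real.pi_pos])

/-! ### The law of the overshoot -/

/-- The generalized arcsine density of the overshoot over the level `1`. -/
noncomputable def overshootDensity (β u : ℝ) : ℝ :=
  Real.sin (Real.pi * β) / Real.pi * (u ^ (-β) / (1 + u))

/-- The law of the overshoot of a `β`-stable subordinator over the level `1`. -/
noncomputable def overshootLaw (β : ℝ) : Measure ℝ :=
  (volume.restrict (Set.Ioi 0)).withDensity fun u => ENNReal.ofReal (overshootDensity β u)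

/-- The renewal identity `(δ₁ * ν) * U = U` on `(1, ∞)` for the potential measure
`U(dx) = x ^ (β - 1) dx`, translated by `-1`. -/
def HasPotentialIdentity (β : ℝ) (ν : Measure ℝ) : Prop :=
  ∀ φ : ℝ → ℝ≥0∞, Measurable φ →
    ∫⁻ b, (∫⁻ y in Set.Ioi (0 : ℝ), φ (b + y) * ENNReal.ofReal (y ^ (β - 1))) ∂ν =
      ∫⁻ t in Set.Ioi (0 : ℝ), φ t * ENNReal.ofReal ((1 + t) ^ (β - 1))

@[fun_prop]
theorem measurable_overshootDensity (β : ℝ) : Measurable (overshootDensity β) := by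
  unfold overshootDensity; fun_prop

theorem lintegral_overshootLaw (β : ℝ) {f : ℝ → ℝ≥0∞} (hf : Measurable f) :
    ∫⁻ u, f u ∂(overshootLaw β) =
      ∫⁻ u in Set.Ioi 0, ENNReal.ofReal (overshootDensity β u) * f u := by
  rw [overshootLaw, lintegral_withDensity_eq_lintegral_mul _ (by fun_prop) hf]
  rfl

theorem ae_overshootLaw_pos (β : ℝ) : ∀ᵐ u ∂(overshootLaw β), 0 < u :=
  (withDensity_absolutelyContinuous _ _).ae_le (ae_restrict_mem measurableSet_Ioi)

theorem lintegral_Ioo_overshootDensity_mul_sub_rpow {β t : ℝ} (h0 : 0 < β) (h1 : β < 1)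
    (ht : 0 < t) :
    ∫⁻ u in Set.Ioo 0 t, ENNReal.ofReal (overshootDensity β u) *
        ENNReal.ofReal ((t - u) ^ (β - 1)) =
      ENNReal.ofReal ((1 + t) ^ (β - 1)) := by
  have hsin := sin_pi_mul_pos h0 h1
  have hbeta : beta (1 - β) β = Real.pi / Real.sin (Real.pi * β) := by
    rw [← beta_one_sub, beta, beta, mul_comm, add_comm]
  have hconv := lintegral_Ioo_rpow_mul_sub_rpow_mul_one_add_rpow (sub_pos.mpr h1) h0 ht
  calc ∫⁻ u in Set.Ioo 0 t, ENNReal.ofReal (overshootDensity β u) *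
        ENNReal.ofReal ((t - u) ^ (β - 1))
      = ∫⁻ u in Set.Ioo 0 t, ENNReal.ofReal (Real.sin (Real.pi * β) / Real.pi) *
          ENNReal.ofReal (u ^ ((1 - β) - 1) * (t - u) ^ (β - 1) * (1 + u) ^ (-((1 - β) + β))) := by
        refine setLIntegral_congr_fun measurableSet_Ioo fun u hu => ?_
        have := hu.1
        rw [← ENNReal.ofReal_mul (by unfold overshootDensity; positivity),
          ← ENNReal.ofReal_mul (by positivity), overshootDensity, sub_add_cancel,
          Real.rpow_neg_one, sub_sub_cancel_left]
        ring_nf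
    _ = ENNReal.ofReal ((1 + t) ^ (β - 1)) := by
        rw [lintegral_const_mul' _ _ ENNReal.ofReal_ne_top, hconv,
          ← ENNReal.ofReal_mul (by positivity), hbeta, sub_add_cancel, sub_self, Real.rpow_zero,
          neg_sub]
        congr 1
        field_simp

theorem hasPotentialIdentity_overshootLaw {β : ℝ} (h0 : 0 < β) (h1 : β < 1) :
    HasPotentialIdentity β (overshootLaw β) := by
  intro φ hφ
  have hmeas : Measurable fun b => ∫⁻ y in Set.Ioi (0 : ℝ),
      φ (b + y) * ENNReal.ofReal (y ^ (β - 1)) :=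
    Measurable.lintegral_prod_right'
      (f := fun p : ℝ × ℝ => φ (p.1 + p.2) * ENNReal.ofReal (p.2 ^ (β - 1))) (by fun_prop)
  calc ∫⁻ b, (∫⁻ y in Set.Ioi (0 : ℝ), φ (b + y) * ENNReal.ofReal (y ^ (β - 1))) ∂overshootLaw β
      = ∫⁻ u in Set.Ioi (0 : ℝ), ∫⁻ t in Set.Ioi u, ENNReal.ofReal (overshootDensity β u) *
          (φ t * ENNReal.ofReal ((t - u) ^ (β - 1))) := by
        rw [lintegral_overshootLaw β hmeas]
        refine lintegral_congr fun u => ?_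
        rw [lintegral_const_mul' _ _ ENNReal.ofReal_ne_top]
        simpa using congrArg (ENNReal.ofReal (overshootDensity β u) * ·)
          (setLIntegral_Ioi_add_left volume u 0 fun t => φ t * ENNReal.ofReal ((t - u) ^ (β - 1)))
    _ = ∫⁻ t in Set.Ioi (0 : ℝ), ∫⁻ u in Set.Ioo 0 t, ENNReal.ofReal (overshootDensity β u) *
          (φ t * ENNReal.ofReal ((t - u) ^ (β - 1))) :=
        setLIntegral_Ioi_Ioi_swap volume (by simp only [Function.uncurry_def]; fun_prop) 0
    _ = ∫⁻ t in Set.Ioi (0 : ℝ), φ t * ENNReal.ofReal ((1 + t) ^ (β - 1)) := by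
        refine setLIntegral_congr_fun measurableSet_Ioi fun t ht => ?_
        simp_rw [mul_left_comm _ (φ t)]
        rw [lintegral_const_mul _ (by fun_prop),
          lintegral_Ioo_overshootDensity_mul_sub_rpow h0 h1 ht]

-- This inverts the convolution with `y ^ (β - 1)`.
theorem lintegral_Ioi_indicator_Iio_rpow_mul_rpow {β : ℝ} (h0 : 0 < β) (h1 : β < 1) (x b : ℝ) :
    ∫⁻ y in Set.Ioi (0 : ℝ),
        (Set.Iio x).indicator (fun t => ENNReal.ofReal ((x - t) ^ (-β))) (b + y) *
          ENNReal.ofReal (y ^ (β - 1)) =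
      (Set.Iio x).indicator (fun _ => ENNReal.ofReal (beta β (1 - β))) b := by
  calc ∫⁻ y in Set.Ioi (0 : ℝ),
        (Set.Iio x).indicator (fun t => ENNReal.ofReal ((x - t) ^ (-β))) (b + y) *
          ENNReal.ofReal (y ^ (β - 1))
      = ∫⁻ y in Set.Ioi (0 : ℝ), (Set.Iio (x - b)).indicator
          (fun y => ENNReal.ofReal (y ^ (β - 1) * (x - b - y) ^ ((1 - β) - 1))) y := by
        refine setLIntegral_congr_fun measurableSet_Ioi fun y (hy : 0 < y) => ?_
        simp only [Set.indicator_apply, Set.mem_Iio, lt_sub_iff_add_lt', ite_mul, zero_mul,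
          sub_sub_cancel_left, sub_add_eq_sub_sub, mul_comm (y ^ (β - 1)),
          ENNReal.ofReal_mul' (Real.rpow_nonneg hy.le _)]
    _ = ∫⁻ y in Set.Ioo 0 (x - b),
          ENNReal.ofReal (y ^ (β - 1) * (x - b - y) ^ ((1 - β) - 1)) := by
        rw [setLIntegral_indicator measurableSet_Iio, Set.Iio_inter_Ioi]
    _ = (Set.Iio x).indicator (fun _ => ENNReal.ofReal (beta β (1 - β))) b := by
        by_cases hb : b < x
        · rw [lintegral_Ioo_beta h0 (sub_pos.mpr h1) (sub_pos.mpr hb),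
            Set.indicator_of_mem (Set.mem_Iio.mpr hb)]
          simp
        · rw [Set.indicator_of_notMem (mt Set.mem_Iio.mp hb), Set.Ioo_eq_empty (by linarith)]
          simp

theorem HasPotentialIdentity.measure_Iio {β : ℝ} (h0 : 0 < β) (h1 : β < 1) {ν : Measure ℝ}
    (h : HasPotentialIdentity β ν) (x : ℝ) :
    ν (Set.Iio x) * ENNReal.ofReal (beta β (1 - β)) =
      ∫⁻ t in Set.Ioi (0 : ℝ), (Set.Iio x).indicator (fun t => ENNReal.ofReal ((x - t) ^ (-β))) t *
        ENNReal.ofReal ((1 + t) ^ (β - 1)) := by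
  rw [← h _ ((by fun_prop : Measurable fun t : ℝ => ENNReal.ofReal ((x - t) ^ (-β))).indicator
    measurableSet_Iio),
    lintegral_congr (lintegral_Ioi_indicator_Iio_rpow_mul_rpow h0 h1 x),
    lintegral_indicator_const measurableSet_Iio, mul_comm]

theorem HasPotentialIdentity.measure_eq {β : ℝ} (h0 : 0 < β) (h1 : β < 1) {ν κ : Measure ℝ}
    [IsProbabilityMeasure ν] [IsProbabilityMeasure κ] (hν : HasPotentialIdentity β ν)
    (hκ : HasPotentialIdentity β κ) : ν = κ := by
  have hbeta : ENNReal.ofReal (beta β (1 - β)) ≠ 0 := by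
    simpa using beta_pos h0 (sub_pos.mpr h1)
  have hIio : ∀ x, ν (Set.Iio x) = κ (Set.Iio x) := fun x =>
    (ENNReal.mul_left_inj hbeta ENNReal.ofReal_ne_top).mp
      ((hν.measure_Iio h0 h1 x).trans (hκ.measure_Iio h0 h1 x).symm)
  refine Measure.ext_of_Ici _ _ fun x => ?_
  rw [← Set.compl_Iio, prob_compl_eq_one_sub measurableSet_Iio,
    prob_compl_eq_one_sub measurableSet_Iio, hIio]

theorem lintegral_rpow_overshootLaw {β s : ℝ} (h0 : 0 < β) (h1 : β < 1) (hs : 0 ≤ s)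
    (hsβ : s < β) :
    ∫⁻ u, ENNReal.ofReal (u ^ s) ∂(overshootLaw β) =
      ENNReal.ofReal (Real.sin (Real.pi * β) / Real.sin (Real.pi * (β - s))) := by
  have hsin := sin_pi_mul_pos h0 h1
  have hbeta : beta (1 - β + s) (β - s) = Real.pi / Real.sin (Real.pi * (β - s)) := by
    rw [← beta_one_sub, beta, beta, mul_comm]
    ring_nf
  calc ∫⁻ u, ENNReal.ofReal (u ^ s) ∂(overshootLaw β)
      = ∫⁻ u in Set.Ioi (0 : ℝ), ENNReal.ofReal (Real.sin (Real.pi * β) / Real.pi) *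
          ENNReal.ofReal (u ^ ((1 - β + s) - 1) * (1 + u) ^ (-((1 - β + s) + (β - s)))) := by
        rw [lintegral_overshootLaw β (by fun_prop)]
        refine setLIntegral_congr_fun measurableSet_Ioi fun u (hu : 0 < u) => ?_
        rw [← ENNReal.ofReal_mul (by unfold overshootDensity; positivity),
          ← ENNReal.ofReal_mul (by positivity), overshootDensity,
          show -((1 - β + s) + (β - s)) = -1 by ring, Real.rpow_neg_one,
          show (1 - β + s) - 1 = -β + s by ring, Real.rpow_add hu]
        ring_nf
    _ = ENNReal.ofReal (Real.sin (Real.pi * β) / Real.sin (Real.pi * (β - s))) := by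
        rw [lintegral_const_mul' _ _ ENNReal.ofReal_ne_top,
          lintegral_Ioi_beta (by linarith) (by linarith), ← ENNReal.ofReal_mul (by positivity),
          hbeta]
        congr 1
        field_simp

theorem isProbabilityMeasure_overshootLaw {β : ℝ} (h0 : 0 < β) (h1 : β < 1) :
    IsProbabilityMeasure (overshootLaw β) :=
  ⟨by simpa [div_self (sin_pi_mul_pos h0 h1).ne'] using lintegral_rpow_overshootLaw h0 h1 le_rfl h0⟩

-- The difference of the two sides is `sin (π * s) * sin (π * (β₁ + β₂ - s - 1))`.
theorem sin_mul_sin_lt_sin_sub_mul_sin_sub {β₁ β₂ s : ℝ} (hβ : β₁ + β₂ ≤ 2) (hs : 0 < s)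
    (hsβ : s < β₁ + β₂ - 1) :
    Real.sin (Real.pi * β₁) * Real.sin (Real.pi * β₂) <
      Real.sin (Real.pi * (β₁ - s)) * Real.sin (Real.pi * (β₂ - s)) := by
  have hdiff : ∀ x y z : ℝ, Real.sin (x - z) * Real.sin (y - z) - Real.sin x * Real.sin y =
      -(Real.sin z * Real.sin (x + y - z)) := fun x y z => by
    simp only [Real.sin_sub, Real.sin_add, Real.cos_add]
    linear_combination (Real.sin x * Real.sin y) * Real.sin_sq_add_cos_sq z
  have hshift : Real.sin (Real.pi * β₁ + Real.pi * β₂ - Real.pi * s) =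
      -Real.sin (Real.pi * (β₁ + β₂ - s - 1)) := by
    rw [← Real.sin_add_pi]; ring_nf
  have hpos := mul_pos (sin_pi_mul_pos hs (by linarith : s < 1))
    (sin_pi_mul_pos (by linarith : 0 < β₁ + β₂ - s - 1) (by linarith))
  have := hdiff (Real.pi * β₁) (Real.pi * β₂) (Real.pi * s)
  rw [hshift] at this
  rw [mul_sub, mul_sub]
  linarith

theorem overshootLaw_moments_mul_lt_one {β₁ β₂ s : ℝ} (hβ₁ : β₁ ≤ 1) (hβ₂ : β₂ ≤ 1) (hs : 0 < s)
    (hsβ : s < β₁ + β₂ - 1) :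
    Real.sin (Real.pi * β₁) / Real.sin (Real.pi * (β₁ - s)) *
      (Real.sin (Real.pi * β₂) / Real.sin (Real.pi * (β₂ - s))) < 1 := by
  have h₁ := sin_pi_mul_pos (β := β₁ - s) (by linarith) (by linarith)
  have h₂ := sin_pi_mul_pos (β := β₂ - s) (by linarith) (by linarith)
  rw [div_mul_div_comm, div_lt_one (by positivity)]
  exact sin_mul_sin_lt_sin_sub_mul_sin_sub (by linarith) hs hsβ

/-! ### The distribution function of the first intersection time -/

/-- The distribution function of the first intersection time at distance `1`, written as a
convolution integral with values in `ℝ≥0∞`; after the substitution `t = x y` this is `P_D(x | 1)`.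
-/
noncomputable def hittingCDF (β₁ β₂ x : ℝ) : ℝ≥0∞ :=
  ENNReal.ofReal (1 / (Real.Gamma (β₁ + β₂ - 1) * Real.Gamma (1 - (β₁ + β₂ - 1)))) *
    ∫⁻ t in Set.Ioo 0 x,
      ENNReal.ofReal ((1 + t) ^ (β₁ - 1) * t ^ (β₂ - 1) * (x - t) ^ (-(β₁ + β₂ - 1)))

/-- The integrand of `P_D(x | a)`, with `c` in place of `a / x`. -/
noncomputable def hittingKernel (β₁ β₂ c y : ℝ) : ℝ :=
  (c + y) ^ (β₁ - 1) * y ^ (β₂ - 1) * (1 - y) ^ (-(β₁ + β₂ - 1))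

@[fun_prop]
theorem measurable_hittingKernel (β₁ β₂ c : ℝ) : Measurable (hittingKernel β₁ β₂ c) := by
  unfold hittingKernel; fun_prop

theorem hittingKernel_nonneg (β₁ β₂ : ℝ) {c y : ℝ} (hc : 0 ≤ c) (hy : y ∈ Set.Ioo (0 : ℝ) 1) :
    0 ≤ hittingKernel β₁ β₂ c y := by
  have := hy.1
  have := sub_pos.mpr hy.2
  unfold hittingKernel
  positivity

theorem hittingKernel_anti {β₁ : ℝ} (hβ₁ : β₁ ≤ 1) (β₂ : ℝ) {c d y : ℝ} (hc : 0 ≤ c) (hcd : c ≤ d)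
    (hy : y ∈ Set.Ioo (0 : ℝ) 1) : hittingKernel β₁ β₂ d y ≤ hittingKernel β₁ β₂ c y := by
  have := hy.1
  have := sub_pos.mpr hy.2
  unfold hittingKernel
  gcongr ?_ * _ * _
  exact Real.rpow_le_rpow_of_nonpos (by positivity) (by gcongr) (by linarith)

theorem hittingCDF_of_nonpos (β₁ β₂ : ℝ) {x : ℝ} (hx : x ≤ 0) : hittingCDF β₁ β₂ x = 0 := by
  simp [hittingCDF, Set.Ioo_eq_empty hx.not_gt]

theorem rpow_mul_rpow_mul_rpow_neg_of_smul (β₁ β₂ : ℝ) {c u v w : ℝ} (hc : 0 < c) (hu : 0 ≤ u)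
    (hv : 0 ≤ v) (hw : 0 ≤ w) :
    c * ((c * u) ^ (β₁ - 1) * (c * v) ^ (β₂ - 1) * (c * w) ^ (-(β₁ + β₂ - 1))) =
      u ^ (β₁ - 1) * v ^ (β₂ - 1) * w ^ (-(β₁ + β₂ - 1)) := by
  have hc_pow : c * (c ^ (β₁ - 1) * c ^ (β₂ - 1) * c ^ (-(β₁ + β₂ - 1))) = 1 := by
    rw [← Real.rpow_add hc, ← Real.rpow_add hc,
      show β₁ - 1 + (β₂ - 1) + -(β₁ + β₂ - 1) = -1 by ring, Real.rpow_neg_one,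
      mul_inv_cancel₀ hc.ne']
  rw [Real.mul_rpow hc.le hu, Real.mul_rpow hc.le hv, Real.mul_rpow hc.le hw]
  linear_combination (u ^ (β₁ - 1) * v ^ (β₂ - 1) * w ^ (-(β₁ + β₂ - 1))) * hc_pow

theorem hittingCDF_eq_lintegral_hittingKernel (β₁ β₂ : ℝ) {x : ℝ} (hx : 0 < x) :
    hittingCDF β₁ β₂ x =
      ENNReal.ofReal (1 / (Real.Gamma (β₁ + β₂ - 1) * Real.Gamma (1 - (β₁ + β₂ - 1)))) *
        ∫⁻ y in Set.Ioo (0 : ℝ) 1, ENNReal.ofReal (hittingKernel β₁ β₂ (1 / x) y) := by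
  have hsubst := setLIntegral_Ioo_mul_left hx 1 fun t =>
    ENNReal.ofReal ((1 + t) ^ (β₁ - 1) * t ^ (β₂ - 1) * (x - t) ^ (-(β₁ + β₂ - 1)))
  rw [mul_one] at hsubst
  rw [hittingCDF, hsubst, ← lintegral_const_mul' _ _ ENNReal.ofReal_ne_top]
  congr 1
  refine setLIntegral_congr_fun measurableSet_Ioo fun y hy => ?_
  have hy0 := hy.1
  have hy1 := sub_pos.mpr hy.2
  rw [← ENNReal.ofReal_mul hx.le, show 1 + x * y = x * (1 / x + y) by field_simp,
    show x - x * y = x * (1 - y) by ring,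
    rpow_mul_rpow_mul_rpow_neg_of_smul β₁ β₂ hx (by positivity) hy0.le hy1.le, hittingKernel]

theorem gamma_mul_gamma_one_sub_pos {h : ℝ} (h0 : 0 < h) (h1 : h < 1) :
    0 < Real.Gamma h * Real.Gamma (1 - h) :=
  mul_pos (Real.Gamma_pos_of_pos h0) (Real.Gamma_pos_of_pos (sub_pos.mpr h1))

theorem intersectionCDF_eq_toReal {β₁ β₂ x : ℝ} (h0 : 0 < β₁ + β₂ - 1) (h1 : β₁ + β₂ - 1 < 1)
    (hx : 0 < x) : intersectionCDF β₁ β₂ x 1 = (hittingCDF β₁ β₂ x).toReal := by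
  rw [intersectionCDF, hittingCDF_eq_lintegral_hittingKernel β₁ β₂ hx, ENNReal.toReal_mul,
    ENNReal.toReal_ofReal (one_div_pos.mpr (gamma_mul_gamma_one_sub_pos h0 h1)).le,
    intervalIntegral.integral_of_le zero_le_one, integral_Ioc_eq_integral_Ioo]
  congr 1
  refine integral_eq_lintegral_of_nonneg_ae (f := hittingKernel β₁ β₂ (1 / x)) ?_ (by fun_prop)
  filter_upwards [ae_restrict_mem measurableSet_Ioo] with y hy
  exact hittingKernel_nonneg β₁ β₂ (by positivity) hy

theorem lintegral_rpow_neg_mul_hittingKernel_zero {β₁ β₂ r : ℝ} (hr : r < β₁ + β₂ - 1)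
    (h1 : β₁ + β₂ - 1 < 1) :
    ∫⁻ y in Set.Ioo (0 : ℝ) 1, ENNReal.ofReal (y ^ (-r) * hittingKernel β₁ β₂ 0 y) =
      ENNReal.ofReal (beta (β₁ + β₂ - 1 - r) (1 - (β₁ + β₂ - 1))) := by
  rw [← lintegral_Ioo_zero_one_beta (by linarith) (by linarith)]
  refine setLIntegral_congr_fun measurableSet_Ioo fun y hy => ?_
  rw [hittingKernel, zero_add, ← mul_assoc, ← mul_assoc, ← Real.rpow_add hy.1,
    ← Real.rpow_add hy.1]
  congr 3 <;> ring

theorem gamma_inv_mul_lintegral_hittingKernel_zero {β₁ β₂ : ℝ} (h0 : 0 < β₁ + β₂ - 1)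
    (h1 : β₁ + β₂ - 1 < 1) :
    ENNReal.ofReal (1 / (Real.Gamma (β₁ + β₂ - 1) * Real.Gamma (1 - (β₁ + β₂ - 1)))) *
      ∫⁻ y in Set.Ioo (0 : ℝ) 1, ENNReal.ofReal (hittingKernel β₁ β₂ 0 y) = 1 := by
  have hΓ := gamma_mul_gamma_one_sub_pos h0 h1
  have hint := lintegral_rpow_neg_mul_hittingKernel_zero h0 h1
  simp only [neg_zero, Real.rpow_zero, one_mul, sub_zero] at hint
  rw [hint, ← ENNReal.ofReal_mul (by positivity), beta, add_sub_cancel, Real.Gamma_one, div_one,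
    one_div_mul_cancel hΓ.ne', ENNReal.ofReal_one]

theorem hittingCDF_le_one {β₁ β₂ : ℝ} (hβ₁ : β₁ ≤ 1) (h0 : 0 < β₁ + β₂ - 1)
    (h1 : β₁ + β₂ - 1 < 1) (x : ℝ) : hittingCDF β₁ β₂ x ≤ 1 := by
  rcases le_or_gt x 0 with hx | hx
  · simp [hittingCDF_of_nonpos β₁ β₂ hx]
  rw [hittingCDF_eq_lintegral_hittingKernel β₁ β₂ hx,
    ← gamma_inv_mul_lintegral_hittingKernel_zero h0 h1]
  gcongr ENNReal.ofReal _ * ?_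
  exact setLIntegral_mono' measurableSet_Ioo fun y hy => ENNReal.ofReal_le_ofReal
    (hittingKernel_anti hβ₁ β₂ le_rfl (by positivity) hy)

theorem monotone_hittingCDF {β₁ : ℝ} (hβ₁ : β₁ ≤ 1) (β₂ : ℝ) : Monotone (hittingCDF β₁ β₂) := by
  intro x z hxz
  rcases le_or_gt x 0 with hx | hx
  · simp [hittingCDF_of_nonpos β₁ β₂ hx]
  have hz := hx.trans_le hxz
  rw [hittingCDF_eq_lintegral_hittingKernel β₁ β₂ hx,
    hittingCDF_eq_lintegral_hittingKernel β₁ β₂ hz]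
  gcongr ENNReal.ofReal _ * ?_
  exact setLIntegral_mono' measurableSet_Ioo fun y hy => ENNReal.ofReal_le_ofReal
    (hittingKernel_anti hβ₁ β₂ (by positivity) (by gcongr) hy)

theorem one_le_one_add_inv_rpow_add {γ r w : ℝ} (hγ0 : -1 ≤ γ) (hr0 : 0 ≤ r) (hr1 : r ≤ 1)
    (hw : 0 < w) : 1 ≤ (1 + 1 / w) ^ γ + w ^ (-r) := by
  rcases le_or_gt w 1 with hw1 | hw1
  · have : 1 ≤ w ^ (-r) := Real.one_le_rpow_of_pos_of_le_one_of_nonpos hw hw1 (by linarith)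
    exact this.trans (le_add_of_nonneg_left (by positivity))
  · calc 1 = (1 + 1 / w) ^ (-1 : ℝ) + (1 + w) ^ (-1 : ℝ) := by
          rw [Real.rpow_neg_one, Real.rpow_neg_one]; field_simp; ring
      _ ≤ (1 + 1 / w) ^ γ + w ^ (-1 : ℝ) := by
          have : 0 < 1 / w := by positivity
          exact add_le_add (Real.rpow_le_rpow_of_exponent_le (by linarith) hγ0)
            (Real.rpow_le_rpow_of_nonpos hw (by linarith) (by norm_num))
      _ ≤ (1 + 1 / w) ^ γ + w ^ (-r) := by gcongr; exact hw1.le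

theorem hittingKernel_zero_le {β₁ β₂ r x y : ℝ} (hβ₁ : 0 ≤ β₁) (hr0 : 0 ≤ r) (hr1 : r ≤ 1)
    (hx : 0 < x) (hy : y ∈ Set.Ioo (0 : ℝ) 1) :
    hittingKernel β₁ β₂ 0 y ≤
      hittingKernel β₁ β₂ (1 / x) y + x ^ (-r) * (y ^ (-r) * hittingKernel β₁ β₂ 0 y) := by
  have hy0 := hy.1
  have hfactor : hittingKernel β₁ β₂ (1 / x) y =
      (1 + 1 / (x * y)) ^ (β₁ - 1) * hittingKernel β₁ β₂ 0 y := by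
    rw [hittingKernel, hittingKernel, zero_add,
      show 1 / x + y = (1 + 1 / (x * y)) * y by field_simp; ring,
      Real.mul_rpow (by positivity) hy0.le]
    ring
  have hw := one_le_one_add_inv_rpow_add (γ := β₁ - 1) (by linarith) hr0 hr1 (mul_pos hx hy0)
  rw [hfactor, ← mul_assoc, ← add_mul, ← Real.mul_rpow hx.le hy0.le]
  exact le_mul_of_one_le_left (hittingKernel_nonneg β₁ β₂ le_rfl hy) hw

theorem one_le_hittingCDF_add {β₁ β₂ r : ℝ} (hβ₁ : 0 ≤ β₁) (h1 : β₁ + β₂ - 1 < 1) (hr0 : 0 ≤ r)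
    (hr : r < β₁ + β₂ - 1) :
    ∃ C : ℝ, 0 ≤ C ∧ ∀ x, 0 < x → 1 ≤ hittingCDF β₁ β₂ x + ENNReal.ofReal (C * x ^ (-r)) := by
  have hΓ := gamma_mul_gamma_one_sub_pos (hr0.trans_lt hr) h1
  have hbeta := beta_pos (sub_pos.mpr hr) (sub_pos.mpr h1)
  refine ⟨1 / (Real.Gamma (β₁ + β₂ - 1) * Real.Gamma (1 - (β₁ + β₂ - 1))) *
    beta (β₁ + β₂ - 1 - r) (1 - (β₁ + β₂ - 1)), by positivity, fun x hx => ?_⟩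
  rw [hittingCDF_eq_lintegral_hittingKernel β₁ β₂ hx,
    ← gamma_inv_mul_lintegral_hittingKernel_zero (hr0.trans_lt hr) h1, mul_assoc,
    ENNReal.ofReal_mul (p := 1 / _) (by positivity), ← mul_add, mul_comm (beta _ _),
    ENNReal.ofReal_mul (by positivity), ← lintegral_rpow_neg_mul_hittingKernel_zero hr h1,
    ← lintegral_const_mul' (ENNReal.ofReal (x ^ (-r))) _ ENNReal.ofReal_ne_top,
    ← lintegral_add_left (by fun_prop)]
  gcongr ENNReal.ofReal _ * ?_
  refine setLIntegral_mono' measurableSet_Ioo fun y hy => ?_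
  have hy0 := hy.1
  have hkernel := hittingKernel_nonneg β₁ β₂ (c := 0) le_rfl hy
  rw [← ENNReal.ofReal_mul (by positivity),
    ← ENNReal.ofReal_add (hittingKernel_nonneg β₁ β₂ (by positivity) hy) (by positivity)]
  exact ENNReal.ofReal_le_ofReal (hittingKernel_zero_le hβ₁ hr0 (by linarith) hx hy)

theorem continuousAt_hittingCDF {β₁ β₂ x : ℝ} (hβ₁ : β₁ ≤ 1) (h0 : 0 < β₁ + β₂ - 1)
    (h1 : β₁ + β₂ - 1 < 1) (hx : 0 < x) : ContinuousAt (hittingCDF β₁ β₂) x := by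
  have hΓ := gamma_mul_gamma_one_sub_pos h0 h1
  refine ContinuousAt.congr (ENNReal.Tendsto.const_mul ?_ (Or.inr ENNReal.ofReal_ne_top))
    (Filter.eventuallyEq_of_mem (Ioi_mem_nhds hx) fun z hz =>
      (hittingCDF_eq_lintegral_hittingKernel β₁ β₂ hz).symm)
  refine tendsto_lintegral_filter_of_dominated_convergence
    (fun y => ENNReal.ofReal (hittingKernel β₁ β₂ 0 y))
    (.of_forall fun z => by fun_prop) ?_ ?_ ?_
  · filter_upwards [Ioi_mem_nhds hx] with z hz
    filter_upwards [ae_restrict_mem measurableSet_Ioo] with y hy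
    exact ENNReal.ofReal_le_ofReal
      (hittingKernel_anti hβ₁ β₂ le_rfl (one_div_pos.mpr hz).le hy)
  · intro htop
    have hone := gamma_inv_mul_lintegral_hittingKernel_zero h0 h1
    rw [htop, ENNReal.mul_top (ENNReal.ofReal_pos.mpr (one_div_pos.mpr hΓ)).ne'] at hone
    exact ENNReal.top_ne_one hone
  · filter_upwards [ae_restrict_mem measurableSet_Ioo] with y hy
    have hy0 := hy.1
    have hbase : ContinuousAt (fun z : ℝ => (1 / z + y) ^ (β₁ - 1)) x :=
      ((continuousAt_const.div continuousAt_id hx.ne').add continuousAt_const).rpow_const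
        (Or.inl (add_pos (one_div_pos.mpr hx) hy0).ne')
    exact ENNReal.tendsto_ofReal ((hbase.mul continuousAt_const).mul continuousAt_const)

theorem hittingCDF_div_sub_one (β₁ β₂ x : ℝ) {b : ℝ} (hb : 0 < b) :
    hittingCDF β₂ β₁ (x / b - 1) =
      ENNReal.ofReal (1 / (Real.Gamma (β₁ + β₂ - 1) * Real.Gamma (1 - (β₁ + β₂ - 1)))) *
        ∫⁻ y in Set.Ioi (0 : ℝ), (Set.Iio x).indicator
            (fun t => ENNReal.ofReal (t ^ (β₂ - 1) * (x - t) ^ (-(β₁ + β₂ - 1)))) (b + y) *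
          ENNReal.ofReal (y ^ (β₁ - 1)) := by
  have hint : ∫⁻ y in Set.Ioi (0 : ℝ), (Set.Iio x).indicator
          (fun t => ENNReal.ofReal (t ^ (β₂ - 1) * (x - t) ^ (-(β₁ + β₂ - 1)))) (b + y) *
        ENNReal.ofReal (y ^ (β₁ - 1)) =
      ∫⁻ y in Set.Ioo 0 (x - b), ENNReal.ofReal
        ((b + y) ^ (β₂ - 1) * y ^ (β₁ - 1) * (x - (b + y)) ^ (-(β₁ + β₂ - 1))) := by
    rw [← Set.Iio_inter_Ioi, ← setLIntegral_indicator measurableSet_Iio]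
    refine setLIntegral_congr_fun measurableSet_Ioi fun y (hy : 0 < y) => ?_
    simp only [Set.indicator_apply, Set.mem_Iio, lt_sub_iff_add_lt', ite_mul, zero_mul,
      ← ENNReal.ofReal_mul' (Real.rpow_nonneg hy.le _), mul_right_comm]
  rw [hint, hittingCDF, add_comm β₂ β₁, show x / b - 1 = b⁻¹ * (x - b) by field_simp,
    setLIntegral_Ioo_mul_left (by positivity), ← lintegral_const_mul' _ _ ENNReal.ofReal_ne_top]
  congr 1
  refine setLIntegral_congr_fun measurableSet_Ioo fun y hy => ?_
  have hy0 := hy.1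
  rw [← ENNReal.ofReal_mul (by positivity), show 1 + b⁻¹ * y = b⁻¹ * (b + y) by field_simp,
    show b⁻¹ * (x - b) - b⁻¹ * y = b⁻¹ * (x - (b + y)) by ring, add_comm β₁ β₂,
    rpow_mul_rpow_mul_rpow_neg_of_smul β₂ β₁ (inv_pos.mpr hb) (by positivity) hy0.le
      (by linarith [hy.2])]

theorem lintegral_hittingCDF_overshootLaw {β₁ : ℝ} (h0 : 0 < β₁) (h1 : β₁ < 1) (β₂ x : ℝ) :
    ∫⁻ b, hittingCDF β₂ β₁ (x / b - 1) ∂(overshootLaw β₁) = hittingCDF β₁ β₂ x := by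
  have hmeas : Measurable ((Set.Iio x).indicator fun t =>
      ENNReal.ofReal (t ^ (β₂ - 1) * (x - t) ^ (-(β₁ + β₂ - 1)))) :=
    Measurable.indicator (by fun_prop) measurableSet_Iio
  rw [lintegral_congr_ae ((ae_overshootLaw_pos β₁).mono fun b => hittingCDF_div_sub_one β₁ β₂ x),
    lintegral_const_mul' _ _ ENNReal.ofReal_ne_top,
    hasPotentialIdentity_overshootLaw h0 h1 _ hmeas, hittingCDF, ← Set.Iio_inter_Ioi,
    ← setLIntegral_indicator measurableSet_Iio]
  congr 1
  refine setLIntegral_congr_fun measurableSet_Ioi fun t (ht : 0 < t) => ?_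
  simp only [Set.indicator_apply, Set.mem_Iio, ite_mul, zero_mul,
    ← ENNReal.ofReal_mul' (Real.rpow_nonneg (by positivity : 0 ≤ 1 + t) _)]
  congr 2
  ring

/-! ### Euler's integral for the hypergeometric function -/

/-- Euler's integral representation of the Gauss hypergeometric function. -/
noncomputable def eulerHypergeometric (a b c : ℝ) (z : ℂ) : ℂ :=
  ((Real.Gamma c / (Real.Gamma b * Real.Gamma (c - b)) : ℝ) : ℂ) *
    ∫ t in Set.Ioo (0 : ℝ) 1,
      ((t ^ (b - 1) * (1 - t) ^ (c - b - 1) : ℝ) : ℂ) * (1 - z * t) ^ (-a : ℂ)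

theorem ae_rpow_mul_one_sub_rpow_nonneg (p q : ℝ) :
    ∀ᵐ t ∂volume.restrict (Set.Ioo (0 : ℝ) 1), 0 ≤ t ^ p * (1 - t) ^ q := by
  filter_upwards [ae_restrict_mem measurableSet_Ioo] with t ht
  exact mul_nonneg (Real.rpow_nonneg ht.1.le _) (Real.rpow_nonneg (sub_nonneg.mpr ht.2.le) _)

theorem integrableOn_rpow_mul_one_sub_rpow {p q : ℝ} (hp : 0 < p) (hq : 0 < q) :
    IntegrableOn (fun t : ℝ => t ^ (p - 1) * (1 - t) ^ (q - 1)) (Set.Ioo 0 1) := by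
  refine ⟨Measurable.aestronglyMeasurable (by fun_prop), ?_⟩
  rw [hasFiniteIntegral_iff_ofReal (ae_rpow_mul_one_sub_rpow_nonneg _ _),
    lintegral_Ioo_zero_one_beta hp hq]
  exact ENNReal.ofReal_lt_top

theorem integral_Ioo_zero_one_beta {p q : ℝ} (hp : 0 < p) (hq : 0 < q) :
    ∫ t in Set.Ioo (0 : ℝ) 1, t ^ (p - 1) * (1 - t) ^ (q - 1) = beta p q := by
  rw [integral_eq_lintegral_of_nonneg_ae (ae_rpow_mul_one_sub_rpow_nonneg _ _)
    (Measurable.aestronglyMeasurable (by fun_prop)), lintegral_Ioo_zero_one_beta hp hq,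
    ENNReal.toReal_ofReal (beta_pos hp hq).le]

theorem one_sub_mul_mem_slitPlane {z : ℂ} (hz : 1 - z ∈ Complex.slitPlane) {t : ℝ} (h0 : 0 ≤ t)
    (h1 : t ≤ 1) : 1 - z * t ∈ Complex.slitPlane := by
  have hmem := Complex.starConvex_one_slitPlane hz (sub_nonneg.mpr h1) h0 (sub_add_cancel 1 t)
  convert! hmem using 1
  simp only [Complex.real_smul, Complex.ofReal_sub, Complex.ofReal_one]
  ring

theorem hasDerivAt_one_sub_mul_cpow (a : ℂ) {z w : ℂ} (hzw : 1 - z * w ∈ Complex.slitPlane) :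
    HasDerivAt (fun z : ℂ => (1 - z * w) ^ a) (a * (1 - z * w) ^ (a - 1) * -w) z := by
  have hlin : HasDerivAt (fun z : ℂ => 1 - z * w) (-w) z := by
    simpa using ((hasDerivAt_id z).mul_const w).const_sub 1
  exact hlin.cpow_const hzw

theorem differentiableOn_eulerHypergeometric (a : ℝ) {b c : ℝ} (hb : 0 < b) (hbc : b < c) :
    DifferentiableOn ℂ (eulerHypergeometric a b c) {z | 1 - z ∈ Complex.slitPlane} := by
  intro z₀ hz₀
  refine DifferentiableAt.differentiableWithinAt (DifferentiableAt.const_mul ?_ _)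
  have hopen : IsOpen {z : ℂ | 1 - z ∈ Complex.slitPlane} :=
    Complex.isOpen_slitPlane.preimage (by fun_prop)
  obtain ⟨ε, hε, hball⟩ := Metric.nhds_basis_closedBall.mem_iff.mp (hopen.mem_nhds hz₀)
  have hslit : ∀ z ∈ Metric.closedBall z₀ ε, ∀ t ∈ Set.Icc (0 : ℝ) 1,
      1 - z * t ∈ Complex.slitPlane := fun z hz t ht =>
    one_sub_mul_mem_slitPlane (hball hz) ht.1 ht.2
  obtain ⟨C, hC⟩ := ((isCompact_closedBall z₀ ε).prod isCompact_Icc).exists_bound_of_continuousOn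
    (f := fun p : ℂ × ℝ => (-a : ℂ) * (1 - p.1 * p.2) ^ (-a - 1 : ℂ) * -(p.2 : ℂ))
    ((continuousOn_const.mul (ContinuousOn.cpow_const (by fun_prop)
      fun p hp => hslit p.1 hp.1 p.2 hp.2)).mul (by fun_prop))
  obtain ⟨C₀, hC₀⟩ := isCompact_Icc.exists_bound_of_continuousOn
    (f := fun t : ℝ => (1 - z₀ * t) ^ (-a : ℂ))
    (ContinuousOn.cpow_const (by fun_prop) (hslit z₀ (Metric.mem_closedBall_self hε.le)))
  have hweight := integrableOn_rpow_mul_one_sub_rpow hb (sub_pos.mpr hbc)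
  have hmeas : ∀ z : ℂ, AEStronglyMeasurable (fun t : ℝ =>
      ((t ^ (b - 1) * (1 - t) ^ (c - b - 1) : ℝ) : ℂ) * (1 - z * t) ^ (-a : ℂ))
      (volume.restrict (Set.Ioo (0 : ℝ) 1)) := fun z =>
    Measurable.aestronglyMeasurable (by fun_prop)
  refine (hasDerivAt_integral_of_dominated_loc_of_deriv_le
    (F' := fun z t => ((t ^ (b - 1) * (1 - t) ^ (c - b - 1) : ℝ) : ℂ) *
      ((-a : ℂ) * (1 - z * t) ^ (-a - 1 : ℂ) * -t))
    (Metric.closedBall_mem_nhds z₀ hε) (.of_forall hmeas) ?_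
    (Measurable.aestronglyMeasurable (by fun_prop)) ?_ (hweight.norm.mul_const C)
    ?_).2.differentiableAt
  · refine (hweight.norm.mul_const C₀).mono' (hmeas z₀) ?_
    filter_upwards [ae_restrict_mem measurableSet_Ioo] with t ht
    rw [norm_mul, Complex.norm_real]
    exact mul_le_mul_of_nonneg_left (hC₀ t ⟨ht.1.le, ht.2.le⟩) (norm_nonneg _)
  · filter_upwards [ae_restrict_mem measurableSet_Ioo] with t ht z hz
    rw [norm_mul, Complex.norm_real]
    exact mul_le_mul_of_nonneg_left (hC (z, t) ⟨hz, ht.1.le, ht.2.le⟩) (norm_nonneg _)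
  · filter_upwards [ae_restrict_mem measurableSet_Ioo] with t ht z hz
    exact (hasDerivAt_one_sub_mul_cpow _ (hslit z hz t ⟨ht.1.le, ht.2.le⟩)).const_mul _

-- The binomial series is `₂F₁(a, b; b; x)`, read here at `b = 1`.
theorem hasSum_one_sub_cpow_neg (a : ℂ) {x : ℂ} (hx : ‖x‖ < 1) :
    HasSum (fun n : ℕ => ((n.factorial : ℂ)⁻¹ * (ascPochhammer ℂ n).eval a) * x ^ n)
      ((1 - x) ^ (-a)) := by
  have hbinom := (Complex.one_add_cpow_hasFPowerSeriesOnBall_zero (a := -a)).hasSum (y := -x)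
    (by simpa [Metric.mem_eball, edist_zero_right, ← ofReal_norm] using hx)
  have hone : ∀ k : ℕ, (k : ℂ) ≠ -1 := fun k hk => by exact_mod_cast congrArg Complex.re hk
  rw [zero_add, ← sub_eq_add_neg,
    binomialSeries_eq_ordinaryHypergeometricSeries (b := (1 : ℂ)) hone] at hbinom
  refine hbinom.congr_fun fun n => ?_
  have hneg : (⇑(-ContinuousLinearMap.id ℂ ℂ) ∘ fun _ : Fin n => -x) = fun _ => x := by ext; simp
  simp only [FormalMultilinearSeries.compContinuousLinearMap_apply]
  rw [hneg, ordinaryHypergeometricSeries_apply_eq, neg_neg, smul_eq_mul, mul_inv_cancel_right₀]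
  simp [ascPochhammer_eval_one, Nat.factorial_ne_zero]

theorem ascPochhammer_eval_ofReal_eq_gamma_div {y : ℝ} (hy : 0 < y) (n : ℕ) :
    (ascPochhammer ℂ n).eval (y : ℂ) = ((Real.Gamma (y + n) / Real.Gamma y : ℝ) : ℂ) := by
  have hpole : ∀ m : ℕ, (y : ℂ) ≠ -m := fun m hm => by
    have hre : y = -m := by exact_mod_cast hm
    linarith [m.cast_nonneg (α := ℝ)]
  rw [← Complex.Gamma_add_nat_div_Gamma_eq _ hpole, Complex.ofReal_div, ← Complex.Gamma_ofReal,
    ← Complex.Gamma_ofReal, Complex.ofReal_add, Complex.ofReal_natCast]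

theorem gamma_div_mul_beta_add_nat {b c : ℝ} (hb : 0 < b) (hbc : b < c) (n : ℕ) :
    ((Real.Gamma c / (Real.Gamma b * Real.Gamma (c - b)) : ℝ) : ℂ) * (beta (b + n) (c - b) : ℝ) =
      (ascPochhammer ℂ n).eval (b : ℂ) * ((ascPochhammer ℂ n).eval (c : ℂ))⁻¹ := by
  have hc := hb.trans hbc
  have hΓcb := (Real.Gamma_pos_of_pos (sub_pos.mpr hbc)).ne'
  rw [ascPochhammer_eval_ofReal_eq_gamma_div hb, ascPochhammer_eval_ofReal_eq_gamma_div hc, beta,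
    show b + n + (c - b) = c + n by ring, ← Complex.ofReal_inv, ← Complex.ofReal_mul,
    ← Complex.ofReal_mul]
  congr 1
  field_simp

theorem integral_rpow_mul_one_sub_rpow_mul_pow {p q : ℝ} (hp : 0 < p) (hq : 0 < q) (k z : ℂ)
    (n : ℕ) :
    ∫ t in Set.Ioo (0 : ℝ) 1,
        ((t ^ (p - 1) * (1 - t) ^ (q - 1) : ℝ) : ℂ) * (k * (z * t) ^ n) =
      k * z ^ n * (beta (p + n) q : ℝ) := by
  rw [← integral_Ioo_zero_one_beta (by positivity) hq, ← integral_complex_ofReal,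
    ← integral_const_mul]
  refine setIntegral_congr_fun measurableSet_Ioo fun t ht => ?_
  have hpow : t ^ (p + n - 1) = t ^ (p - 1) * t ^ n := by
    rw [add_sub_right_comm, Real.rpow_add ht.1, Real.rpow_natCast]
  simp only [hpow, Complex.ofReal_mul, Complex.ofReal_pow, mul_pow]
  ring

theorem hasSum_setIntegral_mul_pow {w : ℝ → ℝ} (hw : IntegrableOn w (Set.Ioo 0 1)) {k : ℕ → ℂ}
    {z : ℂ} (hk : Summable fun n => ‖k n‖ * ‖z‖ ^ n) :
    HasSum (fun n => ∫ t in Set.Ioo (0 : ℝ) 1, (w t : ℂ) * (k n * (z * t) ^ n))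
      (∫ t in Set.Ioo (0 : ℝ) 1, ∑' n, (w t : ℂ) * (k n * (z * t) ^ n)) := by
  have hle : ∀ n, ∀ᵐ t : ℝ ∂volume.restrict (Set.Ioo (0 : ℝ) 1),
      ‖(w t : ℂ) * (k n * (z * t) ^ n)‖ ≤ ‖w t‖ * (‖k n‖ * ‖z‖ ^ n) := fun n => by
    filter_upwards [ae_restrict_mem measurableSet_Ioo] with t ht
    rw [norm_mul, Complex.norm_real, norm_mul (k n), norm_pow, norm_mul z, Complex.norm_real,
      Real.norm_of_nonneg ht.1.le]
    have := ht.1.le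
    gcongr
    exact mul_le_of_le_one_right (norm_nonneg z) ht.2.le
  have hint : ∀ n, IntegrableOn (fun t : ℝ => (w t : ℂ) * (k n * (z * t) ^ n)) (Set.Ioo 0 1) :=
    fun n => (hw.norm.mul_const _).mono'
      (hw.ofReal.aestronglyMeasurable.mul (Measurable.aestronglyMeasurable (by fun_prop))) (hle n)
  refine hasSum_integral_of_summable_integral_norm hint <| Summable.of_nonneg_of_le
    (fun n => integral_nonneg fun t => norm_nonneg _) (fun n => ?_)
    (hk.mul_left (∫ t in Set.Ioo (0 : ℝ) 1, ‖w t‖))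
  rw [← integral_mul_const]
  exact integral_mono_ae (hint n).norm (hw.norm.mul_const _) (hle n)

theorem eulerHypergeometric_eq_ordinaryHypergeometric (a : ℝ) {b c : ℝ} (hb : 0 < b) (hbc : b < c)
    {z : ℂ} (hz : ‖z‖ < 1) :
    eulerHypergeometric a b c z = ordinaryHypergeometric (a : ℂ) (b : ℂ) (c : ℂ) z := by
  set k : ℕ → ℂ := fun n => (n.factorial : ℂ)⁻¹ * (ascPochhammer ℂ n).eval (a : ℂ) with hk
  have hsummable : Summable fun n => ‖k n‖ * ‖z‖ ^ n := by
    simpa [hk] using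
      (hasSum_one_sub_cpow_neg (a : ℂ) (x := (‖z‖ : ℂ)) (by simpa using hz)).summable.norm
  have hsum := hasSum_setIntegral_mul_pow
    (integrableOn_rpow_mul_one_sub_rpow hb (sub_pos.mpr hbc)) hsummable
  have hbinom : ∫ t in Set.Ioo (0 : ℝ) 1, ∑' n,
        ((t ^ (b - 1) * (1 - t) ^ (c - b - 1) : ℝ) : ℂ) * (k n * (z * t) ^ n) =
      ∫ t in Set.Ioo (0 : ℝ) 1,
        ((t ^ (b - 1) * (1 - t) ^ (c - b - 1) : ℝ) : ℂ) * (1 - z * t) ^ (-a : ℂ) := by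
    refine setIntegral_congr_fun measurableSet_Ioo fun t ht => ?_
    have hzt : ‖z * (t : ℂ)‖ < 1 := by
      rw [norm_mul, Complex.norm_real, Real.norm_of_nonneg ht.1.le]
      exact (mul_le_of_le_one_right (norm_nonneg _) ht.2.le).trans_lt hz
    exact ((hasSum_one_sub_cpow_neg (a : ℂ) hzt).mul_left _).tsum_eq
  rw [eulerHypergeometric, ordinaryHypergeometric_eq_tsum, ← hbinom, ← hsum.tsum_eq,
    ← tsum_mul_left]
  refine tsum_congr fun n => ?_
  rw [integral_rpow_mul_one_sub_rpow_mul_pow hb (sub_pos.mpr hbc), smul_eq_mul]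
  linear_combination (k n * z ^ n) * gamma_div_mul_beta_add_nat hb hbc n

theorem isGaussHypergeometric_eulerHypergeometric (a : ℝ) {b c : ℝ} (hb : 0 < b) (hbc : b < c) :
    IsGaussHypergeometric a b c (eulerHypergeometric a b c) :=
  ⟨differentiableOn_eulerHypergeometric a hb hbc,
    fun _ hz => eulerHypergeometric_eq_ordinaryHypergeometric a hb hbc hz⟩

theorem eulerHypergeometric_neg_ofReal (a b c : ℝ) {u : ℝ} (hu : 0 ≤ u) :
    eulerHypergeometric a b c ((-u : ℝ) : ℂ) =
      ((Real.Gamma c / (Real.Gamma b * Real.Gamma (c - b)) *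
        ∫ t in Set.Ioo (0 : ℝ) 1, t ^ (b - 1) * (1 - t) ^ (c - b - 1) * (1 + u * t) ^ (-a) : ℝ) :
          ℂ) := by
  rw [eulerHypergeometric, Complex.ofReal_mul, ← integral_complex_ofReal]
  congr 1
  refine setIntegral_congr_fun measurableSet_Ioo fun t ht => ?_
  have hbase : (1 : ℂ) - ((-u : ℝ) : ℂ) * t = ((1 + u * t : ℝ) : ℂ) := by push_cast; ring
  have hnonneg : 0 ≤ 1 + u * t := add_nonneg zero_le_one (mul_nonneg hu ht.1.le)
  rw [hbase, ← Complex.ofReal_neg, ← Complex.ofReal_cpow hnonneg, ← Complex.ofReal_mul]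

theorem intersectionCDF_eq_rpow_mul_integral (β₁ β₂ : ℝ) {x a : ℝ} (hx : 0 < x) (ha : 0 < a) :
    intersectionCDF β₁ β₂ x a =
      1 / (Real.Gamma (β₁ + β₂ - 1) * Real.Gamma (1 - (β₁ + β₂ - 1))) * ((a / x) ^ (β₁ - 1) *
        ∫ t in Set.Ioo (0 : ℝ) 1, t ^ (β₂ - 1) * (1 - t) ^ (2 - β₁ - β₂ - 1) *
          (1 + x / a * t) ^ (-(1 - β₁))) := by
  rw [intersectionCDF, intervalIntegral.integral_of_le zero_le_one,
    integral_Ioc_eq_integral_Ioo, ← integral_const_mul ((a / x) ^ (β₁ - 1))]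
  congr 1
  refine setIntegral_congr_fun measurableSet_Ioo fun t ht => ?_
  have ht0 := ht.1
  rw [show a / x + t = a / x * (1 + x / a * t) by field_simp,
    Real.mul_rpow (by positivity) (by positivity),
    show 2 - β₁ - β₂ - 1 = -(β₁ + β₂ - 1) by ring, neg_sub 1 β₁]
  ring

theorem intersectionCDF_eq_eulerHypergeometric {β₁ β₂ x a : ℝ} (hβ₁ : β₁ < 2) (hβ₂ : 0 < β₂)
    (h1 : β₁ + β₂ < 2) (hx : 0 < x) (ha : 0 < a) :
    (intersectionCDF β₁ β₂ x a : ℂ) =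
      (Real.Gamma β₂ / (Real.Gamma (β₁ + β₂ - 1) * Real.Gamma (2 - β₁)) *
        (a / x) ^ (β₁ - 1) : ℝ) *
          eulerHypergeometric (1 - β₁) β₂ (2 - β₁) (-(x / a) : ℝ) := by
  have hΓβ₂ := (Real.Gamma_pos_of_pos hβ₂).ne'
  have hΓβ₁ := (Real.Gamma_pos_of_pos (sub_pos.mpr hβ₁)).ne'
  have hΓ := (Real.Gamma_pos_of_pos (by linarith : 0 < 1 - (β₁ + β₂ - 1))).ne'
  rw [eulerHypergeometric_neg_ofReal _ _ _ (by positivity), intersectionCDF_eq_rpow_mul_integral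
    β₁ β₂ hx ha, ← Complex.ofReal_mul, show 2 - β₁ - β₂ = 1 - (β₁ + β₂ - 1) by ring]
  congr 1
  field_simp

/-! ### Measurability of operations on random closed sets -/

theorem measurableSet_closeds_hit_isCompact {K : Set ℝ} (hK : IsCompact K) :
    MeasurableSet {F : TopologicalSpace.Closeds ℝ | ((F : Set ℝ) ∩ K).Nonempty} :=
  MeasurableSpace.measurableSet_generateFrom ⟨K, hK, rfl⟩

theorem measurableSet_closeds_hit_isOpen {U : Set ℝ} (hU : IsOpen U) :
    MeasurableSet {F : TopologicalSpace.Closeds ℝ | ((F : Set ℝ) ∩ U).Nonempty} := by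
  have hloc := hU.locallyCompactSpace
  obtain ⟨K, hK, rfl⟩ : IsSigmaCompact U :=
    isSigmaCompact_iff_sigmaCompactSpace.mpr inferInstance
  simp only [Set.inter_iUnion, Set.nonempty_iUnion, Set.ofPred_exists]
  exact MeasurableSet.iUnion fun n => measurableSet_closeds_hit_isCompact (hK n)

theorem measurable_infEDist_closeds (q : ℝ) :
    Measurable fun F : TopologicalSpace.Closeds ℝ => Metric.infEDist q (F : Set ℝ) := by
  refine measurable_of_Iio fun r => ?_
  convert! measurableSet_closeds_hit_isOpen (U := Metric.eball q r) Metric.isOpen_eball using 1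
  ext F
  simp only [Set.mem_preimage, Set.mem_Iio, Metric.infEDist_lt_iff, Set.mem_ofPred_eq,
    Set.Nonempty, Set.mem_inter_iff, Metric.mem_eball']

theorem measurable_infEDist_closeds_comp {S : Type*} [MeasurableSpace S] {t : S → ℝ}
    {Φ : S → TopologicalSpace.Closeds ℝ} (ht : Measurable t) (hΦ : Measurable Φ) :
    Measurable fun s => Metric.infEDist (t s) (Φ s : Set ℝ) :=
  (measurable_uncurry_of_continuous_of_measurable
    (u := fun (t : ℝ) (F : TopologicalSpace.Closeds ℝ) => Metric.infEDist t (F : Set ℝ))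
    (fun _ => Metric.continuous_infEDist) measurable_infEDist_closeds).comp (ht.prodMk hΦ)

theorem mem_closeds_iff_infEDist_eq_zero {X : Type*} [PseudoEMetricSpace X]
    {F : TopologicalSpace.Closeds X} {x : X} : x ∈ F ↔ Metric.infEDist x (F : Set X) = 0 := by
  rw [← Metric.mem_closure_iff_infEDist_zero, F.isClosed.closure_eq, SetLike.mem_coe]

theorem exists_mem_eq_zero_iff_iInf_denseSeq {X : Type*} [TopologicalSpace X] {K : Set X}
    [TopologicalSpace.SeparableSpace K] [Nonempty K] (hK : IsCompact K) {g : X → ℝ≥0∞}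
    (hg : Continuous g) :
    (∃ x ∈ K, g x = 0) ↔ ⨅ n, g (TopologicalSpace.denseSeq K n) = 0 := by
  constructor
  · rintro ⟨x, hx, hgx⟩
    refine le_antisymm (le_of_forall_gt fun ε hε => ?_) zero_le
    have hopen : IsOpen {y : K | g y < ε} :=
      isOpen_lt (hg.comp continuous_subtype_val) continuous_const
    obtain ⟨n, hn⟩ := (TopologicalSpace.denseRange_denseSeq K).exists_mem_open hopen
      ⟨⟨x, hx⟩, by simpa [hgx] using hε⟩
    exact (iInf_le _ n).trans_lt hn
  · intro hinf
    obtain ⟨x, hx, hmin⟩ := hK.exists_isMinOn (Set.nonempty_coe_sort.mp ‹_›) hg.continuousOn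
    exact ⟨x, hx, le_antisymm
      (hinf ▸ le_iInf fun n => hmin (TopologicalSpace.denseSeq K n).2) zero_le⟩

theorem measurableSet_exists_mem_eq_zero {S X : Type*} [MeasurableSpace S] [TopologicalSpace X]
    [SecondCountableTopology X] {K : Set X} (hK : IsCompact K) {g : S → X → ℝ≥0∞}
    (hg : ∀ s, Continuous (g s)) (hm : ∀ r, Measurable fun s => g s r) :
    MeasurableSet {s | ∃ r ∈ K, g s r = 0} := by
  rcases K.eq_empty_or_nonempty with rfl | hne
  · simp
  have : Nonempty K := hne.to_subtype
  simp_rw [exists_mem_eq_zero_iff_iInf_denseSeq hK (hg _)]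
  exact (measurableSet_singleton 0).preimage (Measurable.iInf fun n => hm _)

theorem measurable_closeds_of_infEDist {S : Type*} [MeasurableSpace S]
    {Φ : S → TopologicalSpace.Closeds ℝ}
    (h : ∀ q, Measurable fun s => Metric.infEDist q (Φ s : Set ℝ)) : Measurable Φ := by
  refine measurable_generateFrom ?_
  rintro _ ⟨K, hK, rfl⟩
  convert! measurableSet_exists_mem_eq_zero hK
    (g := fun s q => Metric.infEDist q (Φ s : Set ℝ)) (fun s => Metric.continuous_infEDist) h
    using 1
  ext s
  simp only [Set.mem_preimage, Set.mem_ofPred_eq, ← mem_closeds_iff_infEDist_eq_zero]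
  exact exists_congr fun x => and_comm

theorem measurable_closeds_closure_range {ι : Type*} [Countable ι] :
    Measurable fun x : ι → ℝ => TopologicalSpace.Closeds.closure (Set.range x) := by
  refine measurable_closeds_of_infEDist fun q => ?_
  simp_rw [TopologicalSpace.Closeds.coe_closure, Metric.infEDist_closure, Metric.infEDist,
    iInf_range]
  fun_prop

/-- The part of `F` on `[t, ∞)`, translated to start in `[0, ∞)`. -/
def tailFrom (t : ℝ) (F : TopologicalSpace.Closeds ℝ) : TopologicalSpace.Closeds ℝ :=
  ⟨{x | 0 ≤ x ∧ t + x ∈ F}, isClosed_Ici.inter (F.isClosed.preimage (by fun_prop))⟩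

theorem mem_tailFrom {t x : ℝ} {F : TopologicalSpace.Closeds ℝ} :
    x ∈ tailFrom t F ↔ 0 ≤ x ∧ t + x ∈ F := Iff.rfl

theorem measurable_tailFrom_uncurry :
    Measurable fun p : ℝ × TopologicalSpace.Closeds ℝ => tailFrom p.1 p.2 := by
  refine measurable_generateFrom ?_
  rintro _ ⟨K, hK, rfl⟩
  convert! measurableSet_exists_mem_eq_zero (hK.inter_right isClosed_Ici (t := Set.Ici (0 : ℝ)))
    (g := fun (p : ℝ × TopologicalSpace.Closeds ℝ) q => Metric.infEDist (p.1 + q) (p.2 : Set ℝ))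
    (fun p => Metric.continuous_infEDist.comp (by fun_prop))
    (fun q => measurable_infEDist_closeds_comp (measurable_fst.add_const q) measurable_snd) using 1
  ext p
  simp only [Set.mem_preimage, Set.mem_ofPred_eq, ← mem_closeds_iff_infEDist_eq_zero,
    Set.Nonempty, Set.mem_inter_iff, SetLike.mem_coe, mem_tailFrom, Set.mem_Ici]
  exact exists_congr fun x => by tauto

/-- The first point of `F` on `[t, ∞)`; it is `0` when `F` does not meet `[t, ∞)`. -/
noncomputable def nextPoint (t : ℝ) (F : TopologicalSpace.Closeds ℝ) : ℝ :=
  sInf ((F : Set ℝ) ∩ Set.Ici t)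

theorem isLeast_nextPoint {t : ℝ} {F : TopologicalSpace.Closeds ℝ}
    (h : ((F : Set ℝ) ∩ Set.Ici t).Nonempty) :
    IsLeast ((F : Set ℝ) ∩ Set.Ici t) (nextPoint t F) :=
  (F.isClosed.inter isClosed_Ici).isLeast_csInf h ⟨t, fun _ hx => hx.2⟩

theorem infEDist_tailFrom_of_nonempty {t : ℝ} {F : TopologicalSpace.Closeds ℝ}
    (h : ((F : Set ℝ) ∩ Set.Ici t).Nonempty) :
    Metric.infEDist 0 (tailFrom t F : Set ℝ) = ENNReal.ofReal (nextPoint t F - t) := by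
  obtain ⟨⟨hmem, hle⟩, hleast⟩ := isLeast_nextPoint h
  have hdist : ∀ x : ℝ, 0 ≤ x → edist 0 x = ENNReal.ofReal x := fun x hx => by
    rw [edist_dist, dist_zero_left, Real.norm_of_nonneg hx]
  have hsub : nextPoint t F - t ∈ tailFrom t F :=
    mem_tailFrom.mpr ⟨sub_nonneg.mpr hle, by rwa [add_sub_cancel]⟩
  refine le_antisymm ((Metric.infEDist_le_edist_of_mem hsub).trans_eq (hdist _ hsub.1))
    (Metric.le_infEDist.mpr fun x ⟨hx, hxF⟩ => ?_)
  rw [hdist x hx]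
  exact ENNReal.ofReal_le_ofReal
    (sub_le_iff_le_add'.mpr (hleast ⟨hxF, le_add_of_nonneg_right hx⟩))

theorem nextPoint_eq_ite (t : ℝ) (F : TopologicalSpace.Closeds ℝ) :
    nextPoint t F = if Metric.infEDist 0 (tailFrom t F : Set ℝ) = ⊤ then 0
      else t + (Metric.infEDist 0 (tailFrom t F : Set ℝ)).toReal := by
  by_cases h : ((F : Set ℝ) ∩ Set.Ici t).Nonempty
  · rw [infEDist_tailFrom_of_nonempty h, if_neg ENNReal.ofReal_ne_top,
      ENNReal.toReal_ofReal (sub_nonneg.mpr (isLeast_nextPoint h).1.2), add_sub_cancel]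
  · have hempty : (tailFrom t F : Set ℝ) = ∅ := Set.eq_empty_of_forall_notMem fun x hx =>
      h ⟨t + x, hx.2, le_add_of_nonneg_right hx.1⟩
    rw [hempty, Metric.infEDist_empty, if_pos rfl, nextPoint, Set.not_nonempty_iff_eq_empty.mp h,
      Real.sInf_empty]

theorem measurable_nextPoint_uncurry :
    Measurable fun p : ℝ × TopologicalSpace.Closeds ℝ => nextPoint p.1 p.2 := by
  have hdist := measurable_infEDist_closeds_comp (measurable_const (a := (0 : ℝ)))
    measurable_tailFrom_uncurry
  simp only [nextPoint_eq_ite]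
  exact Measurable.ite (hdist (measurableSet_singleton ⊤)) measurable_const
    (measurable_fst.add hdist.ennreal_toReal)

/-! ### The strong Markov property of random walks -/

theorem measurable_sInf_nat_setOf {Ω : Type*} [MeasurableSpace Ω] {p : ℕ → Ω → Prop}
    (hp : ∀ k, MeasurableSet {ω | p k ω}) : Measurable fun ω => sInf {k | p k ω} := by
  refine measurable_of_Iic fun k => ?_
  have hset : (fun ω => sInf {k | p k ω}) ⁻¹' Set.Iic k =
      (⋃ j ∈ Finset.range (k + 1), {ω | p j ω}) ∪ ⋂ j, {ω | p j ω}ᶜ := by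
    ext ω
    simp only [Set.mem_preimage, Set.mem_Iic, Set.mem_union, Set.mem_iUnion, Set.mem_iInter,
      Set.mem_compl_iff, Set.mem_ofPred_eq, Finset.mem_range, exists_prop]
    constructor
    · intro hk
      refine or_iff_not_imp_right.mpr fun hex => ?_
      push Not at hex
      exact ⟨_, Nat.lt_succ_of_le hk, Nat.sInf_mem (s := {k | p k ω}) hex⟩
    · rintro (⟨j, hj, hpj⟩ | hnone)
      · exact (Nat.sInf_le hpj).trans (Nat.le_of_lt_succ hj)
      · have hempty : {k | p k ω} = ∅ := Set.eq_empty_of_forall_notMem hnone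
        simp only [hempty, Nat.sInf_empty, zero_le]
  rw [hset]
  exact ((Finset.range (k + 1)).measurableSet_biUnion fun j _ => hp j).union
    (MeasurableSet.iInter fun j => (hp j).compl)

theorem measurable_comp_nat {Ω E : Type*} [MeasurableSpace Ω] [MeasurableSpace E] {N : Ω → ℕ}
    {u : ℕ → Ω → E} (hN : Measurable N) (hu : ∀ k, Measurable (u k)) :
    Measurable fun ω => u (N ω) ω :=
  (measurable_from_prod_countable_right hu : Measurable fun p : ℕ × Ω => u p.1 p.2).comp
    (hN.prodMk measurable_id)

theorem measure_eq_tsum_inter_fiber {Ω : Type*} [MeasurableSpace Ω] {μ : Measure Ω} {N : Ω → ℕ}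
    (hN : Measurable N) {B : Set Ω} (hB : MeasurableSet B) :
    μ B = ∑' k, μ ({ω | N ω = k} ∩ B) := by
  have hcover : B = ⋃ k, {ω | N ω = k} ∩ B := by
    ext ω
    simp only [Set.mem_iUnion, Set.mem_inter_iff, Set.mem_ofPred_eq, exists_eq_left']
  nth_rw 1 [hcover]
  exact measure_iUnion (fun k l hkl => Set.disjoint_left.mpr fun ω h₁ h₂ =>
    hkl (h₁.1.symm.trans h₂.1)) fun k => (hN (measurableSet_singleton k)).inter hB

/-- The σ-algebra generated by the first `k` terms of the sequence `ξ`. -/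
abbrev pastMeasurableSpace {Ω F : Type*} [MeasurableSpace F] (ξ : ℕ → Ω → F) (k : ℕ) :
    MeasurableSpace Ω :=
  ⨆ i ∈ Set.Iio k, MeasurableSpace.comap (ξ i) inferInstance

section IID

variable {Ω E F : Type*} [MeasurableSpace E] [MeasurableSpace F] {ξ : ℕ → Ω → F}

theorem measurable_pastMeasurableSpace {i k : ℕ} (hik : i < k) :
    Measurable[pastMeasurableSpace ξ k] (ξ i) :=
  (comap_measurable (ξ i)).mono
    (le_iSup₂_of_le (f := fun i (_ : i ∈ Set.Iio k) => MeasurableSpace.comap (ξ i) inferInstance)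
      i hik le_rfl) le_rfl

variable [MeasurableSpace Ω] {P : Measure Ω}

theorem pastMeasurableSpace_le (hm : ∀ i, Measurable (ξ i)) (k : ℕ) :
    pastMeasurableSpace ξ k ≤ ‹MeasurableSpace Ω› :=
  iSup₂_le fun i _ => (hm i).comap_le

theorem map_shift_eq_of_iid [IsProbabilityMeasure P] (hm : ∀ i, Measurable (ξ i))
    (hi : iIndepFun ξ P) (hd : ∀ i, IdentDistrib (ξ i) (ξ 0) P P) (k : ℕ) :
    P.map (fun ω j => ξ (k + j) ω) = P.map (fun ω j => ξ j ω) := by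
  rw [(iIndepFun_iff_map_fun_eq_infinitePi_map fun i => hm (k + i)).mp
      (hi.precomp (g := fun j => k + j) (add_right_injective k)),
    (iIndepFun_iff_map_fun_eq_infinitePi_map hm).mp hi]
  congr 1
  ext1 j
  rw [(hd (k + j)).map_eq, (hd j).map_eq]

theorem indep_pastMeasurableSpace_shift (hm : ∀ i, Measurable (ξ i)) (hi : iIndepFun ξ P)
    (k : ℕ) :
    Indep (pastMeasurableSpace ξ k)
      (MeasurableSpace.comap (fun ω j => ξ (k + j) ω) MeasurableSpace.pi) P := by
  have hdisj : Disjoint (Set.Iio k) (Set.Ici k) := Set.Iio_disjoint_Ici le_rfl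
  refine indep_of_indep_of_le_right
    (indep_iSup_of_disjoint (fun i => (hm i).comap_le) hi hdisj) ?_
  rw [← measurable_iff_comap_le]
  refine @measurable_pi_lambda Ω ℕ (fun _ => F) (_) _ _ fun j => ?_
  exact (comap_measurable (ξ (k + j))).mono
    (le_iSup₂_of_le (f := fun i (_ : i ∈ Set.Ici k) => MeasurableSpace.comap (ξ i) inferInstance)
      (k + j) (Nat.le_add_right k j) le_rfl) le_rfl

theorem measure_inter_shift_preimage_of_iid [IsProbabilityMeasure P]
    (hm : ∀ i, Measurable (ξ i)) (hi : iIndepFun ξ P) (hd : ∀ i, IdentDistrib (ξ i) (ξ 0) P P)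
    {k : ℕ} {A : Set Ω} (hA : MeasurableSet[pastMeasurableSpace ξ k] A) {t : Set (ℕ → F)}
    (ht : MeasurableSet t) :
    P (A ∩ (fun ω j => ξ (k + j) ω) ⁻¹' t) = P A * P.map (fun ω j => ξ j ω) t := by
  rw [(Indep_iff _ _ P).mp (indep_pastMeasurableSpace_shift hm hi k) _ _ hA ⟨t, ht, rfl⟩,
    ← map_shift_eq_of_iid hm hi hd k,
    Measure.map_apply (measurable_pi_lambda _ fun j => hm (k + j)) ht]

-- The event `{N = k}` is only required to be in the past up to a null set, because the first
-- passage time takes a junk value on the null event that the level is never passed.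
theorem map_prodMk_shift_of_iid [IsProbabilityMeasure P] (hm : ∀ i, Measurable (ξ i))
    (hi : iIndepFun ξ P) (hd : ∀ i, IdentDistrib (ξ i) (ξ 0) P P) {N : Ω → ℕ}
    (hN : Measurable N) {A : ℕ → Set Ω} (hA : ∀ k, MeasurableSet[pastMeasurableSpace ξ k] (A k))
    (hNA : ∀ k, {ω | N ω = k} =ᵐ[P] A k) {u : ℕ → Ω → E}
    (hu : ∀ k, Measurable[pastMeasurableSpace ξ k] (u k)) :
    P.map (fun ω => (u (N ω) ω, fun j => ξ (N ω + j) ω)) =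
      (P.map fun ω => u (N ω) ω).prod (P.map fun ω j => ξ j ω) := by
  have hum : Measurable fun ω => u (N ω) ω :=
    measurable_comp_nat hN fun k => (hu k).mono (pastMeasurableSpace_le hm k) le_rfl
  have hξm : Measurable fun ω j => ξ (N ω + j) ω :=
    measurable_pi_lambda _ fun j =>
      measurable_comp_nat (u := fun k => ξ (k + j)) hN fun k => hm (k + j)
  have : IsProbabilityMeasure (P.map fun ω => u (N ω) ω) :=
    Measure.isProbabilityMeasure_map hum.aemeasurable
  have : IsProbabilityMeasure (P.map fun ω j => ξ j ω) :=
    Measure.isProbabilityMeasure_map (measurable_pi_lambda _ hm).aemeasurable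
  refine (Measure.prod_eq fun s t hs ht => ?_).symm
  rw [Measure.map_apply (hum.prodMk hξm) (hs.prod ht), Measure.map_apply hum hs]
  rw [measure_eq_tsum_inter_fiber hN (hum.prodMk hξm (hs.prod ht)),
    measure_eq_tsum_inter_fiber hN (hum hs), ← ENNReal.tsum_mul_right]
  refine tsum_congr fun k => ?_
  calc P ({ω | N ω = k} ∩ (fun ω => (u (N ω) ω, fun j => ξ (N ω + j) ω)) ⁻¹' s ×ˢ t)
      = P (({ω | N ω = k} ∩ u k ⁻¹' s) ∩ (fun ω j => ξ (k + j) ω) ⁻¹' t) := by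
        congr 1
        ext ω
        constructor
        · rintro ⟨rfl, h₁, h₂⟩
          exact ⟨⟨rfl, h₁⟩, h₂⟩
        · rintro ⟨⟨rfl, h₁⟩, h₂⟩
          exact ⟨rfl, h₁, h₂⟩
    _ = P ((A k ∩ u k ⁻¹' s) ∩ (fun ω j => ξ (k + j) ω) ⁻¹' t) :=
        measure_congr (((hNA k).inter (ae_eq_refl _)).inter (ae_eq_refl _))
    _ = P (A k ∩ u k ⁻¹' s) * P.map (fun ω j => ξ j ω) t :=
        measure_inter_shift_preimage_of_iid hm hi hd ((hA k).inter (hu k hs)) ht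
    _ = P ({ω | N ω = k} ∩ (fun ω => u (N ω) ω) ⁻¹' s) * P.map (fun ω j => ξ j ω) t := by
        rw [← measure_congr ((hNA k).inter (ae_eq_refl (u k ⁻¹' s)))]
        congr 2
        ext ω
        constructor <;> rintro ⟨rfl, h⟩ <;> exact ⟨rfl, h⟩

end IID

theorem measurable_sum_range_pastMeasurableSpace {Ω : Type*} (ξ : ℕ → Ω → ℝ) {j k : ℕ}
    (hjk : j ≤ k) :
    Measurable[pastMeasurableSpace ξ k] fun ω => ∑ i ∈ Finset.range j, ξ i ω :=
  @Finset.measurable_fun_sum ℝ ℕ Ω _ _ _ (pastMeasurableSpace ξ k) ξ _ fun _ hi =>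
    measurable_pastMeasurableSpace ((Finset.mem_range.mp hi).trans_le hjk)

theorem sInf_nat_setOf_eq_iff {p : ℕ → Prop} (hp : ∃ k, p k) (k : ℕ) :
    sInf {k | p k} = k ↔ p k ∧ ∀ j < k, ¬ p j := by
  refine ⟨?_, fun ⟨hk, hlt⟩ =>
    le_antisymm (Nat.sInf_le hk) (not_lt.mp fun h => hlt _ h (Nat.sInf_mem hp))⟩
  rintro rfl
  exact ⟨Nat.sInf_mem hp, fun j hj => Nat.notMem_of_lt_sInf hj⟩

theorem setOf_firstPassage_eq_ae_eq {Ω : Type*} [MeasurableSpace Ω] {P : Measure Ω}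
    {S T : ℕ → Ω → ℝ} (hST : ∀ᵐ ω ∂P, ∀ k, T k ω = S k ω) {a : ℝ}
    (hpass : ∀ᵐ ω ∂P, ∃ k, a < S k ω) (k : ℕ) :
    {ω | sInf {k | a < S k ω} = k} =ᵐ[P]
      ({ω | a < T k ω} ∩ ⋂ j ∈ Finset.range k, {ω | a < T j ω}ᶜ : Set Ω) := by
  refine Filter.eventuallyEq_set.mpr ?_
  filter_upwards [hST, hpass] with ω hω hpassω
  simpa only [hω, Set.mem_ofPred_eq, Set.mem_inter_iff, Set.mem_iInter, Finset.mem_range,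
    Set.mem_compl_iff] using sInf_nat_setOf_eq_iff hpassω k

theorem map_firstPassage_prodMk_of_iid_increments {Ω : Type*} [MeasurableSpace Ω] {P : Measure Ω}
    [IsProbabilityMeasure P] {S : ℕ → Ω → ℝ} (hS : ∀ k, Measurable (S k))
    (h0 : ∀ᵐ ω ∂P, S 0 ω = 0) (hi : iIndepFun (fun i ω => S (i + 1) ω - S i ω) P)
    (hd : ∀ i, IdentDistrib (fun ω => S (i + 1) ω - S i ω) (fun ω => S (0 + 1) ω - S 0 ω) P P)
    {a : ℝ} (hpass : ∀ᵐ ω ∂P, ∃ k, a < S k ω) {N : Ω → ℕ}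
    (hN : ∀ ω, N ω = sInf {k | a < S k ω}) {J : Type*} (m : J → ℕ) :
    P.map (fun ω => (S (N ω) ω, fun j => S (N ω + m j) ω - S (N ω) ω)) =
      (P.map fun ω => S (N ω) ω).prod (P.map fun ω j => S (m j) ω) := by
  set ξ : ℕ → Ω → ℝ := fun i ω => S (i + 1) ω - S i ω
  have hξm : ∀ i, Measurable (ξ i) := fun i => (hS (i + 1)).sub (hS i)
  have hsum : ∀ k l ω, ∑ i ∈ Finset.range l, ξ (k + i) ω = S (k + l) ω - S k ω :=
    fun k l ω => Finset.sum_range_sub (fun i => S (k + i) ω) l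
  set T : ℕ → Ω → ℝ := fun k ω => ∑ i ∈ Finset.range k, ξ i ω
  have hTS : ∀ᵐ ω ∂P, ∀ k, T k ω = S k ω := h0.mono fun ω hω k => by
    simpa only [zero_add, hω, sub_zero] using hsum 0 k ω
  have hNm : Measurable N :=
    funext hN ▸ measurable_sInf_nat_setOf fun k => measurableSet_lt measurable_const (hS k)
  have hpast : ∀ {j k}, j ≤ k → Measurable[pastMeasurableSpace ξ k] (T j) :=
    measurable_sum_range_pastMeasurableSpace ξ
  have hmarkov := map_prodMk_shift_of_iid hξm hi hd hNm
    (A := fun k => {ω | a < T k ω} ∩ ⋂ j ∈ Finset.range k, {ω | a < T j ω}ᶜ)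
    (fun k => (hpast le_rfl measurableSet_Ioi).inter <| (Finset.range k).measurableSet_biInter
      fun j hj => (hpast (Finset.mem_range.mp hj).le measurableSet_Ioi).compl)
    (fun k => by simpa only [hN] using setOf_firstPassage_eq_ae_eq hTS hpass k)
    (u := T) fun k => hpast le_rfl
  have hψ : Measurable fun (y : ℕ → ℝ) (j : J) => ∑ i ∈ Finset.range (m j), y i := by fun_prop
  have hTN : Measurable fun ω => T (N ω) ω := measurable_comp_nat hNm fun k =>
    (hpast le_rfl).mono (pastMeasurableSpace_le hξm k) le_rfl
  have hshift : Measurable fun ω j => ξ (N ω + j) ω := measurable_pi_lambda _ fun j =>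
    measurable_comp_nat (u := fun k => ξ (k + j)) hNm fun k => hξm (k + j)
  have hmap := congrArg (Measure.map (Prod.map id fun y (j : J) => ∑ i ∈ Finset.range (m j), y i))
    hmarkov
  rw [Measure.map_map (measurable_id.prodMap hψ) (hTN.prodMk hshift),
    ← Measure.map_prod_map _ _ measurable_id hψ, Measure.map_id,
    Measure.map_map hψ (measurable_pi_lambda _ hξm)] at hmap
  convert hmap using 1
  · refine Measure.map_congr (hTS.mono fun ω hω => ?_)
    simp only [Function.comp_apply, Prod.map_apply, id_eq, hω, hsum]
  · congr 1
    · exact Measure.map_congr (hTS.mono fun ω hω => (hω _).symm)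
    · exact Measure.map_congr (hTS.mono fun ω hω => funext fun j => (hω (m j)).symm)

/-! ### Paths of subordinators -/

/-- Nondecreasing, right-continuous, unbounded functions: the properties of almost every path of a
stable subordinator on which the analysis of its first passages rests. -/
structure IsSubordinatorPath (x : ℝ≥0 → ℝ) : Prop where
  mono : Monotone x
  continuousWithinAt : ∀ t, ContinuousWithinAt x (Set.Ici t) t
  unbounded : ∀ M, ∃ t, M < x t

/-- The first passage time over the level `a`. -/
noncomputable def passageTime (x : ℝ≥0 → ℝ) (a : ℝ) : ℝ≥0 := sInf {t | a < x t}

/-- The first time in `2⁻ⁿ ℕ`, in units of `2⁻ⁿ`, at which the level `a` has been passed. -/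
noncomputable def gridPassage (x : ℝ≥0 → ℝ) (a : ℝ) (n : ℕ) : ℕ :=
  sInf {k : ℕ | a < x (k / 2 ^ n)}

/-- The dyadic time `k / 2ⁿ` for `i = (n, k)`. -/
noncomputable def dyadicTime (i : ℕ × ℕ) : ℝ≥0 := i.2 / 2 ^ i.1

/-- The index `(n, k)` of the smallest multiple `k / 2ⁿ` of `2⁻ⁿ` that exceeds `u`. -/
noncomputable def dyadicAbove (u : ℝ≥0) (n : ℕ) : ℕ × ℕ := (n, ⌊u * 2 ^ n⌋₊ + 1)

theorem tendsto_inv_two_pow_nnreal :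
    Filter.Tendsto (fun n : ℕ => ((2 : ℝ≥0) ^ n)⁻¹) Filter.atTop (nhds 0) := by
  simp_rw [← inv_pow]
  exact NNReal.tendsto_pow_atTop_nhds_zero_of_lt_one (inv_lt_one_of_one_lt₀ one_lt_two)

theorem lt_dyadicTime_dyadicAbove (u : ℝ≥0) (n : ℕ) : u < dyadicTime (dyadicAbove u n) := by
  rw [dyadicTime, dyadicAbove, lt_div_iff₀ (by positivity)]
  push_cast
  exact Nat.lt_floor_add_one _

theorem dyadicTime_dyadicAbove_le (u : ℝ≥0) (n : ℕ) :
    dyadicTime (dyadicAbove u n) ≤ u + (2 ^ n)⁻¹ := by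
  rw [dyadicTime, dyadicAbove, div_le_iff₀ (by positivity), add_mul,
    inv_mul_cancel₀ (by positivity)]
  push_cast
  gcongr
  exact Nat.floor_le zero_le

theorem tendsto_of_le_of_le_add_inv_two_pow {t : ℝ≥0} {u : ℕ → ℝ≥0} (h₁ : ∀ n, t ≤ u n)
    (h₂ : ∀ n, u n ≤ t + (2 ^ n)⁻¹) : Filter.Tendsto u Filter.atTop (nhds t) := by
  refine tendsto_of_tendsto_of_tendsto_of_le_of_le tendsto_const_nhds ?_ h₁ h₂
  simpa using tendsto_inv_two_pow_nnreal.const_add t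

theorem tendsto_dyadicAbove (u : ℝ≥0) :
    Filter.Tendsto (fun n => dyadicTime (dyadicAbove u n)) Filter.atTop (nhds u) :=
  tendsto_of_le_of_le_add_inv_two_pow (fun n => (lt_dyadicTime_dyadicAbove u n).le)
    (dyadicTime_dyadicAbove_le u)

theorem tendsto_comp_of_continuousWithinAt_Ici {α β ι : Type*} [TopologicalSpace α] [Preorder α]
    [TopologicalSpace β] {x : α → β} {t : α} (hx : ContinuousWithinAt x (Set.Ici t) t)
    {u : ι → α} {l : Filter ι} (h₁ : ∀ n, t ≤ u n) (h₂ : Filter.Tendsto u l (nhds t)) :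
    Filter.Tendsto (fun n => x (u n)) l (nhds (x t)) :=
  Filter.Tendsto.comp hx (tendsto_nhdsWithin_iff.mpr ⟨h₂, Filter.Eventually.of_forall h₁⟩)

theorem closure_range_eq_closure_range_dyadic {E : Type*}
    [TopologicalSpace E] {x : ℝ≥0 → E} (hx : ∀ t, ContinuousWithinAt x (Set.Ici t) t) :
    closure (Set.range x) = closure (Set.range fun i => x (dyadicTime i)) := by
  refine subset_antisymm (closure_minimal ?_ isClosed_closure) (closure_mono ?_)
  · rintro _ ⟨t, rfl⟩
    exact mem_closure_of_tendsto (tendsto_comp_of_continuousWithinAt_Ici (hx t)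
      (fun n => (lt_dyadicTime_dyadicAbove t n).le) (tendsto_dyadicAbove t))
      (Filter.Eventually.of_forall fun n => ⟨_, rfl⟩)
  · rintro _ ⟨i, rfl⟩
    exact ⟨_, rfl⟩

theorem le_of_lt_passageTime {x : ℝ≥0 → ℝ} {a : ℝ} {t : ℝ≥0} (ht : t < passageTime x a) :
    x t ≤ a :=
  not_lt.mp fun h => notMem_of_lt_csInf ht (OrderBot.bddBelow _) h

theorem passageTime_le {x : ℝ≥0 → ℝ} {a : ℝ} {t : ℝ≥0} (ht : a < x t) : passageTime x a ≤ t :=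
  csInf_le (OrderBot.bddBelow _) ht

namespace IsSubordinatorPath

variable {x : ℝ≥0 → ℝ}

theorem lt_of_passageTime_lt (hx : IsSubordinatorPath x) {a : ℝ} {t : ℝ≥0}
    (ht : passageTime x a < t) : a < x t := by
  obtain ⟨s, hs, hst⟩ := exists_lt_of_csInf_lt (hx.unbounded a) ht
  exact lt_of_lt_of_le hs (hx.mono hst.le)

theorem le_apply_passageTime (hx : IsSubordinatorPath x) (a : ℝ) : a ≤ x (passageTime x a) :=
  ge_of_tendsto' (tendsto_comp_of_continuousWithinAt_Ici (hx.continuousWithinAt _)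
    (fun n => (lt_dyadicTime_dyadicAbove _ n).le) (tendsto_dyadicAbove (passageTime x a)))
    fun n => (hx.lt_of_passageTime_lt (lt_dyadicTime_dyadicAbove _ n)).le

theorem exists_lt_apply_div_two_pow (hx : IsSubordinatorPath x) (a : ℝ) (n : ℕ) :
    ∃ k : ℕ, a < x (k / 2 ^ n) := by
  obtain ⟨t, ht⟩ := hx.unbounded a
  exact ⟨_, ht.trans_le (hx.mono (lt_dyadicTime_dyadicAbove t n).le)⟩

theorem passageTime_le_gridPassage (hx : IsSubordinatorPath x) (a : ℝ) (n : ℕ) :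
    passageTime x a ≤ gridPassage x a n / 2 ^ n :=
  passageTime_le (Nat.sInf_mem (s := {k : ℕ | a < x (k / 2 ^ n)})
    (hx.exists_lt_apply_div_two_pow a n))

theorem gridPassage_le (hx : IsSubordinatorPath x) (a : ℝ) (n : ℕ) :
    (gridPassage x a n : ℝ≥0) / 2 ^ n ≤ passageTime x a + (2 ^ n)⁻¹ := by
  rcases Nat.eq_zero_or_pos (gridPassage x a n) with h | h
  · simp [h]
  · obtain ⟨k, hk⟩ := Nat.exists_eq_add_of_lt h
    rw [zero_add] at hk
    have hkx : ¬ a < x (k / 2 ^ n) :=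
      Nat.notMem_of_lt_sInf (s := {k : ℕ | a < x (k / 2 ^ n)})
        (show k < gridPassage x a n by omega)
    have hkle : (k : ℝ≥0) / 2 ^ n ≤ passageTime x a :=
      not_lt.mp fun hlt => hkx (hx.lt_of_passageTime_lt hlt)
    rw [hk]
    push_cast
    rw [add_div, one_div]
    gcongr

theorem tendsto_apply_gridPassage_add (hx : IsSubordinatorPath x) (a : ℝ) (t : ℝ≥0) :
    Filter.Tendsto (fun n : ℕ => x (gridPassage x a n / 2 ^ n + t)) Filter.atTop
      (nhds (x (passageTime x a + t))) := by
  refine tendsto_comp_of_continuousWithinAt_Ici (hx.continuousWithinAt _)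
    (fun n => by gcongr; exact hx.passageTime_le_gridPassage a n) ?_
  exact (tendsto_of_le_of_le_add_inv_two_pow (hx.passageTime_le_gridPassage a)
    (hx.gridPassage_le a)).add_const t

theorem continuousWithinAt_shift_Ici (hx : IsSubordinatorPath x) (s t : ℝ≥0) :
    ContinuousWithinAt (fun u => x (s + u) - x s) (Set.Ici t) t := by
  refine ContinuousWithinAt.sub ?_ continuousWithinAt_const
  refine (hx.continuousWithinAt (s + t)).comp (by fun_prop) fun u hu => ?_
  exact add_le_add_right (Set.mem_Ici.mp hu) s

end IsSubordinatorPath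

/-! ### The strong Markov property of stable subordinators at first passage times -/

theorem integral_mul_of_tendsto_ae_of_map_eq_prod {Ω E F : Type*} [MeasurableSpace Ω]
    {P : Measure Ω} [IsProbabilityMeasure P] [TopologicalSpace E] [MeasurableSpace E]
    [OpensMeasurableSpace E] [TopologicalSpace F] [MeasurableSpace F] [OpensMeasurableSpace F]
    {Y : ℕ → Ω → E} {Z : ℕ → Ω → F} {Y' : Ω → E} {Z' : Ω → F} {ν : Measure F} [SFinite ν]
    (hY : ∀ n, Measurable (Y n)) (hZ : ∀ n, Measurable (Z n))
    (hprod : ∀ᶠ n in Filter.atTop, P.map (fun ω => (Y n ω, Z n ω)) = (P.map (Y n)).prod ν)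
    (hYlim : ∀ᵐ ω ∂P, Filter.Tendsto (fun n => Y n ω) Filter.atTop (nhds (Y' ω)))
    (hZlim : ∀ᵐ ω ∂P, Filter.Tendsto (fun n => Z n ω) Filter.atTop (nhds (Z' ω)))
    (f : E →ᵇ ℝ) (g : F →ᵇ ℝ) :
    ∫ ω, f (Y' ω) * g (Z' ω) ∂P = (∫ ω, f (Y' ω) ∂P) * ∫ z, g z ∂ν := by
  have hfm : ∀ n, Measurable fun ω => f (Y n ω) := fun n => f.continuous.measurable.comp (hY n)
  have hgm : ∀ n, Measurable fun ω => g (Z n ω) := fun n => g.continuous.measurable.comp (hZ n)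
  have hflim : ∀ᵐ ω ∂P, Filter.Tendsto (fun n => f (Y n ω)) Filter.atTop (nhds (f (Y' ω))) :=
    hYlim.mono fun ω hω => (f.continuous.tendsto _).comp hω
  have hglim : ∀ᵐ ω ∂P, Filter.Tendsto (fun n => g (Z n ω)) Filter.atTop (nhds (g (Z' ω))) :=
    hZlim.mono fun ω hω => (g.continuous.tendsto _).comp hω
  have hlim_mul : Filter.Tendsto (fun n => ∫ ω, f (Y n ω) * g (Z n ω) ∂P) Filter.atTop
      (nhds (∫ ω, f (Y' ω) * g (Z' ω) ∂P)) := by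
    refine tendsto_integral_of_dominated_convergence (fun _ => ‖f‖ * ‖g‖)
      (fun n => ((hfm n).mul (hgm n)).aestronglyMeasurable) (integrable_const _)
      (fun n => Filter.Eventually.of_forall fun ω => ?_) ?_
    · rw [norm_mul]
      exact mul_le_mul (f.norm_coe_le_norm _) (g.norm_coe_le_norm _) (norm_nonneg _)
        (norm_nonneg _)
    · filter_upwards [hflim, hglim] with ω h₁ h₂ using h₁.mul h₂
  have hlim : Filter.Tendsto (fun n => ∫ ω, f (Y n ω) ∂P) Filter.atTop
      (nhds (∫ ω, f (Y' ω) ∂P)) :=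
    tendsto_integral_of_dominated_convergence (fun _ => ‖f‖)
      (fun n => (hfm n).aestronglyMeasurable) (integrable_const _)
      (fun n => Filter.Eventually.of_forall fun ω => f.norm_coe_le_norm _) hflim
  refine tendsto_nhds_unique (hlim_mul.congr' ?_) (hlim.mul_const _)
  filter_upwards [hprod] with n hn
  have hfgm : Measurable fun p : E × F => f p.1 * g p.2 :=
    (f.continuous.measurable.comp measurable_fst).mul (g.continuous.measurable.comp measurable_snd)
  rw [← integral_map (f := fun p : E × F => f p.1 * g p.2) ((hY n).prodMk (hZ n)).aemeasurable
      hfgm.aestronglyMeasurable, hn, integral_prod_mul (fun y => f y) fun z => g z,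
    integral_map (hY n).aemeasurable f.continuous.measurable.aestronglyMeasurable]

theorem exists_dyadicTime_eq (J : Finset (ℕ × ℕ)) :
    ∃ M, ∀ n, M ≤ n → ∀ i ∈ J, ∃ k : ℕ, dyadicTime i = k / 2 ^ n := by
  refine ⟨J.sup Prod.fst, fun n hn i hi => ⟨i.2 * 2 ^ (n - i.1), ?_⟩⟩
  have hin : i.1 ≤ n := (Finset.le_sup (f := Prod.fst) hi).trans hn
  rw [dyadicTime, div_eq_div_iff (by positivity) (by positivity)]
  push_cast
  rw [mul_assoc, ← pow_add, Nat.sub_add_cancel hin]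

/-- The process after its first passage over the level `a`, started anew from `0`. -/
noncomputable def postPassage {Ω : Type*} (X : ℝ≥0 → Ω → ℝ) (a : ℝ) (t : ℝ≥0) (ω : Ω) : ℝ :=
  X (passageTime (fun s => X s ω) a + t) ω - X (passageTime (fun s => X s ω) a) ω

section Subordinator

variable {Ω : Type*} [MeasurableSpace Ω] {P : Measure Ω} {β : ℝ} {X : ℝ≥0 → Ω → ℝ}

theorem measurable_comp_gridPassage (hX : ∀ t, Measurable (X t)) (a : ℝ) (n : ℕ) (t : ℝ≥0) :
    Measurable fun ω => X (gridPassage (fun s => X s ω) a n / 2 ^ n + t) ω :=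
  measurable_comp_nat (u := fun k => X (k / 2 ^ n + t))
    (measurable_sInf_nat_setOf fun k => measurableSet_lt measurable_const (hX (k / 2 ^ n)))
    fun k => hX (k / 2 ^ n + t)

theorem IsStableSubordinator.ae_nonneg (hX : IsStableSubordinator β X P) :
    ∀ᵐ ω ∂P, ∀ t, 0 ≤ X t ω := by
  filter_upwards [hX.start_zero, hX.monotone] with ω h₀ hmono t
  exact h₀ ▸ hmono (zero_le (a := t))

theorem IsStableSubordinator.identDistrib_increment_grid (hX : IsStableSubordinator β X P)
    (n i : ℕ) :
    IdentDistrib (fun ω => X ((i + 1 : ℕ) / 2 ^ n) ω - X (i / 2 ^ n) ω) (X (2 ^ n)⁻¹) P P := by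
  have hadd : (i : ℝ≥0) / 2 ^ n + (2 ^ n)⁻¹ = (i + 1 : ℕ) / 2 ^ n := by
    push_cast
    rw [add_div, one_div]
  exact hadd ▸ hX.stationary_increments (i / 2 ^ n) (2 ^ n)⁻¹

theorem integrable_exp_neg_mul [IsFiniteMeasure P] {Y : Ω → ℝ} (hY : AEMeasurable Y P)
    (hY₀ : ∀ᵐ ω ∂P, 0 ≤ Y ω) {l : ℝ} (hl : 0 ≤ l) :
    Integrable (fun ω => Real.exp (-l * Y ω)) P := by
  refine Integrable.of_bound (C := 1)
    (Real.measurable_exp.comp_aemeasurable (hY.const_mul (-l))).aestronglyMeasurable ?_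
  filter_upwards [hY₀] with ω hω
  rw [Real.norm_of_nonneg (Real.exp_pos _).le, Real.exp_le_one_iff, neg_mul]
  exact neg_nonpos.mpr (mul_nonneg hl hω)

variable [IsProbabilityMeasure P]

theorem IsStableSubordinator.integrable_exp (hX : IsStableSubordinator β X P) {l : ℝ}
    (hl : 0 ≤ l) (t : ℝ≥0) : Integrable (fun ω => Real.exp (-l * X t ω)) P :=
  integrable_exp_neg_mul (hX.measurable t).aemeasurable (hX.ae_nonneg.mono fun _ hω => hω t) hl

theorem IsStableSubordinator.measure_forall_le_eq_zero (hX : IsStableSubordinator β X P) (M : ℝ) :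
    P {ω | ∀ t, X t ω ≤ M} = 0 := by
  obtain ⟨c, hc, hlap⟩ := hX.laplace
  have hchernoff : ∀ k : ℕ, P.real {ω | ∀ t, X t ω ≤ M} ≤ Real.exp M * Real.exp (-c * k) := by
    intro k
    have hle := measure_le_le_exp_mul_mgf (X := X k) (μ := P) (t := -1) M (by norm_num)
      (hX.integrable_exp zero_le_one k)
    have hmgf : mgf (X k) P (-1) = Real.exp (-c * k) := by
      simpa [mgf] using hlap k 1 zero_le_one
    rw [hmgf, neg_neg, one_mul] at hle
    exact (measureReal_mono fun ω (hω : ∀ t, X t ω ≤ M) => hω k).trans hle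
  have hlim : Filter.Tendsto (fun k : ℕ => Real.exp M * Real.exp (-c * k)) Filter.atTop
      (nhds 0) := by
    rw [← mul_zero (Real.exp M)]
    exact (Real.tendsto_exp_atBot.comp
      (tendsto_natCast_atTop_atTop.const_mul_atTop_of_neg (neg_neg_of_pos hc))).const_mul _
  exact (measureReal_eq_zero_iff (measure_ne_top P _)).mp
    (le_antisymm (ge_of_tendsto' hlim hchernoff) measureReal_nonneg)

theorem IsStableSubordinator.ae_unbounded (hX : IsStableSubordinator β X P) :
    ∀ᵐ ω ∂P, ∀ M, ∃ t, M < X t ω := by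
  have hnat : ∀ᵐ ω ∂P, ∀ n : ℕ, ∃ t, (n : ℝ) < X t ω := by
    refine ae_all_iff.mpr fun n => ?_
    simpa only [ae_iff, not_exists, not_lt] using hX.measure_forall_le_eq_zero n
  filter_upwards [hnat] with ω hω M
  obtain ⟨n, hn⟩ := exists_nat_ge M
  obtain ⟨t, ht⟩ := hω n
  exact ⟨t, hn.trans_lt ht⟩

theorem IsStableSubordinator.ae_isSubordinatorPath (hX : IsStableSubordinator β X P) :
    ∀ᵐ ω ∂P, IsSubordinatorPath fun t => X t ω := by
  filter_upwards [hX.monotone, hX.right_continuous, hX.ae_unbounded]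
    with ω hmono hright hunbounded using ⟨hmono, hright, hunbounded⟩

theorem IsStableSubordinator.aemeasurable_passageTime_add (hX : IsStableSubordinator β X P)
    (a : ℝ) (t : ℝ≥0) : AEMeasurable (fun ω => X (passageTime (fun s => X s ω) a + t) ω) P := by
  refine aemeasurable_of_tendsto_metrizable_ae Filter.atTop
    (fun n => (measurable_comp_gridPassage hX.measurable a n t).aemeasurable) ?_
  filter_upwards [hX.ae_isSubordinatorPath] with ω hω using hω.tendsto_apply_gridPassage_add a t

theorem IsStableSubordinator.aemeasurable_overshoot (hX : IsStableSubordinator β X P) (a : ℝ) :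
    AEMeasurable (overshoot X a) P := by
  have hpassage := hX.aemeasurable_passageTime_add a 0
  simp only [add_zero] at hpassage
  exact hpassage.sub_const a

theorem IsStableSubordinator.aemeasurable_postPassage (hX : IsStableSubordinator β X P) (a : ℝ)
    (t : ℝ≥0) : AEMeasurable (postPassage X a t) P := by
  have hzero := hX.aemeasurable_passageTime_add a 0
  simp only [add_zero] at hzero
  exact (hX.aemeasurable_passageTime_add a t).sub hzero

-- The increments over the grid `2⁻ⁿ ℕ` are i.i.d., so this is the first passage of a random walk.
theorem IsStableSubordinator.map_gridPassage_prodMk (hX : IsStableSubordinator β X P) (a : ℝ)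
    {J : Type*} (n : ℕ) (m : J → ℕ) :
    P.map (fun ω => (X (gridPassage (fun s => X s ω) a n / 2 ^ n) ω, fun j =>
        X (gridPassage (fun s => X s ω) a n / 2 ^ n + m j / 2 ^ n) ω -
          X (gridPassage (fun s => X s ω) a n / 2 ^ n) ω)) =
      (P.map fun ω => X (gridPassage (fun s => X s ω) a n / 2 ^ n) ω).prod
        (P.map fun ω j => X (m j / 2 ^ n) ω) := by
  have hstep : ∀ k l : ℕ, (k : ℝ≥0) / 2 ^ n + l / 2 ^ n = (k + l : ℕ) / 2 ^ n := fun k l => by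
    rw [Nat.cast_add, add_div]
  have hmono : Monotone fun k : ℕ => (k : ℝ≥0) / 2 ^ n := fun i j hij => by dsimp only; gcongr
  simp only [hstep]
  refine map_firstPassage_prodMk_of_iid_increments (S := fun k => X (k / 2 ^ n))
    (fun k => hX.measurable _) ?_ (hX.indep_increments.nat hmono)
    (fun i => (hX.identDistrib_increment_grid n i).trans (hX.identDistrib_increment_grid n 0).symm)
    ?_ (fun ω => rfl) m
  · filter_upwards [hX.start_zero] with ω h₀
    rw [Nat.cast_zero, zero_div, h₀]
  · filter_upwards [hX.ae_isSubordinatorPath] with ω hω using hω.exists_lt_apply_div_two_pow a n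

theorem IsStableSubordinator.integral_overshoot_mul_postPassage (hX : IsStableSubordinator β X P)
    (a : ℝ) (J : Finset (ℕ × ℕ)) (f : ℝ →ᵇ ℝ) (g : (J → ℝ) →ᵇ ℝ) :
    ∫ ω, f (overshoot X a ω) * g (fun j => postPassage X a (dyadicTime j) ω) ∂P =
      (∫ ω, f (overshoot X a ω) ∂P) * ∫ ω, g (fun j => X (dyadicTime j) ω) ∂P := by
  obtain ⟨M, hM⟩ := exists_dyadicTime_eq J
  set Y : ℕ → ℝ≥0 → Ω → ℝ := fun n t ω => X (gridPassage (fun s => X s ω) a n / 2 ^ n + t) ω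
  have hYm : ∀ n t, Measurable (Y n t) := measurable_comp_gridPassage hX.measurable a
  have hYlim : ∀ᵐ ω ∂P, ∀ t, Filter.Tendsto (fun n => Y n t ω) Filter.atTop
      (nhds (X (passageTime (fun s => X s ω) a + t) ω)) := by
    filter_upwards [hX.ae_isSubordinatorPath] with ω hω t
      using hω.tendsto_apply_gridPassage_add a t
  have hprod : ∀ n ≥ M, P.map (fun ω => (Y n 0 ω, fun j : J => Y n (dyadicTime j) ω - Y n 0 ω)) =
      (P.map (Y n 0)).prod (P.map fun ω (j : J) => X (dyadicTime j) ω) := by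
    intro n hn
    choose m hm using fun j : J => hM n hn j j.2
    simpa only [Y, hm, add_zero] using hX.map_gridPassage_prodMk a n m
  have hlim := integral_mul_of_tendsto_ae_of_map_eq_prod
    (Y' := fun ω => X (passageTime (fun s => X s ω) a) ω)
    (Z' := fun ω (j : J) => postPassage X a (dyadicTime j) ω)
    (Z := fun n ω (j : J) => Y n (dyadicTime j) ω - Y n 0 ω) (fun n => hYm n 0)
    (fun n => measurable_pi_lambda _ fun j => (hYm n _).sub (hYm n 0))
    (Filter.eventually_atTop.mpr ⟨M, hprod⟩)
    (by filter_upwards [hYlim] with ω hω using by simpa only [add_zero] using hω 0)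
    (by
      filter_upwards [hYlim] with ω hω
      refine tendsto_pi_nhds.mpr fun j => ?_
      simpa only [postPassage, add_zero] using (hω (dyadicTime j)).sub (hω 0))
    (f.compContinuous ⟨fun y => y - a, by fun_prop⟩) g
  rwa [integral_map (measurable_pi_lambda _ fun j => hX.measurable _).aemeasurable
    g.continuous.measurable.aestronglyMeasurable] at hlim

theorem IsStableSubordinator.integral_postPassage (hX : IsStableSubordinator β X P) (a : ℝ)
    (J : Finset (ℕ × ℕ)) (g : (J → ℝ) →ᵇ ℝ) :
    ∫ ω, g (fun j => postPassage X a (dyadicTime j) ω) ∂P =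
      ∫ ω, g (fun j => X (dyadicTime j) ω) ∂P := by
  simpa only [BoundedContinuousFunction.const_apply, one_mul, integral_const, probReal_univ,
    smul_eq_mul] using
    hX.integral_overshoot_mul_postPassage a J (BoundedContinuousFunction.const ℝ 1) g

theorem IsStableSubordinator.indepFun_overshoot_postPassage (hX : IsStableSubordinator β X P)
    (a : ℝ) : IndepFun (overshoot X a) (fun ω i => postPassage X a (dyadicTime i) ω) P := by
  refine indepFun_process_of_bcf (hX.aemeasurable_overshoot a)
    (fun i => hX.aemeasurable_postPassage a (dyadicTime i)) fun f J g => ?_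
  exact (hX.integral_overshoot_mul_postPassage a J f g).trans
    (congrArg _ (hX.integral_postPassage a J g).symm)

theorem IsStableSubordinator.map_postPassage (hX : IsStableSubordinator β X P) (a : ℝ) :
    P.map (fun ω i => postPassage X a (dyadicTime i) ω) =
      P.map (fun ω i => X (dyadicTime i) ω) := by
  have hY : ∀ i, AEMeasurable (postPassage X a (dyadicTime i)) P := fun i =>
    hX.aemeasurable_postPassage a (dyadicTime i)
  have hZ : ∀ i, Measurable (X (dyadicTime i)) := fun i => hX.measurable _
  rw [map_eq_iff_forall_finset_map_restrict_eq
    (aemeasurable_pi_lambda (fun ω i => postPassage X a (dyadicTime i) ω) hY)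
    (measurable_pi_lambda (fun ω i => X (dyadicTime i) ω) hZ).aemeasurable]
  intro J
  have hYJ : AEMeasurable (fun ω => J.restrict fun i => postPassage X a (dyadicTime i) ω) P :=
    aemeasurable_pi_lambda _ fun j => hY j
  have hZJ : AEMeasurable (fun ω => J.restrict fun i => X (dyadicTime i) ω) P :=
    aemeasurable_pi_lambda _ fun j => (hZ j).aemeasurable
  have := Measure.isProbabilityMeasure_map hYJ
  have := Measure.isProbabilityMeasure_map hZJ
  refine ext_of_forall_integral_eq_of_IsFiniteMeasure fun g => ?_
  rw [integral_map hYJ g.continuous.measurable.aestronglyMeasurable,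
    integral_map hZJ g.continuous.measurable.aestronglyMeasurable]
  exact hX.integral_postPassage a J g

end Subordinator

/-! ### Potential measures -/

theorem lintegral_Ioi_rpow_mul_exp {p l : ℝ} (hp : 0 < p) (hl : 0 < l) :
    ∫⁻ t in Set.Ioi (0 : ℝ), ENNReal.ofReal (t ^ (p - 1) * Real.exp (-l * t)) =
      ENNReal.ofReal ((1 / l) ^ p * Real.Gamma p) := by
  have hgamma := Real.integral_rpow_mul_exp_neg_mul_Ioi hp hl
  have hpos : 0 < (1 / l) ^ p * Real.Gamma p :=
    mul_pos (by positivity) (Real.Gamma_pos_of_pos hp)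
  have hint : IntegrableOn (fun t : ℝ => t ^ (p - 1) * Real.exp (-(l * t))) (Set.Ioi 0) :=
    not_imp_comm.mp integral_undef (hgamma.trans_ne hpos.ne')
  rw [← hgamma, ofReal_integral_eq_lintegral_ofReal hint]
  · simp_rw [neg_mul]
  · filter_upwards [ae_restrict_mem measurableSet_Ioi] with t ht
    exact mul_nonneg (Real.rpow_nonneg (le_of_lt ht) _) (Real.exp_pos _).le

theorem lintegral_Ioi_exp_neg_mul {k : ℝ} (hk : 0 < k) :
    ∫⁻ t in Set.Ioi (0 : ℝ), ENNReal.ofReal (Real.exp (-k * t)) = ENNReal.ofReal (1 / k) := by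
  simpa using lintegral_Ioi_rpow_mul_exp one_pos hk

/-- The density `x ^ (β - 1) / (c Γ(β))` on `(0, ∞)`, the potential measure of a `β`-stable
subordinator with Laplace exponent `c * l ^ β`. -/
noncomputable def potentialMeasure (β c : ℝ) : Measure ℝ :=
  (volume.restrict (Set.Ioi 0)).withDensity fun x =>
    ENNReal.ofReal (1 / (c * Real.Gamma β) * x ^ (β - 1))

instance (β c : ℝ) : SFinite (potentialMeasure β c) := by
  unfold potentialMeasure; infer_instance

theorem setLIntegral_Ioi_potentialMeasure (β c : ℝ) {a : ℝ} (ha : 0 ≤ a) {f : ℝ → ℝ≥0∞}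
    (hf : Measurable f) :
    ∫⁻ x in Set.Ioi a, f x ∂(potentialMeasure β c) =
      ∫⁻ x in Set.Ioi a, ENNReal.ofReal (1 / (c * Real.Gamma β) * x ^ (β - 1)) * f x := by
  rw [potentialMeasure, restrict_withDensity measurableSet_Ioi,
    Measure.restrict_restrict measurableSet_Ioi, Set.inter_eq_left.mpr (Set.Ioi_subset_Ioi ha),
    lintegral_withDensity_eq_lintegral_mul _ (by fun_prop) hf]
  rfl

theorem lintegral_potentialMeasure (β c : ℝ) {f : ℝ → ℝ≥0∞} (hf : Measurable f) :
    ∫⁻ x, f x ∂(potentialMeasure β c) =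
      ∫⁻ x in Set.Ioi 0, ENNReal.ofReal (1 / (c * Real.Gamma β) * x ^ (β - 1)) * f x := by
  rw [potentialMeasure, lintegral_withDensity_eq_lintegral_mul _ (by fun_prop) hf]
  rfl

theorem laplace_potentialMeasure {β c l : ℝ} (hβ : 0 < β) (hc : 0 < c) (hl : 0 < l) :
    ∫⁻ x, ENNReal.ofReal (Real.exp (-l * x)) ∂(potentialMeasure β c) =
      ENNReal.ofReal (1 / (c * l ^ β)) := by
  have : 0 < Real.Gamma β := Real.Gamma_pos_of_pos hβ
  calc ∫⁻ x, ENNReal.ofReal (Real.exp (-l * x)) ∂(potentialMeasure β c)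
      = ∫⁻ x in Set.Ioi 0, ENNReal.ofReal (1 / (c * Real.Gamma β)) *
          ENNReal.ofReal (x ^ (β - 1) * Real.exp (-l * x)) := by
        rw [lintegral_potentialMeasure β c (by fun_prop)]
        refine lintegral_congr fun x => ?_
        rw [← ENNReal.ofReal_mul' (Real.exp_pos _).le, ← ENNReal.ofReal_mul (by positivity),
          mul_assoc]
    _ = ENNReal.ofReal (1 / (c * Real.Gamma β)) * ENNReal.ofReal ((1 / l) ^ β * Real.Gamma β) := by
        rw [lintegral_const_mul' _ _ ENNReal.ofReal_ne_top, lintegral_Ioi_rpow_mul_exp hβ hl]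
    _ = ENNReal.ofReal (1 / (c * l ^ β)) := by
        rw [← ENNReal.ofReal_mul (by positivity), Real.div_rpow zero_le_one hl.le, Real.one_rpow]
        field_simp

theorem setLIntegral_Ioi_comp_div_sub_one_potentialMeasure {β c a : ℝ} (hβ : 0 < β) (hc : 0 < c)
    (ha : 0 < a) {φ : ℝ → ℝ≥0∞} (hφ : Measurable φ) :
    ∫⁻ x in Set.Ioi a, φ (x / a - 1) ∂(potentialMeasure β c) =
      ENNReal.ofReal a * ENNReal.ofReal (1 / (c * Real.Gamma β) * a ^ (β - 1)) *
        ∫⁻ t in Set.Ioi (0 : ℝ), φ t * ENNReal.ofReal ((1 + t) ^ (β - 1)) := by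
  have : 0 < Real.Gamma β := Real.Gamma_pos_of_pos hβ
  have hshift := setLIntegral_Ioi_add_left volume a 0 fun x =>
    ENNReal.ofReal (1 / (c * Real.Gamma β) * x ^ (β - 1)) * φ (x / a - 1)
  rw [add_zero] at hshift
  rw [setLIntegral_Ioi_potentialMeasure β c ha.le (by fun_prop), ← hshift,
    setLIntegral_Ioi_mul_left ha, mul_assoc]
  congr 1
  rw [← lintegral_const_mul _ (by fun_prop)]
  refine setLIntegral_congr_fun measurableSet_Ioi fun t (ht : 0 < t) => ?_
  have harg : (a + a * t) / a - 1 = t := by field_simp; ring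
  have hpow : (a + a * t) ^ (β - 1) = a ^ (β - 1) * (1 + t) ^ (β - 1) := by
    rw [← Real.mul_rpow ha.le (by positivity), mul_one_add]
  rw [harg, hpow, ← mul_assoc, ENNReal.ofReal_mul (by positivity), mul_assoc,
    mul_comm (ENNReal.ofReal ((1 + t) ^ (β - 1)))]

theorem lintegral_comp_div_potentialMeasure {β c a : ℝ} (hβ : 0 < β) (hc : 0 < c) (ha : 0 < a)
    {φ : ℝ → ℝ≥0∞} (hφ : Measurable φ) :
    ∫⁻ x, φ (x / a) ∂(potentialMeasure β c) =
      ENNReal.ofReal a * ENNReal.ofReal (1 / (c * Real.Gamma β) * a ^ (β - 1)) *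
        ∫⁻ y in Set.Ioi (0 : ℝ), φ y * ENNReal.ofReal (y ^ (β - 1)) := by
  have : 0 < Real.Gamma β := Real.Gamma_pos_of_pos hβ
  rw [lintegral_potentialMeasure β c (by fun_prop), setLIntegral_Ioi_mul_left ha, mul_assoc]
  congr 1
  rw [← lintegral_const_mul _ (by fun_prop)]
  refine setLIntegral_congr_fun measurableSet_Ioi fun y (hy : 0 < y) => ?_
  rw [mul_div_cancel_left₀ y ha.ne', Real.mul_rpow ha.le hy.le, ← mul_assoc,
    ENNReal.ofReal_mul (by positivity), mul_assoc, mul_comm (ENNReal.ofReal (y ^ (β - 1)))]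

theorem IsSubordinatorPath.setLIntegral_indicator_Ioi {x : ℝ≥0 → ℝ} (hx : IsSubordinatorPath x)
    (a : ℝ) (f : ℝ → ℝ≥0∞) :
    ∫⁻ t in Set.Ioi (0 : ℝ), (Set.Ioi a).indicator f (x t.toNNReal) =
      ∫⁻ u in Set.Ioi (0 : ℝ), f (x (passageTime x a + u.toNNReal)) := by
  set τ := passageTime x a
  have hshift : ∫⁻ u in Set.Ioi (0 : ℝ), f (x (τ + u.toNNReal)) =
      ∫⁻ t in Set.Ioi (τ : ℝ), f (x t.toNNReal) := by
    have h := setLIntegral_Ioi_add_left volume (τ : ℝ) 0 fun t => f (x t.toNNReal)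
    rw [add_zero] at h
    rw [← h]
    refine setLIntegral_congr_fun measurableSet_Ioi fun u (hu : 0 < u) => ?_
    rw [Real.toNNReal_add τ.coe_nonneg hu.le, Real.toNNReal_coe]
  have hsplit : Set.Ioc 0 (τ : ℝ) ∪ Set.Ioi (τ : ℝ) = Set.Ioi 0 :=
    Set.Ioc_union_Ioi_eq_Ioi τ.coe_nonneg
  have hbefore : ∫⁻ t in Set.Ioc 0 (τ : ℝ), (Set.Ioi a).indicator f (x t.toNNReal) = 0 := by
    rw [setLIntegral_congr Ioo_ae_eq_Ioc.symm]
    refine setLIntegral_eq_zero measurableSet_Ioo fun t ht => ?_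
    have htτ : t.toNNReal < τ := (Real.toNNReal_lt_iff_lt_coe ht.1.le).mpr ht.2
    exact Set.indicator_of_notMem (not_lt.mpr (le_of_lt_passageTime htτ)) f
  have hafter : ∫⁻ t in Set.Ioi (τ : ℝ), (Set.Ioi a).indicator f (x t.toNNReal) =
      ∫⁻ t in Set.Ioi (τ : ℝ), f (x t.toNNReal) := by
    refine setLIntegral_congr_fun measurableSet_Ioi fun t ht => ?_
    exact Set.indicator_of_mem (hx.lt_of_passageTime_lt (Real.lt_toNNReal_iff_coe_lt.mpr ht)) f
  rw [← hsplit, lintegral_union measurableSet_Ioi (Set.Ioc_disjoint_Ioi le_rfl), hbefore, zero_add,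
    hafter, hsplit, hshift]

theorem apply_passageTime {Ω : Type*} (X : ℝ≥0 → Ω → ℝ) (a : ℝ) (ω : Ω) :
    X (passageTime (fun s => X s ω) a) ω = a + overshoot X a ω :=
  (add_sub_cancel a _).symm

section Subordinator

variable {Ω : Type*} [MeasurableSpace Ω] {P : Measure Ω} {β c : ℝ} {X : ℝ≥0 → Ω → ℝ}

theorem aemeasurable_uncurry_of_continuousWithinAt_Ici {Z : ℝ≥0 → Ω → ℝ}
    (hm : ∀ i, AEMeasurable (Z (dyadicTime i)) P)
    (hrc : ∀ᵐ ω ∂P, ∀ t, ContinuousWithinAt (fun s => Z s ω) (Set.Ici t) t) :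
    AEMeasurable (fun p : ℝ × Ω => Z p.1.toNNReal p.2) ((volume.restrict (Set.Ioi 0)).prod P) := by
  choose W hW hZW using hm
  refine aemeasurable_of_tendsto_metrizable_ae Filter.atTop
    (f := fun n p => Z (dyadicTime (dyadicAbove p.1.toNNReal n)) p.2) (fun n => ?_) ?_
  · refine ⟨fun p => W (dyadicAbove p.1.toNNReal n) p.2, ?_, ?_⟩
    · have huncurry : Measurable fun p : (ℕ × ℕ) × Ω => W p.1 p.2 :=
        measurable_from_prod_countable_right hW
      have hdyadic : Measurable fun p : ℝ × Ω => dyadicAbove p.1.toNNReal n :=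
        measurable_const.prodMk ((Nat.measurable_floor.comp (by fun_prop)).add_const 1)
      exact huncurry.comp (hdyadic.prodMk measurable_snd)
    · filter_upwards [Measure.quasiMeasurePreserving_snd.ae (ae_all_iff.mpr hZW)] with p hp
        using hp _
  · filter_upwards [Measure.quasiMeasurePreserving_snd.ae hrc] with p hp
    exact tendsto_comp_of_continuousWithinAt_Ici (hp _)
      (fun n => (lt_dyadicTime_dyadicAbove _ n).le) (tendsto_dyadicAbove _)

theorem tendsto_integral_exp_neg_mul [IsFiniteMeasure P] {Y : ℕ → Ω → ℝ} {Y' : Ω → ℝ}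
    (hY : ∀ n, AEMeasurable (Y n) P) (hY₀ : ∀ n, ∀ᵐ ω ∂P, 0 ≤ Y n ω)
    (hlim : ∀ᵐ ω ∂P, Filter.Tendsto (fun n => Y n ω) Filter.atTop (nhds (Y' ω))) {l : ℝ}
    (hl : 0 ≤ l) :
    Filter.Tendsto (fun n => ∫ ω, Real.exp (-l * Y n ω) ∂P) Filter.atTop
      (nhds (∫ ω, Real.exp (-l * Y' ω) ∂P)) := by
  refine tendsto_integral_of_dominated_convergence (fun _ => 1)
    (fun n => (integrable_exp_neg_mul (hY n) (hY₀ n) hl).aestronglyMeasurable)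
    (integrable_const _) (fun n => ?_) ?_
  · filter_upwards [hY₀ n] with ω hω
    rw [Real.norm_of_nonneg (Real.exp_pos _).le, Real.exp_le_one_iff, neg_mul]
    exact neg_nonpos.mpr (mul_nonneg hl hω)
  · filter_upwards [hlim] with ω hω using (Real.continuous_exp.tendsto _).comp (hω.const_mul _)

/-- The process `X` has the Laplace transforms of a `β`-stable subordinator with exponent
`c * l ^ β`; this names the constant that `IsStableSubordinator.laplace` only asserts to exist. -/
def HasStableLaplaceExponent (β c : ℝ) (X : ℝ≥0 → Ω → ℝ) (P : Measure Ω) : Prop :=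
  ∀ (t : ℝ≥0) (l : ℝ), 0 ≤ l → ∫ ω, Real.exp (-l * X t ω) ∂P = Real.exp (-c * t * l ^ β)

/-- The occupation measure of a process: the expected time spent in a set by its paths. -/
noncomputable def occupationMeasure (X : ℝ≥0 → Ω → ℝ) (P : Measure Ω) : Measure ℝ :=
  ((volume.restrict (Set.Ioi 0)).prod P).map fun p : ℝ × Ω => X p.1.toNNReal p.2

namespace IsStableSubordinator

theorem aemeasurable_uncurry (hX : IsStableSubordinator β X P) :
    AEMeasurable (fun p : ℝ × Ω => X p.1.toNNReal p.2) ((volume.restrict (Set.Ioi 0)).prod P) :=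
  aemeasurable_uncurry_of_continuousWithinAt_Ici (fun _ => (hX.measurable _).aemeasurable)
    hX.right_continuous

variable [IsProbabilityMeasure P]

theorem aemeasurable_uncurry_passageTime_add (hX : IsStableSubordinator β X P) (a : ℝ) :
    AEMeasurable (fun p : ℝ × Ω => X (passageTime (fun s => X s p.2) a + p.1.toNNReal) p.2)
      ((volume.restrict (Set.Ioi 0)).prod P) := by
  refine aemeasurable_uncurry_of_continuousWithinAt_Ici
    (Z := fun u ω => X (passageTime (fun s => X s ω) a + u) ω)
    (fun i => hX.aemeasurable_passageTime_add a _) ?_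
  filter_upwards [hX.ae_isSubordinatorPath] with ω hω t
  exact (hω.continuousWithinAt _).comp (by fun_prop) fun u hu =>
    Set.mem_Ici.mpr (add_le_add_right (Set.mem_Ici.mp hu) _)

theorem occupationMeasure_eq_potentialMeasure (hβ : 0 < β) (hX : IsStableSubordinator β X P)
    (hc : 0 < c) (hlap : HasStableLaplaceExponent β c X P) :
    occupationMeasure X P = potentialMeasure β c := by
  have hlaplace : ∀ l : ℝ, 0 < l → ∫⁻ x, ENNReal.ofReal (Real.exp (-l * x))
      ∂(occupationMeasure X P) = ENNReal.ofReal (1 / (c * l ^ β)) := by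
    intro l hl
    have hexp : Measurable fun x : ℝ => ENNReal.ofReal (Real.exp (-l * x)) := by fun_prop
    rw [occupationMeasure, lintegral_map' hexp.aemeasurable hX.aemeasurable_uncurry,
      lintegral_prod _ (by exact hexp.comp_aemeasurable hX.aemeasurable_uncurry),
      ← lintegral_Ioi_exp_neg_mul (by positivity)]
    refine setLIntegral_congr_fun measurableSet_Ioi fun t (ht : 0 < t) => ?_
    dsimp only
    rw [← ofReal_integral_eq_lintegral_ofReal (hX.integrable_exp hl.le _)
      (Filter.Eventually.of_forall fun ω => (Real.exp_pos _).le), hlap _ l hl.le,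
      Real.coe_toNNReal _ ht.le, neg_mul, neg_mul, mul_right_comm, neg_mul]
  refine measure_eq_of_laplace_eq (fun l hl => ?_) fun l hl => ?_
  · exact hlaplace l hl ▸ ENNReal.ofReal_ne_top
  · rw [hlaplace l hl, laplace_potentialMeasure hβ hc hl]

theorem integral_exp_postPassage (hX : IsStableSubordinator β X P) (a l : ℝ) (i : ℕ × ℕ) :
    ∫ ω, Real.exp (-l * postPassage X a (dyadicTime i) ω) ∂P =
      ∫ ω, Real.exp (-l * X (dyadicTime i) ω) ∂P := by
  have hident : IdentDistrib (fun ω i => postPassage X a (dyadicTime i) ω)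
      (fun ω i => X (dyadicTime i) ω) P P :=
    ⟨aemeasurable_pi_lambda _ fun i => hX.aemeasurable_postPassage a (dyadicTime i),
      (measurable_pi_lambda _ fun i => hX.measurable _).aemeasurable, hX.map_postPassage a⟩
  exact (hident.comp (u := fun y => Real.exp (-l * y i)) (by fun_prop)).integral_eq

theorem integral_exp_passageTime_add_dyadicTime (hX : IsStableSubordinator β X P) (a l : ℝ)
    (i : ℕ × ℕ) :
    ∫ ω, Real.exp (-l * X (passageTime (fun s => X s ω) a + dyadicTime i) ω) ∂P =
      (∫ ω, Real.exp (-l * (a + overshoot X a ω)) ∂P) *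
        ∫ ω, Real.exp (-l * X (dyadicTime i) ω) ∂P := by
  have hindep : IndepFun (fun ω => Real.exp (-l * (a + overshoot X a ω)))
      (fun ω => Real.exp (-l * postPassage X a (dyadicTime i) ω)) P :=
    (hX.indepFun_overshoot_postPassage a).comp
      (φ := fun b => Real.exp (-l * (a + b))) (ψ := fun y : ℕ × ℕ → ℝ => Real.exp (-l * y i))
      (by fun_prop) (by fun_prop)
  rw [← hX.integral_exp_postPassage a, ← hindep.integral_fun_mul_eq_mul_integral
    (by have := hX.aemeasurable_overshoot a; fun_prop)
    (by have := hX.aemeasurable_postPassage a (dyadicTime i); fun_prop)]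
  refine integral_congr_ae (Filter.Eventually.of_forall fun ω => ?_)
  dsimp only
  rw [← Real.exp_add, ← apply_passageTime, ← mul_add, postPassage, add_sub_cancel]

theorem integral_exp_passageTime_add (hX : IsStableSubordinator β X P)
    (hlap : HasStableLaplaceExponent β c X P) (a : ℝ) {l : ℝ} (hl : 0 ≤ l) (u : ℝ≥0) :
    ∫ ω, Real.exp (-l * X (passageTime (fun s => X s ω) a + u) ω) ∂P =
      (∫ ω, Real.exp (-l * (a + overshoot X a ω)) ∂P) * Real.exp (-c * u * l ^ β) := by
  have hleft : Filter.Tendsto (fun n => ∫ ω, Real.exp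
      (-l * X (passageTime (fun s => X s ω) a + dyadicTime (dyadicAbove u n)) ω) ∂P) Filter.atTop
      (nhds (∫ ω, Real.exp (-l * X (passageTime (fun s => X s ω) a + u) ω) ∂P)) := by
    refine tendsto_integral_exp_neg_mul (fun n => hX.aemeasurable_passageTime_add a _)
      (fun n => hX.ae_nonneg.mono fun ω hω => hω _) ?_ hl
    filter_upwards [hX.ae_isSubordinatorPath] with ω hω
    exact tendsto_comp_of_continuousWithinAt_Ici (hω.continuousWithinAt _)
      (fun n => by gcongr; exact (lt_dyadicTime_dyadicAbove u n).le)
      ((tendsto_dyadicAbove u).const_add _)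
  have hright : Filter.Tendsto (fun n => (∫ ω, Real.exp (-l * (a + overshoot X a ω)) ∂P) *
      Real.exp (-c * dyadicTime (dyadicAbove u n) * l ^ β)) Filter.atTop
      (nhds ((∫ ω, Real.exp (-l * (a + overshoot X a ω)) ∂P) * Real.exp (-c * u * l ^ β))) := by
    have hu : Filter.Tendsto (fun n => (dyadicTime (dyadicAbove u n) : ℝ)) Filter.atTop
        (nhds (u : ℝ)) := (NNReal.continuous_coe.tendsto u).comp (tendsto_dyadicAbove u)
    exact ((Real.continuous_exp.tendsto _).comp ((hu.const_mul (-c)).mul_const _)).const_mul _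
  refine tendsto_nhds_unique hleft (hright.congr fun n => ?_)
  rw [hX.integral_exp_passageTime_add_dyadicTime, hlap _ l hl]

theorem setLIntegral_Ioi_occupationMeasure (hX : IsStableSubordinator β X P) (a : ℝ)
    {f : ℝ → ℝ≥0∞} (hf : Measurable f) :
    ∫⁻ x in Set.Ioi a, f x ∂(occupationMeasure X P) =
      ∫⁻ u in Set.Ioi (0 : ℝ), ∫⁻ ω, f (X (passageTime (fun s => X s ω) a + u.toNNReal) ω) ∂P := by
  have hind := hf.indicator (measurableSet_Ioi (a := a))
  have hpost : AEMeasurable (fun p : ℝ × Ω =>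
      f (X (passageTime (fun s => X s p.2) a + p.1.toNNReal) p.2))
      ((volume.restrict (Set.Ioi 0)).prod P) :=
    hf.comp_aemeasurable (hX.aemeasurable_uncurry_passageTime_add a)
  calc ∫⁻ x in Set.Ioi a, f x ∂(occupationMeasure X P)
      = ∫⁻ p : ℝ × Ω, (Set.Ioi a).indicator f (X p.1.toNNReal p.2)
          ∂((volume.restrict (Set.Ioi 0)).prod P) := by
        rw [← lintegral_indicator measurableSet_Ioi, occupationMeasure,
          lintegral_map' hind.aemeasurable hX.aemeasurable_uncurry]
    _ = ∫⁻ ω, ∫⁻ t in Set.Ioi (0 : ℝ), (Set.Ioi a).indicator f (X t.toNNReal ω) ∂volume ∂P :=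
        lintegral_prod_symm _ (hind.comp_aemeasurable hX.aemeasurable_uncurry)
    _ = ∫⁻ ω, ∫⁻ u in Set.Ioi (0 : ℝ),
          f (X (passageTime (fun s => X s ω) a + u.toNNReal) ω) ∂volume ∂P := by
        refine lintegral_congr_ae ?_
        filter_upwards [hX.ae_isSubordinatorPath] with ω hω using hω.setLIntegral_indicator_Ioi a f
    _ = ∫⁻ u in Set.Ioi (0 : ℝ),
          ∫⁻ ω, f (X (passageTime (fun s => X s ω) a + u.toNNReal) ω) ∂P :=
        (lintegral_prod_symm _ hpost).symm.trans (lintegral_prod _ hpost)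

theorem laplace_occupationMeasure_Ioi (hX : IsStableSubordinator β X P) (hc : 0 < c)
    (hlap : HasStableLaplaceExponent β c X P) (a : ℝ) {l : ℝ} (hl : 0 < l) :
    ∫⁻ x in Set.Ioi a, ENNReal.ofReal (Real.exp (-l * x)) ∂(occupationMeasure X P) =
      (∫⁻ ω, ENNReal.ofReal (Real.exp (-l * (a + overshoot X a ω))) ∂P) *
        ENNReal.ofReal (1 / (c * l ^ β)) := by
  have hint : ∀ u : ℝ≥0, Integrable
      (fun ω => Real.exp (-l * X (passageTime (fun s => X s ω) a + u) ω)) P := fun u =>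
    integrable_exp_neg_mul (hX.aemeasurable_passageTime_add a u)
      (hX.ae_nonneg.mono fun ω hω => hω _) hl.le
  have hint_overshoot : Integrable (fun ω => Real.exp (-l * (a + overshoot X a ω))) P := by
    simpa only [add_zero, apply_passageTime] using hint 0
  rw [hX.setLIntegral_Ioi_occupationMeasure a (by fun_prop),
    ← lintegral_Ioi_exp_neg_mul (by positivity), ← lintegral_const_mul _ (by fun_prop)]
  refine setLIntegral_congr_fun measurableSet_Ioi fun u (hu : 0 < u) => ?_
  rw [← ofReal_integral_eq_lintegral_ofReal (hint _)
      (Filter.Eventually.of_forall fun ω => (Real.exp_pos _).le),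
    ← ofReal_integral_eq_lintegral_ofReal hint_overshoot
      (Filter.Eventually.of_forall fun ω => (Real.exp_pos _).le),
    hX.integral_exp_passageTime_add hlap a hl.le, ENNReal.ofReal_mul' (Real.exp_pos _).le,
    Real.coe_toNNReal _ hu.le, neg_mul, neg_mul, mul_right_comm, neg_mul]

-- The renewal equation: the strong Markov property restarts the potential at the first passage.
theorem restrict_Ioi_potentialMeasure (hβ : 0 < β) (hX : IsStableSubordinator β X P) (hc : 0 < c)
    (hlap : HasStableLaplaceExponent β c X P) (a : ℝ) :
    (potentialMeasure β c).restrict (Set.Ioi a) =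
      ((P.map (overshoot X a)).prod (potentialMeasure β c)).map fun p => a + p.1 + p.2 := by
  refine measure_eq_of_laplace_eq (fun l hl => ?_) fun l hl => ?_
  · refine ((setLIntegral_le_lintegral _ _).trans_lt ?_).ne
    rw [laplace_potentialMeasure hβ hc hl]
    exact ENNReal.ofReal_lt_top
  · have hexp : Measurable fun b : ℝ => ENNReal.ofReal (Real.exp (-l * (a + b))) := by fun_prop
    have hinner : Measurable fun b => ∫⁻ y, ENNReal.ofReal (Real.exp (-l * (a + b + y)))
        ∂(potentialMeasure β c) :=
      Measurable.lintegral_prod_right' (f := fun p : ℝ × ℝ =>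
        ENNReal.ofReal (Real.exp (-l * (a + p.1 + p.2)))) (by fun_prop)
    rw [← hX.occupationMeasure_eq_potentialMeasure hβ hc hlap,
      hX.laplace_occupationMeasure_Ioi hc hlap a hl,
      hX.occupationMeasure_eq_potentialMeasure hβ hc hlap,
      lintegral_map (by fun_prop) (by fun_prop), lintegral_prod _ (by fun_prop),
      lintegral_map' hinner.aemeasurable (hX.aemeasurable_overshoot a),
      ← laplace_potentialMeasure hβ hc hl,
      ← lintegral_mul_const'' _ (by exact hexp.comp_aemeasurable (hX.aemeasurable_overshoot a))]
    refine lintegral_congr fun ω => ?_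
    rw [← lintegral_const_mul _ (by fun_prop)]
    refine lintegral_congr fun y => ?_
    rw [← ENNReal.ofReal_mul (Real.exp_pos _).le, ← Real.exp_add, mul_add (-l) _ y]

theorem hasPotentialIdentity (hβ : 0 < β) (hX : IsStableSubordinator β X P) {a : ℝ}
    (ha : 0 < a) : HasPotentialIdentity β (P.map fun ω => overshoot X a ω / a) := by
  obtain ⟨c, hc, hlap⟩ := hX.laplace
  intro φ hφ
  have : 0 < Real.Gamma β := Real.Gamma_pos_of_pos hβ
  have hover := hX.aemeasurable_overshoot a
  set k : ℝ≥0∞ := ENNReal.ofReal a * ENNReal.ofReal (1 / (c * Real.Gamma β) * a ^ (β - 1)) with hk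
  have hk₀ : k ≠ 0 := mul_ne_zero (ENNReal.ofReal_pos.mpr ha).ne'
    (ENNReal.ofReal_pos.mpr (by positivity)).ne'
  have hk_top : k ≠ ∞ := ENNReal.mul_ne_top ENNReal.ofReal_ne_top ENNReal.ofReal_ne_top
  have hψ : Measurable fun x => φ (x / a - 1) := by fun_prop
  have hinner : Measurable fun b => ∫⁻ y, φ ((a + b + y) / a - 1) ∂(potentialMeasure β c) :=
    Measurable.lintegral_prod_right' (f := fun p : ℝ × ℝ => φ ((a + p.1 + p.2) / a - 1))
      (by fun_prop)
  have hconv : Measurable fun b => ∫⁻ y in Set.Ioi 0, φ (b + y) * ENNReal.ofReal (y ^ (β - 1)) :=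
    Measurable.lintegral_prod_right' (f := fun p : ℝ × ℝ =>
      φ (p.1 + p.2) * ENNReal.ofReal (p.2 ^ (β - 1))) (by fun_prop)
  have hscale : ∀ ω, ∫⁻ y, φ ((a + overshoot X a ω + y) / a - 1) ∂(potentialMeasure β c) =
      k * ∫⁻ y in Set.Ioi (0 : ℝ), φ (overshoot X a ω / a + y) * ENNReal.ofReal (y ^ (β - 1)) := by
    intro ω
    rw [hk, ← lintegral_comp_div_potentialMeasure hβ hc ha
      (φ := fun z => φ (overshoot X a ω / a + z)) (by fun_prop)]
    refine lintegral_congr fun y => congrArg φ ?_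
    field_simp
    ring
  refine (ENNReal.mul_right_inj hk₀ hk_top).mp ?_
  rw [← setLIntegral_Ioi_comp_div_sub_one_potentialMeasure hβ hc ha hφ,
    hX.restrict_Ioi_potentialMeasure hβ hc hlap a, lintegral_map hψ (by fun_prop),
    lintegral_prod _ (by fun_prop), lintegral_map' hinner.aemeasurable hover]
  simp_rw [hscale]
  rw [lintegral_const_mul' _ _ hk_top, lintegral_map' hconv.aemeasurable (hover.div_const a)]

end IsStableSubordinator

end Subordinator

/-! ### Overshoots and closed ranges of stable subordinators -/

theorem overshootLaw_Iic_zero (β : ℝ) : overshootLaw β (Set.Iic 0) = 0 := by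
  have h := ae_iff.mp (ae_overshootLaw_pos β)
  simp only [not_lt] at h
  exact h

theorem tendsto_overshootLaw_Iic {β : ℝ} (h0 : 0 < β) (h1 : β < 1) :
    Filter.Tendsto (fun ε => overshootLaw β (Set.Iic ε)) (nhdsWithin 0 (Set.Ioi 0)) (nhds 0) := by
  have := isProbabilityMeasure_overshootLaw h0 h1
  have hlim := tendsto_measure_biInter_gt (μ := overshootLaw β) (a := (0 : ℝ))
    (fun ε _ => measurableSet_Iic.nullMeasurableSet) (fun i j _ hij => Set.Iic_subset_Iic.mpr hij)
    ⟨1, one_pos, measure_ne_top _ _⟩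
  have hinter : ⋂ ε > (0 : ℝ), Set.Iic ε = Set.Iic 0 := by
    ext u
    simp only [Set.mem_iInter, Set.mem_Iic]
    exact ⟨fun h => le_of_forall_gt_imp_ge_of_dense h, fun h ε hε => h.trans hε.le⟩
  rwa [hinter, overshootLaw_Iic_zero] at hlim

theorem mem_closure_range_passageTime_add {x : ℝ≥0 → ℝ} {a y : ℝ} (hay : a < y)
    (hy : y ∈ closure (Set.range x)) :
    y ∈ closure (Set.range fun u => x (passageTime x a + u)) := by
  rw [mem_closure_iff] at hy ⊢
  intro U hU hyU
  obtain ⟨_, ⟨htU, hat⟩, t, rfl⟩ := hy (U ∩ Set.Ioi a) (hU.inter isOpen_Ioi) ⟨hyU, hay⟩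
  exact ⟨_, htU, t - passageTime x a, by simp only [add_tsub_cancel_of_le (passageTime_le hat)]⟩

namespace IsSubordinatorPath

variable {x : ℝ≥0 → ℝ} {a : ℝ}

theorem apply_passageTime_le_of_mem_closure (hx : IsSubordinatorPath x)
    (ha : a < x (passageTime x a)) (hmem : a ∈ closure (Set.range x)) {b : ℝ} (hb : b < a) :
    x (passageTime x b) ≤ a := by
  obtain ⟨_, ⟨hbt, hta⟩, t, rfl⟩ :=
    mem_closure_iff.mp hmem (Set.Ioo b (x (passageTime x a))) isOpen_Ioo ⟨hb, ha⟩
  have htτ : t < passageTime x a := not_le.mp fun hle => (hx.mono hle).not_gt hta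
  exact (hx.mono (passageTime_le hbt)).trans (le_of_lt_passageTime htτ)

theorem nextPoint_closure_range (hx : IsSubordinatorPath x) (ha : a ∉ closure (Set.range x)) :
    nextPoint a (TopologicalSpace.Closeds.closure (Set.range x)) = x (passageTime x a) := by
  refine IsLeast.csInf_eq ⟨⟨subset_closure ⟨_, rfl⟩, hx.le_apply_passageTime a⟩, ?_⟩
  rintro y ⟨hy, hay⟩
  have hlt : a < y := lt_of_le_of_ne hay fun heq => ha (heq ▸ hy)
  refine closure_minimal ?_ isClosed_Ici (mem_closure_range_passageTime_add hlt hy)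
  rintro _ ⟨u, rfl⟩
  exact hx.mono le_self_add

theorem tailFrom_closure_range (hx : IsSubordinatorPath x) (ha : a < x (passageTime x a)) :
    tailFrom (x (passageTime x a)) (TopologicalSpace.Closeds.closure (Set.range x)) =
      TopologicalSpace.Closeds.closure
        (Set.range fun u => x (passageTime x a + u) - x (passageTime x a)) := by
  set τ := passageTime x a
  ext z
  change (0 ≤ z ∧ x τ + z ∈ closure (Set.range x)) ↔
    z ∈ closure (Set.range fun u => x (τ + u) - x τ)
  refine ⟨fun ⟨hz, hmem⟩ => ?_, fun hmem => ⟨?_, ?_⟩⟩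
  · have hpost := mem_closure_range_passageTime_add (ha.trans_le (le_add_of_nonneg_right hz)) hmem
    simpa only [add_sub_cancel_left] using
      map_mem_closure (f := fun y => y - x τ) (t := Set.range fun u => x (τ + u) - x τ)
        (by fun_prop) hpost (Set.forall_mem_range.mpr fun u => ⟨u, rfl⟩)
  · exact closure_minimal (Set.range_subset_iff.mpr fun u => sub_nonneg.mpr (hx.mono le_self_add))
      isClosed_Ici hmem
  · exact map_mem_closure (f := fun y => x τ + y) (by fun_prop) hmem
      (Set.forall_mem_range.mpr fun u => ⟨τ + u, (add_sub_cancel _ _).symm⟩)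

end IsSubordinatorPath

/-- The distance from `a` to the first point of `F` on `[a, ∞)`, together with the part of `F`
beyond that point. -/
noncomputable def splitAt (a : ℝ) (F : TopologicalSpace.Closeds ℝ) :
    ℝ × TopologicalSpace.Closeds ℝ :=
  (nextPoint a F - a, tailFrom (nextPoint a F) F)

theorem measurable_splitAt_uncurry :
    Measurable fun p : ℝ × TopologicalSpace.Closeds ℝ => splitAt p.1 p.2 :=
  (measurable_nextPoint_uncurry.sub measurable_fst).prodMk
    (measurable_tailFrom_uncurry.comp (measurable_nextPoint_uncurry.prodMk measurable_snd))

theorem measurable_splitAt (a : ℝ) : Measurable (splitAt a) :=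
  measurable_splitAt_uncurry.comp (measurable_const.prodMk measurable_id)

/-- Laws of random closed subsets of `[0, ∞)` that are unbounded, contain `0`, and regenerate after
each level `a > 0`, with first point `a + a * U` beyond `a`, where `U` has law `overshootLaw β`. -/
structure IsStableRegenerativeLaw (β : ℝ) (ρ : Measure (TopologicalSpace.Closeds ℝ)) : Prop where
  isProbabilityMeasure : IsProbabilityMeasure ρ
  ae_nonneg : ∀ᵐ F ∂ρ, ∀ x ∈ F, 0 ≤ x
  ae_zero_mem : ∀ᵐ F ∂ρ, 0 ∈ F
  ae_unbounded : ∀ᵐ F : TopologicalSpace.Closeds ℝ ∂ρ,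
    ∀ n : ℕ, ((F : Set ℝ) ∩ Set.Ioi (n : ℝ)).Nonempty
  map_splitAt : ∀ a : ℝ, 0 < a → ρ.map (splitAt a) = ((overshootLaw β).map fun u => a * u).prod ρ

theorem measurableSet_closeds_forall_nonneg :
    MeasurableSet {F : TopologicalSpace.Closeds ℝ | ∀ x ∈ F, 0 ≤ x} := by
  convert! (measurableSet_closeds_hit_isOpen (isOpen_Iio (a := (0 : ℝ)))).compl using 1
  ext F
  simp only [Set.mem_ofPred_eq, Set.mem_compl_iff, Set.not_nonempty_iff_eq_empty,
    Set.eq_empty_iff_forall_notMem, Set.mem_inter_iff, Set.mem_Iio, not_and, not_lt,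
    SetLike.mem_coe]

theorem measurableSet_closeds_mem (x : ℝ) :
    MeasurableSet {F : TopologicalSpace.Closeds ℝ | x ∈ F} := by
  convert! measurableSet_closeds_hit_isCompact (isCompact_singleton (x := x)) using 1
  ext F
  simp

section Subordinator

variable {Ω : Type*} [MeasurableSpace Ω] {P : Measure Ω} {β : ℝ} {X : ℝ≥0 → Ω → ℝ}

namespace IsStableSubordinator

theorem ae_closedRange_eq (hX : IsStableSubordinator β X P) :
    ∀ᵐ ω ∂P, closedRange X ω =
      TopologicalSpace.Closeds.closure (Set.range fun i => X (dyadicTime i) ω) := by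
  filter_upwards [hX.right_continuous] with ω hω
  exact SetLike.coe_injective (closure_range_eq_closure_range_dyadic hω)

theorem aemeasurable_closedRange (hX : IsStableSubordinator β X P) :
    AEMeasurable (closedRange X) P :=
  ⟨_, measurable_closeds_closure_range.comp
    (measurable_pi_lambda (fun ω i => X (dyadicTime i) ω) fun _ => hX.measurable _),
    hX.ae_closedRange_eq⟩

variable [IsProbabilityMeasure P]

theorem map_overshoot_div (h0 : 0 < β) (h1 : β < 1) (hX : IsStableSubordinator β X P) {a : ℝ}
    (ha : 0 < a) : (P.map fun ω => overshoot X a ω / a) = overshootLaw β :=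
  have := isProbabilityMeasure_overshootLaw h0 h1
  have := Measure.isProbabilityMeasure_map ((hX.aemeasurable_overshoot a).div_const a)
  (hX.hasPotentialIdentity h0 ha).measure_eq h0 h1 (hasPotentialIdentity_overshootLaw h0 h1)

theorem map_overshoot (h0 : 0 < β) (h1 : β < 1) (hX : IsStableSubordinator β X P) {a : ℝ}
    (ha : 0 < a) : P.map (overshoot X a) = (overshootLaw β).map fun u => a * u := by
  rw [← hX.map_overshoot_div h0 h1 ha, AEMeasurable.map_map_of_aemeasurable (by fun_prop)
    ((hX.aemeasurable_overshoot a).div_const a)]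
  exact congrArg P.map (funext fun ω => (mul_div_cancel₀ _ ha.ne').symm)

theorem ae_overshoot_pos (h0 : 0 < β) (h1 : β < 1) (hX : IsStableSubordinator β X P) {a : ℝ}
    (ha : 0 < a) : ∀ᵐ ω ∂P, 0 < overshoot X a ω := by
  have hpos := ae_overshootLaw_pos β
  rw [← hX.map_overshoot_div h0 h1 ha] at hpos
  filter_upwards [ae_of_ae_map ((hX.aemeasurable_overshoot a).div_const a) hpos] with ω hω
  exact (div_pos_iff_of_pos_right ha).mp hω

-- If `a` is in the closed range, the passage over `a / (1 + ε)` lands at most at `a`.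
theorem measure_mem_closure_range_le (h0 : 0 < β) (h1 : β < 1) (hX : IsStableSubordinator β X P)
    {a ε : ℝ} (ha : 0 < a) (hε : 0 < ε) :
    P {ω | a ∈ closure (Set.range fun t => X t ω)} ≤ overshootLaw β (Set.Iic ε) := by
  set b := a / (1 + ε) with hb
  have hb₀ : 0 < b := by positivity
  have hba : b < a := div_lt_self ha (lt_add_of_pos_right 1 hε)
  have hgap : a - b = ε * b := by rw [hb]; field_simp; ring
  rw [← hX.map_overshoot_div h0 h1 hb₀, Measure.map_apply_of_aemeasurable
    ((hX.aemeasurable_overshoot b).div_const b) measurableSet_Iic]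
  refine measure_mono_ae ?_
  filter_upwards [hX.ae_isSubordinatorPath, hX.ae_overshoot_pos h0 h1 ha] with ω hω hpos hmem
  have hle : overshoot X b ω ≤ a - b :=
    sub_le_sub_right (hω.apply_passageTime_le_of_mem_closure (sub_pos.mp hpos) hmem hba) b
  exact (div_le_iff₀ hb₀).mpr (hle.trans_eq hgap)

theorem ae_notMem_closure_range (h0 : 0 < β) (h1 : β < 1) (hX : IsStableSubordinator β X P)
    {a : ℝ} (ha : 0 < a) : ∀ᵐ ω ∂P, a ∉ closure (Set.range fun t => X t ω) := by
  refine ae_iff.mpr ?_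
  simp only [not_not]
  refine nonpos_iff_eq_zero.mp (ge_of_tendsto (tendsto_overshootLaw_Iic h0 h1) ?_)
  filter_upwards [self_mem_nhdsWithin] with ε hε using hX.measure_mem_closure_range_le h0 h1 ha hε

theorem ae_splitAt_closedRange_eq (h0 : 0 < β) (h1 : β < 1) (hX : IsStableSubordinator β X P)
    {a : ℝ} (ha : 0 < a) :
    ∀ᵐ ω ∂P, splitAt a (closedRange X ω) = (overshoot X a ω,
      TopologicalSpace.Closeds.closure (Set.range fun i => postPassage X a (dyadicTime i) ω)) := by
  filter_upwards [hX.ae_isSubordinatorPath, hX.ae_overshoot_pos h0 h1 ha,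
    hX.ae_notMem_closure_range h0 h1 ha] with ω hω hpos hnot
  have hdyadic : TopologicalSpace.Closeds.closure (Set.range fun u => postPassage X a u ω) =
      TopologicalSpace.Closeds.closure (Set.range fun i => postPassage X a (dyadicTime i) ω) :=
    SetLike.coe_injective
      (closure_range_eq_closure_range_dyadic (hω.continuousWithinAt_shift_Ici _))
  rw [splitAt, closedRange, hω.nextPoint_closure_range hnot,
    hω.tailFrom_closure_range (sub_pos.mp hpos), ← hdyadic]
  rfl

theorem map_closure_range_postPassage (hX : IsStableSubordinator β X P) (a : ℝ) :
    P.map (fun ω => TopologicalSpace.Closeds.closure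
      (Set.range fun i => postPassage X a (dyadicTime i) ω)) = P.map (closedRange X) := by
  rw [Measure.map_congr hX.ae_closedRange_eq]
  have hident : IdentDistrib (fun ω i => postPassage X a (dyadicTime i) ω)
      (fun ω i => X (dyadicTime i) ω) P P :=
    ⟨aemeasurable_pi_lambda _ fun i => hX.aemeasurable_postPassage a (dyadicTime i),
      (measurable_pi_lambda _ fun i => hX.measurable _).aemeasurable, hX.map_postPassage a⟩
  exact (hident.comp measurable_closeds_closure_range).map_eq

theorem map_splitAt (h0 : 0 < β) (h1 : β < 1) (hX : IsStableSubordinator β X P) {a : ℝ}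
    (ha : 0 < a) :
    (P.map (closedRange X)).map (splitAt a) =
      ((overshootLaw β).map fun u => a * u).prod (P.map (closedRange X)) := by
  have hclosure := measurable_closeds_closure_range (ι := ℕ × ℕ)
  have hindep : IndepFun (overshoot X a) (fun ω => TopologicalSpace.Closeds.closure
      (Set.range fun i => postPassage X a (dyadicTime i) ω)) P :=
    (hX.indepFun_overshoot_postPassage a).comp (φ := id) measurable_id hclosure
  rw [AEMeasurable.map_map_of_aemeasurable (measurable_splitAt a).aemeasurable
    hX.aemeasurable_closedRange, ← hX.map_overshoot h0 h1 ha, ← hX.map_closure_range_postPassage a]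
  refine (Measure.map_congr (hX.ae_splitAt_closedRange_eq h0 h1 ha)).trans ?_
  exact (indepFun_iff_map_prod_eq_prod_map_map (hX.aemeasurable_overshoot a)
    (hclosure.comp_aemeasurable (aemeasurable_pi_lambda _ fun i =>
      hX.aemeasurable_postPassage a (dyadicTime i)))).mp hindep

theorem isStableRegenerativeLaw (h0 : 0 < β) (h1 : β < 1) (hX : IsStableSubordinator β X P) :
    IsStableRegenerativeLaw β (P.map (closedRange X)) where
  isProbabilityMeasure := Measure.isProbabilityMeasure_map hX.aemeasurable_closedRange
  ae_nonneg := by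
    rw [ae_map_iff hX.aemeasurable_closedRange measurableSet_closeds_forall_nonneg]
    filter_upwards [hX.ae_nonneg] with ω hω x hx
    exact closure_minimal (Set.range_subset_iff.mpr hω) isClosed_Ici hx
  ae_zero_mem := by
    rw [ae_map_iff hX.aemeasurable_closedRange (measurableSet_closeds_mem 0)]
    filter_upwards [hX.start_zero] with ω hω using subset_closure ⟨0, hω⟩
  ae_unbounded := by
    rw [ae_all_iff]
    intro n
    rw [ae_map_iff hX.aemeasurable_closedRange
      (measurableSet_closeds_hit_isOpen (isOpen_Ioi (a := (n : ℝ))))]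
    filter_upwards [hX.ae_unbounded] with ω hω
    obtain ⟨t, ht⟩ := hω n
    exact ⟨_, subset_closure ⟨t, rfl⟩, ht⟩
  map_splitAt _ ha := hX.map_splitAt h0 h1 ha

end IsStableSubordinator

end Subordinator

/-! ### The leapfrog chain of two closed sets -/

/-- The states `((s, a), (F₁, F₂))` of the leapfrog chain: the current position is `s`, the set `F₂`
is seen from the current position, and `F₁` from the point at distance `a` to its left. -/
abbrev LeapState : Type :=
  (ℝ × ℝ) × (TopologicalSpace.Closeds ℝ × TopologicalSpace.Closeds ℝ)

/-- One step of the leapfrog chain: it moves to the next point of the first set, and the sets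
exchange their roles. -/
noncomputable def leap (p : LeapState) : LeapState :=
  ((p.1.1 + (splitAt p.1.2 p.2.1).1, (splitAt p.1.2 p.2.1).1), (p.2.2, (splitAt p.1.2 p.2.1).2))

theorem measurable_leap : Measurable leap := by
  have h : Measurable fun p : LeapState => splitAt p.1.2 p.2.1 :=
    Measurable.comp (g := fun p : ℝ × TopologicalSpace.Closeds ℝ => splitAt p.1 p.2)
      (f := fun p : LeapState => (p.1.2, p.2.1)) measurable_splitAt_uncurry
      (measurable_fst.snd.prodMk measurable_snd.fst)
  exact ((measurable_fst.fst.add h.fst).prodMk h.fst).prodMk (measurable_snd.snd.prodMk h.snd)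

theorem measurable_leap_mk (x : ℝ × ℝ) : Measurable fun F => leap (x, F) :=
  measurable_leap.comp measurable_prodMk_left

theorem measurable_iterate_leap_mk (n : ℕ) (x : ℝ × ℝ) : Measurable fun F => leap^[n] (x, F) :=
  (measurable_leap.iterate n).comp measurable_prodMk_left

instance (β : ℝ) : SFinite (overshootLaw β) :=
  inferInstanceAs (SFinite ((volume.restrict (Set.Ioi 0)).withDensity _))

section Chain

variable {β₁ β₂ : ℝ} {ρ₁ ρ₂ : Measure (TopologicalSpace.Closeds ℝ)}

theorem map_leap [SFinite ρ₂] (h₁ : IsStableRegenerativeLaw β₁ ρ₁) (s : ℝ) {a : ℝ} (ha : 0 < a) :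
    (ρ₁.prod ρ₂).map (fun F => leap ((s, a), F)) =
      ((overshootLaw β₁).prod (ρ₂.prod ρ₁)).map fun q => ((s + a * q.1, a * q.1), q.2) := by
  have := h₁.isProbabilityMeasure
  have hpair : ((overshootLaw β₁).map fun u => a * u).prod (ρ₁.prod ρ₂) =
      ((overshootLaw β₁).prod (ρ₂.prod ρ₁)).map (Prod.map (fun u => a * u) Prod.swap) := by
    rw [← Measure.map_prod_map _ _ (by fun_prop) measurable_swap, Measure.prod_swap]
  calc (ρ₁.prod ρ₂).map (fun F => leap ((s, a), F))
      = ((ρ₁.map (splitAt a)).prod ρ₂).map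
          (fun q => ((s + q.1.1, q.1.1), (q.2, q.1.2))) := by
        rw [← Measure.map_id (μ := ρ₂),
          Measure.map_prod_map _ _ (measurable_splitAt a) measurable_id, Measure.map_id,
          Measure.map_map (by fun_prop) ((measurable_splitAt a).prodMap measurable_id)]
        rfl
    _ = (((overshootLaw β₁).map fun u => a * u).prod (ρ₁.prod ρ₂)).map
          (fun q => ((s + q.1, q.1), (q.2.2, q.2.1))) := by
        rw [h₁.map_splitAt a ha, ← Measure.prodAssoc_prod, Measure.map_map (by fun_prop)
          (by fun_prop)]
        rfl
    _ = ((overshootLaw β₁).prod (ρ₂.prod ρ₁)).map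
          (fun q => ((s + a * q.1, a * q.1), q.2)) := by
        rw [hpair, Measure.map_map (by fun_prop) (by fun_prop)]
        rfl

theorem lintegral_leap [SFinite ρ₂] (h₁ : IsStableRegenerativeLaw β₁ ρ₁) (s : ℝ) {a : ℝ}
    (ha : 0 < a) {f : LeapState → ℝ≥0∞} (hf : Measurable f) :
    ∫⁻ F, f (leap ((s, a), F)) ∂(ρ₁.prod ρ₂) =
      ∫⁻ u, ∫⁻ G, f ((s + a * u, a * u), G) ∂(ρ₂.prod ρ₁) ∂(overshootLaw β₁) := by
  have := h₁.isProbabilityMeasure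
  rw [← lintegral_map hf (measurable_leap_mk (s, a)), map_leap h₁ s ha,
    lintegral_map hf (by fun_prop), lintegral_prod _ (by fun_prop)]

theorem ae_leap [SFinite ρ₂] (h₁ : IsStableRegenerativeLaw β₁ ρ₁) (s : ℝ) {a : ℝ} (ha : 0 < a)
    {A : Set LeapState} (hA : MeasurableSet A)
    (h : ∀ᵐ u ∂(overshootLaw β₁), ∀ᵐ G ∂(ρ₂.prod ρ₁), ((s + a * u, a * u), G) ∈ A) :
    ∀ᵐ F ∂(ρ₁.prod ρ₂), leap ((s, a), F) ∈ A := by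
  have := h₁.isProbabilityMeasure
  have hstep : Measurable fun q : ℝ × TopologicalSpace.Closeds ℝ × TopologicalSpace.Closeds ℝ =>
      ((s + a * q.1, a * q.1), q.2) := by fun_prop
  have hmap : ∀ᵐ p ∂((ρ₁.prod ρ₂).map fun F => leap ((s, a), F)), p ∈ A := by
    rw [map_leap h₁ s ha]
    exact (ae_map_iff hstep.aemeasurable hA).mpr
      ((Measure.ae_prod_iff_ae_ae (hA.preimage hstep)).mpr h)
  exact ae_of_ae_map (measurable_leap_mk (s, a)).aemeasurable hmap

/-- States of the leapfrog chain at a positive distance `a`, with the first set unbounded. -/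
def regularStates : Set LeapState :=
  {p | 0 < p.1.2 ∧ ∀ n : ℕ, ((p.2.1 : Set ℝ) ∩ Set.Ioi (n : ℝ)).Nonempty}

theorem measurableSet_regularStates : MeasurableSet regularStates := by
  have hregular : regularStates = {p | 0 < p.1.2} ∩ ⋂ n : ℕ, (fun p => p.2.1) ⁻¹'
      {F : TopologicalSpace.Closeds ℝ | ((F : Set ℝ) ∩ Set.Ioi (n : ℝ)).Nonempty} := by
    ext p
    simp only [regularStates, Set.mem_ofPred_eq, Set.mem_inter_iff, Set.mem_iInter,
      Set.mem_preimage]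
  rw [hregular]
  exact (measurableSet_lt measurable_const measurable_fst.snd).inter (MeasurableSet.iInter fun n =>
    (measurableSet_closeds_hit_isOpen isOpen_Ioi).preimage measurable_snd.fst)

theorem ae_iterate_leap_mem_regularStates (n : ℕ) (h₁ : IsStableRegenerativeLaw β₁ ρ₁)
    (h₂ : IsStableRegenerativeLaw β₂ ρ₂) (s : ℝ) {a : ℝ} (ha : 0 < a) :
    ∀ᵐ F ∂(ρ₁.prod ρ₂), leap^[n] ((s, a), F) ∈ regularStates := by
  have := h₁.isProbabilityMeasure
  have := h₂.isProbabilityMeasure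
  induction n generalizing β₁ β₂ ρ₁ ρ₂ s a with
  | zero =>
    filter_upwards [Measure.quasiMeasurePreserving_fst.ae h₁.ae_unbounded] with F hF
    exact ⟨ha, hF⟩
  | succ n ih =>
    refine ae_leap (A := leap^[n] ⁻¹' regularStates) h₁ s ha
      (measurableSet_regularStates.preimage (measurable_leap.iterate n)) ?_
    filter_upwards [ae_overshootLaw_pos β₁] with u hu
    exact ih h₂ h₁ (s + a * u) (mul_pos ha hu) ‹_› ‹_›

/-- `hittingCDF` with the two indices exchanged `n` times. -/
noncomputable def alternatingCDF : ℕ → ℝ → ℝ → ℝ → ℝ≥0∞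
  | 0, β₁, β₂ => hittingCDF β₁ β₂
  | n + 1, β₁, β₂ => alternatingCDF n β₂ β₁

theorem alternatingCDF_eq_or (n : ℕ) (β₁ β₂ : ℝ) :
    alternatingCDF n β₁ β₂ = hittingCDF β₁ β₂ ∨ alternatingCDF n β₁ β₂ = hittingCDF β₂ β₁ := by
  induction n generalizing β₁ β₂ with
  | zero => exact Or.inl rfl
  | succ n ih => exact (ih β₂ β₁).symm

theorem measurable_alternatingCDF (hβ₁ : β₁ ≤ 1) (hβ₂ : β₂ ≤ 1) (n : ℕ) :
    Measurable (alternatingCDF n β₁ β₂) := by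
  rcases alternatingCDF_eq_or n β₁ β₂ with h | h <;> rw [h]
  · exact (monotone_hittingCDF hβ₁ β₂).measurable
  · exact (monotone_hittingCDF hβ₂ β₁).measurable

theorem alternatingCDF_of_nonpos (n : ℕ) (β₁ β₂ : ℝ) {x : ℝ} (hx : x ≤ 0) :
    alternatingCDF n β₁ β₂ x = 0 := by
  rcases alternatingCDF_eq_or n β₁ β₂ with h | h <;> rw [h] <;> exact hittingCDF_of_nonpos _ _ hx

theorem alternatingCDF_le_one (hβ₁ : β₁ ≤ 1) (hβ₂ : β₂ ≤ 1) (h0 : 0 < β₁ + β₂ - 1)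
    (h1 : β₁ + β₂ - 1 < 1) (n : ℕ) (x : ℝ) : alternatingCDF n β₁ β₂ x ≤ 1 := by
  rcases alternatingCDF_eq_or n β₁ β₂ with h | h <;> rw [h]
  · exact hittingCDF_le_one hβ₁ h0 h1 x
  · exact hittingCDF_le_one hβ₂ (by linarith) (by linarith) x

theorem exists_one_le_alternatingCDF_add (hβ₁ : 0 ≤ β₁) (hβ₂ : 0 ≤ β₂) (h1 : β₁ + β₂ - 1 < 1)
    {r : ℝ} (hr0 : 0 ≤ r) (hr : r < β₁ + β₂ - 1) :
    ∃ C : ℝ, ∀ n, ∀ y > 0, 1 ≤ alternatingCDF n β₁ β₂ y + ENNReal.ofReal (C * y ^ (-r)) := by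
  obtain ⟨C, hC, h⟩ := one_le_hittingCDF_add hβ₁ h1 hr0 hr
  obtain ⟨C', hC', h'⟩ :=
    one_le_hittingCDF_add (β₂ := β₁) hβ₂ (by linarith) hr0 (by linarith)
  refine ⟨C + C', fun n y hy => ?_⟩
  have : 0 ≤ y ^ (-r) := Real.rpow_nonneg hy.le _
  rcases alternatingCDF_eq_or n β₁ β₂ with heq | heq <;> rw [heq]
  · refine (h y hy).trans ?_
    gcongr
    linarith
  · refine (h' y hy).trans ?_
    gcongr
    linarith

theorem tendsto_alternatingCDF (hβ₁ : β₁ < 1) (hβ₂ : β₂ < 1) (hβ : 0 < β₁ + β₂ - 1) {x : ℕ → ℝ}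
    (hx : Filter.Tendsto x Filter.atTop Filter.atTop) :
    Filter.Tendsto (fun n => alternatingCDF n β₁ β₂ (x n)) Filter.atTop (nhds 1) := by
  obtain ⟨r, hr0, hr⟩ := exists_between hβ
  obtain ⟨C, hC⟩ := exists_one_le_alternatingCDF_add (β₁ := β₁) (β₂ := β₂) (by linarith)
    (by linarith) (by linarith) hr0.le hr
  have herr : Filter.Tendsto (fun n => C * x n ^ (-r)) Filter.atTop (nhds 0) := by
    simpa only [mul_zero, Function.comp_apply] using
      ((tendsto_rpow_neg_atTop hr0).comp hx).const_mul C
  have hlow : Filter.Tendsto (fun n => 1 - ENNReal.ofReal (C * x n ^ (-r))) Filter.atTop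
      (nhds 1) := by
    simpa only [ENNReal.ofReal_zero, tsub_zero] using
      ENNReal.Tendsto.sub tendsto_const_nhds (ENNReal.tendsto_ofReal herr)
        (Or.inl ENNReal.one_ne_top)
  refine tendsto_of_tendsto_of_tendsto_of_le_of_le' hlow tendsto_const_nhds ?_
    (Filter.Eventually.of_forall fun n =>
      alternatingCDF_le_one hβ₁.le hβ₂.le hβ (by linarith) n _)
  filter_upwards [hx.eventually_gt_atTop 0] with n hn
  exact tsub_le_iff_right.mpr (hC n _ hn)

/-- The conditional probability that the limit of the leapfrog chain is at most `z`, given that its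
state is `p` after `n` leaps. -/
noncomputable def leapCDF (β₁ β₂ z : ℝ) (n : ℕ) (p : LeapState) : ℝ≥0∞ :=
  alternatingCDF n β₁ β₂ ((z - p.1.1) / p.1.2)

theorem measurable_leapCDF (hβ₁ : β₁ ≤ 1) (hβ₂ : β₂ ≤ 1) (z : ℝ) (n : ℕ) :
    Measurable (leapCDF β₁ β₂ z n) :=
  (measurable_alternatingCDF hβ₁ hβ₂ n).comp (by fun_prop)

theorem lintegral_leapCDF_iterate_leap (n : ℕ) (hβ₁ : β₁ ∈ Set.Ioo (0 : ℝ) 1)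
    (hβ₂ : β₂ ∈ Set.Ioo (0 : ℝ) 1)
    (h₁ : IsStableRegenerativeLaw β₁ ρ₁) (h₂ : IsStableRegenerativeLaw β₂ ρ₂) (z s : ℝ) {a : ℝ}
    (ha : 0 < a) :
    ∫⁻ F, leapCDF β₁ β₂ z n (leap^[n] ((s, a), F)) ∂(ρ₁.prod ρ₂) =
      hittingCDF β₁ β₂ ((z - s) / a) := by
  have := h₁.isProbabilityMeasure
  have := h₂.isProbabilityMeasure
  induction n generalizing β₁ β₂ ρ₁ ρ₂ s a with
  | zero =>
    simp only [leapCDF, alternatingCDF, Function.iterate_zero, id_eq, lintegral_const,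
      measure_univ, mul_one]
  | succ n ih =>
    calc ∫⁻ F, leapCDF β₁ β₂ z (n + 1) (leap^[n] (leap ((s, a), F))) ∂(ρ₁.prod ρ₂)
        = ∫⁻ u, ∫⁻ G, leapCDF β₂ β₁ z n (leap^[n] ((s + a * u, a * u), G)) ∂(ρ₂.prod ρ₁)
            ∂(overshootLaw β₁) :=
          lintegral_leap h₁ s ha
            ((measurable_leapCDF hβ₁.2.le hβ₂.2.le z (n + 1)).comp (measurable_leap.iterate n))
      _ = ∫⁻ u, hittingCDF β₂ β₁ ((z - s) / a / u - 1) ∂(overshootLaw β₁) := by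
          refine lintegral_congr_ae ?_
          filter_upwards [ae_overshootLaw_pos β₁] with u hu
          rw [ih hβ₂ hβ₁ h₂ h₁ (s + a * u) (mul_pos ha hu) ‹_› ‹_›]
          congr 1
          field_simp
          ring
      _ = hittingCDF β₁ β₂ ((z - s) / a) :=
          lintegral_hittingCDF_overshootLaw hβ₁.1 hβ₁.2 β₂ ((z - s) / a)

/-- The product of the first `n` terms of the sequence `m₁, m₂, m₁, m₂, …`. -/
noncomputable def alternatingProd : ℕ → ℝ≥0∞ → ℝ≥0∞ → ℝ≥0∞
  | 0, _, _ => 1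
  | n + 1, m₁, m₂ => m₁ * alternatingProd n m₂ m₁

theorem alternatingProd_two_mul (k : ℕ) (m₁ m₂ : ℝ≥0∞) :
    alternatingProd (2 * k) m₁ m₂ = (m₁ * m₂) ^ k := by
  induction k with
  | zero => rw [mul_zero, pow_zero, alternatingProd]
  | succ k ih => rw [mul_add_one, alternatingProd, alternatingProd, ih, pow_succ', mul_assoc]

theorem tsum_alternatingProd_ne_top {m₁ m₂ : ℝ≥0∞} (h₁ : m₁ ≠ ∞) (h : m₁ * m₂ < 1) :
    ∑' n, alternatingProd n m₁ m₂ ≠ ∞ := by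
  have hgeom : ∑' k, (m₁ * m₂) ^ k ≠ ∞ := by
    rw [ENNReal.tsum_geometric]
    exact ENNReal.inv_ne_top.mpr (tsub_pos_of_lt h).ne'
  rw [← tsum_even_add_odd ENNReal.summable ENNReal.summable]
  simp_rw [alternatingProd, alternatingProd_two_mul, ENNReal.tsum_mul_left, mul_comm m₂]
  exact ENNReal.add_ne_top.mpr ⟨hgeom, ENNReal.mul_ne_top h₁ hgeom⟩

theorem lintegral_rpow_iterate_leap (n : ℕ) (r : ℝ) (h₁ : IsStableRegenerativeLaw β₁ ρ₁)
    (h₂ : IsStableRegenerativeLaw β₂ ρ₂) (s : ℝ) {a : ℝ} (ha : 0 < a) :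
    ∫⁻ F, ENNReal.ofReal ((leap^[n] ((s, a), F)).1.2 ^ r) ∂(ρ₁.prod ρ₂) =
      alternatingProd n (∫⁻ u, ENNReal.ofReal (u ^ r) ∂(overshootLaw β₁))
        (∫⁻ u, ENNReal.ofReal (u ^ r) ∂(overshootLaw β₂)) * ENNReal.ofReal (a ^ r) := by
  have := h₁.isProbabilityMeasure
  have := h₂.isProbabilityMeasure
  induction n generalizing β₁ β₂ ρ₁ ρ₂ s a with
  | zero =>
    simp only [alternatingProd, Function.iterate_zero, id_eq, lintegral_const, measure_univ,
      mul_one, one_mul]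
  | succ n ih =>
    set m₁ := ∫⁻ u, ENNReal.ofReal (u ^ r) ∂(overshootLaw β₁) with hm₁
    set m₂ := ∫⁻ u, ENNReal.ofReal (u ^ r) ∂(overshootLaw β₂)
    calc ∫⁻ F, ENNReal.ofReal ((leap^[n] (leap ((s, a), F))).1.2 ^ r) ∂(ρ₁.prod ρ₂)
        = ∫⁻ u, ∫⁻ G, ENNReal.ofReal ((leap^[n] ((s + a * u, a * u), G)).1.2 ^ r) ∂(ρ₂.prod ρ₁)
            ∂(overshootLaw β₁) :=
          lintegral_leap h₁ s ha (f := fun p => ENNReal.ofReal ((leap^[n] p).1.2 ^ r))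
            ((measurable_leap.iterate n).fst.snd.pow_const r).ennreal_ofReal
      _ = ∫⁻ u, alternatingProd n m₂ m₁ * ENNReal.ofReal (a ^ r) * ENNReal.ofReal (u ^ r)
            ∂(overshootLaw β₁) := by
          refine lintegral_congr_ae ?_
          filter_upwards [ae_overshootLaw_pos β₁] with u hu
          rw [ih h₂ h₁ (s + a * u) (mul_pos ha hu) ‹_› ‹_›, Real.mul_rpow ha.le hu.le,
            ENNReal.ofReal_mul (by positivity), mul_assoc]
      _ = alternatingProd (n + 1) m₁ m₂ * ENNReal.ofReal (a ^ r) := by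
          rw [lintegral_const_mul _ (by fun_prop), ← hm₁, alternatingProd]
          ring

end Chain

/-! ### Orbits of the leapfrog chain -/

theorem inter_Ici_nonempty_of_mem_regularStates {p : LeapState} (hp : p ∈ regularStates) :
    ((p.2.1 : Set ℝ) ∩ Set.Ici p.1.2).Nonempty := by
  obtain ⟨n, hn⟩ := exists_nat_ge p.1.2
  obtain ⟨x, hx, hnx⟩ := hp.2 n
  exact ⟨x, hx, hn.trans (le_of_lt hnx)⟩

theorem splitAt_fst_nonneg {a : ℝ} {F : TopologicalSpace.Closeds ℝ}
    (h : ((F : Set ℝ) ∩ Set.Ici a).Nonempty) : 0 ≤ (splitAt a F).1 :=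
  sub_nonneg.mpr (isLeast_nextPoint h).1.2

theorem splitAt_fst_le {a y : ℝ} {F : TopologicalSpace.Closeds ℝ} (hy : 0 ≤ y) (h : a + y ∈ F) :
    (splitAt a F).1 ≤ y := by
  have hmem : a + y ∈ (F : Set ℝ) ∩ Set.Ici a := ⟨h, le_add_of_nonneg_right hy⟩
  exact sub_le_iff_le_add'.mpr ((isLeast_nextPoint ⟨_, hmem⟩).2 hmem)

theorem add_splitAt_fst_mem {a : ℝ} {F : TopologicalSpace.Closeds ℝ}
    (h : ((F : Set ℝ) ∩ Set.Ici a).Nonempty) : a + (splitAt a F).1 ∈ F := by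
  rw [splitAt, add_sub_cancel]
  exact (isLeast_nextPoint h).1.1

theorem mem_splitAt_snd {a x : ℝ} {F : TopologicalSpace.Closeds ℝ} :
    x ∈ (splitAt a F).2 ↔ 0 ≤ x ∧ a + (splitAt a F).1 + x ∈ F := by
  rw [splitAt, mem_tailFrom, add_sub_cancel]

theorem iterate_leap_fst_succ (p : LeapState) (n : ℕ) :
    (leap^[n + 1] p).1.1 = (leap^[n] p).1.1 + (leap^[n + 1] p).1.2 := by
  rw [Function.iterate_succ_apply']
  rfl

theorem iterate_leap_le_of_mem (n : ℕ) {s a y : ℝ} {A B : TopologicalSpace.Closeds ℝ}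
    (hy : 0 ≤ y) (hA : a + y ∈ A) (hB : y ∈ B) : (leap^[n] ((s, a), (A, B))).1.1 ≤ s + y := by
  induction n generalizing s a y A B with
  | zero => exact le_add_of_nonneg_right hy
  | succ n ih =>
    have hle : (splitAt a A).1 ≤ y := splitAt_fst_le hy hA
    calc (leap^[n] ((s + (splitAt a A).1, (splitAt a A).1), (B, (splitAt a A).2))).1.1
        ≤ s + (splitAt a A).1 + (y - (splitAt a A).1) :=
          ih (sub_nonneg.mpr hle) (by rwa [add_sub_cancel])
            (mem_splitAt_snd.mpr ⟨sub_nonneg.mpr hle, by rwa [add_add_sub_cancel]⟩)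
      _ = s + y := by ring

theorem exists_mem_between_iterate_leap (n : ℕ) {s a : ℝ} {A B : TopologicalSpace.Closeds ℝ}
    (hreg : ∀ n, leap^[n] ((s, a), (A, B)) ∈ regularStates) (h0 : 0 ∈ B) :
    (∃ u ∈ Set.Icc (leap^[n] ((s, a), (A, B))).1.1 (leap^[n + 1] ((s, a), (A, B))).1.1,
        a + (u - s) ∈ A) ∧
      ∃ v ∈ Set.Icc (leap^[n] ((s, a), (A, B))).1.1 (leap^[n + 1] ((s, a), (A, B))).1.1,
        v - s ∈ B := by
  induction n generalizing s a A B with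
  | zero =>
    have hne := inter_Ici_nonempty_of_mem_regularStates (hreg 0)
    have hle : s ≤ s + (splitAt a A).1 := le_add_of_nonneg_right (splitAt_fst_nonneg hne)
    refine ⟨⟨s + (splitAt a A).1, ⟨hle, le_rfl⟩, ?_⟩, ⟨s, ⟨le_rfl, hle⟩, ?_⟩⟩
    · rw [add_sub_cancel_left]
      exact add_splitAt_fst_mem hne
    · rwa [sub_self]
  | succ n ih =>
    have hne := inter_Ici_nonempty_of_mem_regularStates (hreg 0)
    obtain ⟨⟨u, hu, huB⟩, ⟨v, hv, hvA⟩⟩ := ih (s := s + (splitAt a A).1) (a := (splitAt a A).1)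
      (A := B) (B := (splitAt a A).2) (fun n => hreg (n + 1))
      (mem_splitAt_snd.mpr ⟨le_rfl, by rw [add_zero]; exact add_splitAt_fst_mem hne⟩)
    refine ⟨⟨v, hv, ?_⟩, ⟨u, hu, ?_⟩⟩
    · convert (mem_splitAt_snd.mp hvA).2 using 1
      ring
    · convert huB using 1
      ring

theorem isLeast_inter_of_tendsto_iterate_leap {a L : ℝ} {A B : TopologicalSpace.Closeds ℝ}
    (hreg : ∀ n, leap^[n] ((0, a), (A, B)) ∈ regularStates) (h0 : 0 ∈ B) (hB : ∀ x ∈ B, 0 ≤ x)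
    (hL : Filter.Tendsto (fun n => (leap^[n] ((0, a), (A, B))).1.1) Filter.atTop (nhds L)) :
    IsLeast ((A : Set ℝ) ∩ (fun r => a + r) '' (B : Set ℝ)) (a + L) := by
  have hL' := hL.comp (Filter.tendsto_add_atTop_nat 1)
  choose hA hB' using fun n => exists_mem_between_iterate_leap n hreg h0
  choose u hu huA using hA
  choose v hv hvB using hB'
  have hul := tendsto_of_tendsto_of_tendsto_of_le_of_le hL hL' (fun n => (hu n).1) fun n => (hu n).2
  have hvl := tendsto_of_tendsto_of_tendsto_of_le_of_le hL hL' (fun n => (hv n).1) fun n => (hv n).2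
  simp only [sub_zero] at huA hvB
  refine ⟨⟨?_, L, ?_, rfl⟩, ?_⟩
  · exact A.isClosed.mem_of_tendsto (hul.const_add a) (Filter.Eventually.of_forall huA)
  · exact B.isClosed.mem_of_tendsto hvl (Filter.Eventually.of_forall hvB)
  · rintro _ ⟨hA, y, hy, rfl⟩
    have hle := le_of_tendsto' hL fun n => iterate_leap_le_of_mem n (hB y hy) hA hy
    rw [zero_add] at hle
    exact add_le_add_right hle a

theorem summable_of_tsum_ofReal_rpow_ne_top {x : ℕ → ℝ} {r : ℝ} (hr0 : 0 < r) (hr : r ≤ 1)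
    (hx : ∀ n, 0 ≤ x n) (h : ∑' n, ENNReal.ofReal (x n ^ r) ≠ ∞) : Summable x := by
  have hs : Summable fun n => x n ^ r :=
    (ENNReal.summable_toReal h).congr fun n =>
      ENNReal.toReal_ofReal (Real.rpow_nonneg (hx n) r)
  refine hs.of_norm_bounded_eventually_nat ?_
  filter_upwards [hs.tendsto_atTop_zero.eventually_lt_const one_pos] with n hn
  have hx1 : x n < 1 := lt_of_not_ge fun h1 => hn.not_ge (Real.one_le_rpow h1 hr0.le)
  rw [Real.norm_of_nonneg (hx n)]
  exact Real.self_le_rpow_of_le_one (hx n) hx1.le hr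

/-! ### The law of the meeting time -/

/-- The first point of `F₁ ∩ (a + F₂)`, measured from `a`. -/
noncomputable def meetingTime (a : ℝ)
    (F : TopologicalSpace.Closeds ℝ × TopologicalSpace.Closeds ℝ) : ℝ :=
  sInf ((F.1 : Set ℝ) ∩ (fun r => a + r) '' (F.2 : Set ℝ)) - a

/-- The pairs of closed sets for which the leapfrog chain, started at the origin of the second set
with the first set seen from distance `a`, never gets stuck and has summable leaps. -/
structure IsConvergentLeapOrbit (a : ℝ)
    (F : TopologicalSpace.Closeds ℝ × TopologicalSpace.Closeds ℝ) : Prop where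
  regular : ∀ n, leap^[n] ((0, a), F) ∈ regularStates
  summable : Summable fun n => (leap^[n] ((0, a), F)).1.2
  zero_mem : 0 ∈ F.2
  nonneg : ∀ x ∈ F.2, 0 ≤ x

namespace IsConvergentLeapOrbit

variable {a z : ℝ} {F : TopologicalSpace.Closeds ℝ × TopologicalSpace.Closeds ℝ}

theorem gap_pos (h : IsConvergentLeapOrbit a F) (n : ℕ) : 0 < (leap^[n] ((0, a), F)).1.2 :=
  (h.regular n).1

theorem strictMono_position (h : IsConvergentLeapOrbit a F) :
    StrictMono fun n => (leap^[n] ((0, a), F)).1.1 :=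
  strictMono_nat_of_lt_succ fun n => by
    rw [iterate_leap_fst_succ]
    exact lt_add_of_pos_right _ (h.gap_pos (n + 1))

theorem position_eq_sum (a : ℝ) (F : TopologicalSpace.Closeds ℝ × TopologicalSpace.Closeds ℝ)
    (n : ℕ) : (leap^[n] ((0, a), F)).1.1 =
      ∑ i ∈ Finset.range n, (leap^[i + 1] ((0, a), F)).1.2 := by
  induction n with
  | zero => rfl
  | succ n ih => rw [iterate_leap_fst_succ, ih, Finset.sum_range_succ]

theorem tendsto_position (h : IsConvergentLeapOrbit a F) :
    Filter.Tendsto (fun n => (leap^[n] ((0, a), F)).1.1) Filter.atTop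
      (nhds (meetingTime a F)) := by
  have hlim : Filter.Tendsto (fun n => (leap^[n] ((0, a), F)).1.1) Filter.atTop
      (nhds (∑' i, (leap^[i + 1] ((0, a), F)).1.2)) := by
    simp_rw [position_eq_sum]
    exact ((summable_nat_add_iff 1).mpr h.summable).hasSum.tendsto_sum_nat
  have hleast := isLeast_inter_of_tendsto_iterate_leap h.regular h.zero_mem h.nonneg hlim
  rwa [meetingTime, hleast.csInf_eq, add_sub_cancel_left]

theorem isLeast_meetingTime (h : IsConvergentLeapOrbit a F) :
    IsLeast ((F.1 : Set ℝ) ∩ (fun r => a + r) '' (F.2 : Set ℝ)) (a + meetingTime a F) :=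
  isLeast_inter_of_tendsto_iterate_leap h.regular h.zero_mem h.nonneg h.tendsto_position

theorem meetingTime_pos (h : IsConvergentLeapOrbit a F) : 0 < meetingTime a F :=
  (h.strictMono_position one_pos).trans_le
    (h.strictMono_position.monotone.ge_of_tendsto h.tendsto_position 1)

theorem tendsto_leapCDF_of_meetingTime_lt {β₁ β₂ : ℝ} (h : IsConvergentLeapOrbit a F)
    (hβ₁ : β₁ < 1) (hβ₂ : β₂ < 1) (hβ : 0 < β₁ + β₂ - 1) (hz : meetingTime a F < z) :
    Filter.Tendsto (fun n => leapCDF β₁ β₂ z n (leap^[n] ((0, a), F))) Filter.atTop (nhds 1) := by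
  refine tendsto_alternatingCDF hβ₁ hβ₂ hβ ?_
  simp_rw [div_eq_mul_inv]
  refine (h.tendsto_position.const_sub z).pos_mul_atTop (sub_pos.mpr hz) ?_
  exact (tendsto_nhdsWithin_iff.mpr ⟨h.summable.tendsto_atTop_zero,
    Filter.Eventually.of_forall h.gap_pos⟩).inv_tendsto_nhdsGT_zero

theorem tendsto_leapCDF_of_lt_meetingTime (h : IsConvergentLeapOrbit a F) (β₁ β₂ : ℝ)
    (hz : z < meetingTime a F) :
    Filter.Tendsto (fun n => leapCDF β₁ β₂ z n (leap^[n] ((0, a), F))) Filter.atTop (nhds 0) := by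
  refine tendsto_const_nhds.congr' ?_
  filter_upwards [h.tendsto_position.eventually_const_lt hz] with n hn
  exact (alternatingCDF_of_nonpos n β₁ β₂
    (div_nonpos_of_nonpos_of_nonneg (sub_nonpos.mpr hn.le) (h.gap_pos n).le)).symm

end IsConvergentLeapOrbit

theorem aemeasurable_meetingTime
    {μ : Measure (TopologicalSpace.Closeds ℝ × TopologicalSpace.Closeds ℝ)} {a : ℝ}
    (h : ∀ᵐ F ∂μ, IsConvergentLeapOrbit a F) : AEMeasurable (meetingTime a) μ :=
  aemeasurable_of_tendsto_metrizable_ae Filter.atTop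
    (fun n => (measurable_iterate_leap_mk n (0, a)).fst.fst.aemeasurable)
    (h.mono fun _ hF => hF.tendsto_position)

section Meeting

variable {β₁ β₂ : ℝ} {ρ₁ ρ₂ : Measure (TopologicalSpace.Closeds ℝ)}

-- For `0 < r < β₁ + β₂ - 1` the `r`-th moments of the two overshoot laws have a product less
-- than `1`, so that the `r`-th moments of the leaps decay geometrically.
theorem lintegral_rpow_overshootLaw_mul_lt_one (hβ₁ : β₁ ∈ Set.Ioo (0 : ℝ) 1)
    (hβ₂ : β₂ ∈ Set.Ioo (0 : ℝ) 1) {r : ℝ} (hr0 : 0 < r) (hr : r < β₁ + β₂ - 1) :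
    (∫⁻ u, ENNReal.ofReal (u ^ r) ∂(overshootLaw β₁)) *
      (∫⁻ u, ENNReal.ofReal (u ^ r) ∂(overshootLaw β₂)) < 1 := by
  have hs₁ := sin_pi_mul_pos hβ₁.1 hβ₁.2
  have hs₂ : 0 < Real.sin (Real.pi * (β₁ - r)) :=
    sin_pi_mul_pos (by linarith [hβ₂.2]) (by linarith [hβ₁.2])
  rw [lintegral_rpow_overshootLaw hβ₁.1 hβ₁.2 hr0.le (by linarith [hβ₂.2]),
    lintegral_rpow_overshootLaw hβ₂.1 hβ₂.2 hr0.le (by linarith [hβ₁.2]),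
    ← ENNReal.ofReal_mul (by positivity), ENNReal.ofReal_lt_one]
  exact overshootLaw_moments_mul_lt_one hβ₁.2.le hβ₂.2.le hr0 hr

theorem ae_summable_iterate_leap (hβ₁ : β₁ ∈ Set.Ioo (0 : ℝ) 1) (hβ₂ : β₂ ∈ Set.Ioo (0 : ℝ) 1)
    (hβ : 0 < β₁ + β₂ - 1) (h₁ : IsStableRegenerativeLaw β₁ ρ₁)
    (h₂ : IsStableRegenerativeLaw β₂ ρ₂) {a : ℝ} (ha : 0 < a) :
    ∀ᵐ F ∂(ρ₁.prod ρ₂), Summable fun n => (leap^[n] ((0, a), F)).1.2 := by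
  obtain ⟨r, hr0, hr⟩ := exists_between hβ
  have hm : ∀ n, Measurable fun F => ENNReal.ofReal ((leap^[n] ((0, a), F)).1.2 ^ r) := fun n =>
    ((measurable_iterate_leap_mk n (0, a)).fst.snd.pow_const r).ennreal_ofReal
  have hfin : ∫⁻ F, ∑' n, ENNReal.ofReal ((leap^[n] ((0, a), F)).1.2 ^ r) ∂(ρ₁.prod ρ₂) ≠ ∞ := by
    rw [lintegral_tsum fun n => (hm n).aemeasurable]
    simp_rw [lintegral_rpow_iterate_leap _ r h₁ h₂ 0 ha, ENNReal.tsum_mul_right]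
    refine ENNReal.mul_ne_top (tsum_alternatingProd_ne_top ?_
      (lintegral_rpow_overshootLaw_mul_lt_one hβ₁ hβ₂ hr0 hr)) ENNReal.ofReal_ne_top
    rw [lintegral_rpow_overshootLaw hβ₁.1 hβ₁.2 hr0.le (by linarith [hβ₂.2])]
    exact ENNReal.ofReal_ne_top
  filter_upwards [ae_all_iff.mpr fun n => ae_iterate_leap_mem_regularStates n h₁ h₂ 0 ha,
    ae_lt_top (Measurable.tsum hm) hfin] with F hreg hF
  exact summable_of_tsum_ofReal_rpow_ne_top hr0 (by linarith [hβ₁.2, hβ₂.2])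
    (fun n => (hreg n).1.le) hF.ne

theorem ae_isConvergentLeapOrbit (hβ₁ : β₁ ∈ Set.Ioo (0 : ℝ) 1) (hβ₂ : β₂ ∈ Set.Ioo (0 : ℝ) 1)
    (hβ : 0 < β₁ + β₂ - 1) (h₁ : IsStableRegenerativeLaw β₁ ρ₁)
    (h₂ : IsStableRegenerativeLaw β₂ ρ₂) {a : ℝ} (ha : 0 < a) :
    ∀ᵐ F ∂(ρ₁.prod ρ₂), IsConvergentLeapOrbit a F := by
  have := h₁.isProbabilityMeasure
  have := h₂.isProbabilityMeasure
  filter_upwards [ae_all_iff.mpr fun n => ae_iterate_leap_mem_regularStates n h₁ h₂ 0 ha,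
    ae_summable_iterate_leap hβ₁ hβ₂ hβ h₁ h₂ ha,
    Measure.quasiMeasurePreserving_snd.ae h₂.ae_zero_mem,
    Measure.quasiMeasurePreserving_snd.ae h₂.ae_nonneg] with F hreg hsum h0 hnonneg
  exact ⟨hreg, hsum, h0, hnonneg⟩

theorem measure_meetingTime_lt_le (hβ₁ : β₁ ∈ Set.Ioo (0 : ℝ) 1) (hβ₂ : β₂ ∈ Set.Ioo (0 : ℝ) 1)
    (hβ : 0 < β₁ + β₂ - 1) (h₁ : IsStableRegenerativeLaw β₁ ρ₁)
    (h₂ : IsStableRegenerativeLaw β₂ ρ₂) {a : ℝ} (ha : 0 < a) (z : ℝ) :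
    (ρ₁.prod ρ₂) {F | meetingTime a F < z} ≤ hittingCDF β₁ β₂ (z / a) := by
  have hconv := ae_isConvergentLeapOrbit hβ₁ hβ₂ hβ h₁ h₂ ha
  have hlt : NullMeasurableSet {F | meetingTime a F < z} (ρ₁.prod ρ₂) :=
    nullMeasurableSet_lt (aemeasurable_meetingTime hconv) aemeasurable_const
  calc (ρ₁.prod ρ₂) {F | meetingTime a F < z}
      = ∫⁻ F, {F | meetingTime a F < z}.indicator 1 F ∂(ρ₁.prod ρ₂) :=
        (lintegral_indicator_one₀ hlt).symm
    _ ≤ ∫⁻ F, Filter.liminf (fun n => leapCDF β₁ β₂ z n (leap^[n] ((0, a), F))) Filter.atTop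
          ∂(ρ₁.prod ρ₂) := by
        refine lintegral_mono_ae ?_
        filter_upwards [hconv] with F hF
        exact Set.indicator_apply_le' (fun hz =>
          (hF.tendsto_leapCDF_of_meetingTime_lt hβ₁.2 hβ₂.2 hβ hz).liminf_eq.ge) fun _ => zero_le
    _ ≤ Filter.liminf (fun n => ∫⁻ F, leapCDF β₁ β₂ z n (leap^[n] ((0, a), F)) ∂(ρ₁.prod ρ₂))
          Filter.atTop :=
        lintegral_liminf_le fun n =>
          (measurable_leapCDF hβ₁.2.le hβ₂.2.le z n).comp (measurable_iterate_leap_mk n (0, a))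
    _ = hittingCDF β₁ β₂ (z / a) := by
        simp_rw [lintegral_leapCDF_iterate_leap _ hβ₁ hβ₂ h₁ h₂ z 0 ha, sub_zero,
          Filter.liminf_const]

theorem le_measure_meetingTime_le (hβ₁ : β₁ ∈ Set.Ioo (0 : ℝ) 1) (hβ₂ : β₂ ∈ Set.Ioo (0 : ℝ) 1)
    (hβ : 0 < β₁ + β₂ - 1) (h₁ : IsStableRegenerativeLaw β₁ ρ₁)
    (h₂ : IsStableRegenerativeLaw β₂ ρ₂) {a : ℝ} (ha : 0 < a) (z : ℝ) :
    hittingCDF β₁ β₂ (z / a) ≤ (ρ₁.prod ρ₂) {F | meetingTime a F ≤ z} := by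
  have := h₁.isProbabilityMeasure
  have := h₂.isProbabilityMeasure
  have hconv := ae_isConvergentLeapOrbit hβ₁ hβ₂ hβ h₁ h₂ ha
  have hle : NullMeasurableSet {F | meetingTime a F ≤ z} (ρ₁.prod ρ₂) :=
    nullMeasurableSet_le (aemeasurable_meetingTime hconv) aemeasurable_const
  have hle_one : ∀ n p, leapCDF β₁ β₂ z n p ≤ 1 := fun n p =>
    alternatingCDF_le_one hβ₁.2.le hβ₂.2.le hβ (by linarith [hβ₁.2, hβ₂.2]) n _
  calc hittingCDF β₁ β₂ (z / a)
      = Filter.limsup (fun n => ∫⁻ F, leapCDF β₁ β₂ z n (leap^[n] ((0, a), F)) ∂(ρ₁.prod ρ₂))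
          Filter.atTop := by
        simp_rw [lintegral_leapCDF_iterate_leap _ hβ₁ hβ₂ h₁ h₂ z 0 ha, sub_zero,
          Filter.limsup_const]
    _ ≤ ∫⁻ F, Filter.limsup (fun n => leapCDF β₁ β₂ z n (leap^[n] ((0, a), F))) Filter.atTop
          ∂(ρ₁.prod ρ₂) :=
        limsup_lintegral_le 1 (fun n => (measurable_leapCDF hβ₁.2.le hβ₂.2.le z n).comp
            (measurable_iterate_leap_mk n (0, a)))
          (fun n => Filter.Eventually.of_forall fun F => hle_one n _)
          (by simp only [Pi.one_apply, lintegral_one, measure_univ, ne_eq, ENNReal.one_ne_top,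
            not_false_eq_true])
    _ ≤ ∫⁻ F, {F | meetingTime a F ≤ z}.indicator 1 F ∂(ρ₁.prod ρ₂) := by
        refine lintegral_mono_ae ?_
        filter_upwards [hconv] with F hF
        refine Set.le_indicator_apply (fun _ => ?_) fun hz => ?_
        · exact Filter.limsup_le_of_le (by isBoundedDefault)
            (Filter.Eventually.of_forall fun n => hle_one n _)
        · exact (hF.tendsto_leapCDF_of_lt_meetingTime β₁ β₂ (not_le.mp hz)).limsup_eq.le
    _ = (ρ₁.prod ρ₂) {F | meetingTime a F ≤ z} := lintegral_indicator_one₀ hle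

theorem measure_meetingTime_le (hβ₁ : β₁ ∈ Set.Ioo (0 : ℝ) 1) (hβ₂ : β₂ ∈ Set.Ioo (0 : ℝ) 1)
    (hβ : 0 < β₁ + β₂ - 1) (h₁ : IsStableRegenerativeLaw β₁ ρ₁)
    (h₂ : IsStableRegenerativeLaw β₂ ρ₂) {a : ℝ} (ha : 0 < a) (z : ℝ) :
    (ρ₁.prod ρ₂) {F | meetingTime a F ≤ z} = hittingCDF β₁ β₂ (z / a) := by
  rcases le_or_gt z 0 with hz | hz
  · have hpos : ∀ᵐ F ∂(ρ₁.prod ρ₂), ¬ meetingTime a F ≤ z :=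
      (ae_isConvergentLeapOrbit hβ₁ hβ₂ hβ h₁ h₂ ha).mono fun F hF =>
        not_le.mpr (hz.trans_lt hF.meetingTime_pos)
    rw [hittingCDF_of_nonpos _ _ (div_nonpos_of_nonpos_of_nonneg hz ha.le)]
    simpa only [ae_iff, not_not] using hpos
  · refine le_antisymm ?_ (le_measure_meetingTime_le hβ₁ hβ₂ hβ h₁ h₂ ha z)
    have hcont : ContinuousAt (fun w => hittingCDF β₁ β₂ (w / a)) z :=
      ContinuousAt.comp (f := fun w : ℝ => w / a) (g := hittingCDF β₁ β₂)
        (continuousAt_hittingCDF hβ₁.2.le hβ (by linarith [hβ₁.2, hβ₂.2]) (div_pos hz ha))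
        (by fun_prop)
    refine ge_of_tendsto (hcont.tendsto.mono_left (nhdsWithin_le_nhds (s := Set.Ioi z))) ?_
    filter_upwards [self_mem_nhdsWithin] with w (hw : z < w)
    exact (measure_mono fun F (hF : meetingTime a F ≤ z) => hF.trans_lt hw).trans
      (measure_meetingTime_lt_le hβ₁ hβ₂ hβ h₁ h₂ ha w)

end Meeting

/-! ### First intersection times of independent stable regenerative sets -/

section Transfer

variable {Ω : Type*} [MeasurableSpace Ω] {P : Measure Ω} {β β₁ β₂ : ℝ}
  {R R₁ R₂ : Ω → TopologicalSpace.Closeds ℝ}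

theorem IsStableRegenerativeSet.isStableRegenerativeLaw (hβ : β ∈ Set.Ioo (0 : ℝ) 1)
    (hR : IsStableRegenerativeSet β R P) : IsStableRegenerativeLaw β (P.map R) := by
  obtain ⟨_, _, _, _, _, hX, hid⟩ := hR
  rw [hid.map_eq]
  exact hX.isStableRegenerativeLaw hβ.1 hβ.2

theorem IsStableRegenerativeSet.aemeasurable (hR : IsStableRegenerativeSet β R P) :
    AEMeasurable R P := by
  obtain ⟨_, _, _, _, _, _, hid⟩ := hR
  exact hid.aemeasurable_fst

theorem IsStableOvershoot.map_eq {B : Ω → ℝ} (hβ : β ∈ Set.Ioo (0 : ℝ) 1)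
    (hB : IsStableOvershoot β 1 B P) : P.map B = overshootLaw β := by
  obtain ⟨_, _, _, _, _, hX, hid⟩ := hB
  rw [hid.map_eq, ← hX.map_overshoot_div hβ.1 hβ.2 one_pos]
  simp only [div_one]

theorem IsStableOvershoot.aemeasurable {a : ℝ} {B : Ω → ℝ} (hB : IsStableOvershoot β a B P) :
    AEMeasurable B P := by
  obtain ⟨_, _, _, _, _, _, hid⟩ := hB
  exact hid.aemeasurable_fst

theorem ae_isConvergentLeapOrbit_map [IsProbabilityMeasure P]
    (hβ₁ : β₁ ∈ Set.Ioo (0 : ℝ) 1) (hβ₂ : β₂ ∈ Set.Ioo (0 : ℝ) 1) (hβ : 0 < β₁ + β₂ - 1)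
    (hR₁ : IsStableRegenerativeSet β₁ R₁ P) (hR₂ : IsStableRegenerativeSet β₂ R₂ P)
    (hR : IndepFun R₁ R₂ P) {a : ℝ} (ha : 0 < a) :
    ∀ᵐ F ∂(P.map fun ω => (R₁ ω, R₂ ω)), IsConvergentLeapOrbit a F := by
  rw [(indepFun_iff_map_prod_eq_prod_map_map hR₁.aemeasurable hR₂.aemeasurable).mp hR]
  exact ae_isConvergentLeapOrbit hβ₁ hβ₂ hβ (hR₁.isStableRegenerativeLaw hβ₁)
    (hR₂.isStableRegenerativeLaw hβ₂) ha

theorem ae_isLeast_firstIntersectionTime [IsProbabilityMeasure P]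
    (hβ₁ : β₁ ∈ Set.Ioo (0 : ℝ) 1) (hβ₂ : β₂ ∈ Set.Ioo (0 : ℝ) 1) (hβ : 0 < β₁ + β₂ - 1)
    (hR₁ : IsStableRegenerativeSet β₁ R₁ P) (hR₂ : IsStableRegenerativeSet β₂ R₂ P)
    (hR : IndepFun R₁ R₂ P) {a : ℝ} (ha : 0 < a) :
    ∀ᵐ ω ∂P, IsLeast (shiftedIntersection R₁ R₂ a ω) (a + firstIntersectionTime R₁ R₂ a ω) :=
  (ae_of_ae_map (hR₁.aemeasurable.prodMk hR₂.aemeasurable)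
    (ae_isConvergentLeapOrbit_map hβ₁ hβ₂ hβ hR₁ hR₂ hR ha)).mono
      fun _ h => h.isLeast_meetingTime

theorem aemeasurable_firstIntersectionTime [IsProbabilityMeasure P]
    (hβ₁ : β₁ ∈ Set.Ioo (0 : ℝ) 1) (hβ₂ : β₂ ∈ Set.Ioo (0 : ℝ) 1) (hβ : 0 < β₁ + β₂ - 1)
    (hR₁ : IsStableRegenerativeSet β₁ R₁ P) (hR₂ : IsStableRegenerativeSet β₂ R₂ P)
    (hR : IndepFun R₁ R₂ P) {a : ℝ} (ha : 0 < a) :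
    AEMeasurable (firstIntersectionTime R₁ R₂ a) P := by
  have hm := aemeasurable_meetingTime (ae_isConvergentLeapOrbit_map hβ₁ hβ₂ hβ hR₁ hR₂ hR ha)
  exact hm.comp_aemeasurable (hR₁.aemeasurable.prodMk hR₂.aemeasurable)

theorem measure_firstIntersectionTime_le [IsProbabilityMeasure P]
    (hβ₁ : β₁ ∈ Set.Ioo (0 : ℝ) 1) (hβ₂ : β₂ ∈ Set.Ioo (0 : ℝ) 1) (hβ : 0 < β₁ + β₂ - 1)
    (hR₁ : IsStableRegenerativeSet β₁ R₁ P) (hR₂ : IsStableRegenerativeSet β₂ R₂ P)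
    (hR : IndepFun R₁ R₂ P) {a : ℝ} (ha : 0 < a) (z : ℝ) :
    P {ω | firstIntersectionTime R₁ R₂ a ω ≤ z} = hittingCDF β₁ β₂ (z / a) := by
  have hm := aemeasurable_meetingTime (ae_isConvergentLeapOrbit_map hβ₁ hβ₂ hβ hR₁ hR₂ hR ha)
  rw [← measure_meetingTime_le hβ₁ hβ₂ hβ (hR₁.isStableRegenerativeLaw hβ₁)
      (hR₂.isStableRegenerativeLaw hβ₂) ha,
    ← (indepFun_iff_map_prod_eq_prod_map_map hR₁.aemeasurable hR₂.aemeasurable).mp hR,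
    Measure.map_apply₀ (hR₁.aemeasurable.prodMk hR₂.aemeasurable)
      (nullMeasurableSet_le hm aemeasurable_const)]
  rfl

theorem map_firstIntersectionTime_Iic [IsProbabilityMeasure P]
    (hβ₁ : β₁ ∈ Set.Ioo (0 : ℝ) 1) (hβ₂ : β₂ ∈ Set.Ioo (0 : ℝ) 1) (hβ : 0 < β₁ + β₂ - 1)
    (hR₁ : IsStableRegenerativeSet β₁ R₁ P) (hR₂ : IsStableRegenerativeSet β₂ R₂ P)
    (hR : IndepFun R₁ R₂ P) (z : ℝ) :
    P.map (firstIntersectionTime R₁ R₂ 1) (Set.Iic z) = hittingCDF β₁ β₂ z := by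
  rw [Measure.map_apply_of_aemeasurable
    (aemeasurable_firstIntersectionTime hβ₁ hβ₂ hβ hR₁ hR₂ hR one_pos) measurableSet_Iic]
  have h := measure_firstIntersectionTime_le hβ₁ hβ₂ hβ hR₁ hR₂ hR one_pos z
  rwa [div_one] at h

theorem identDistrib_firstIntersectionTime_div [IsProbabilityMeasure P]
    (hβ₁ : β₁ ∈ Set.Ioo (0 : ℝ) 1) (hβ₂ : β₂ ∈ Set.Ioo (0 : ℝ) 1) (hβ : 0 < β₁ + β₂ - 1)
    (hR₁ : IsStableRegenerativeSet β₁ R₁ P) (hR₂ : IsStableRegenerativeSet β₂ R₂ P)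
    (hR : IndepFun R₁ R₂ P) {a : ℝ} (ha : 0 < a) :
    IdentDistrib (fun ω => firstIntersectionTime R₁ R₂ a ω / a) (firstIntersectionTime R₁ R₂ 1)
      P P := by
  have hm := (aemeasurable_firstIntersectionTime hβ₁ hβ₂ hβ hR₁ hR₂ hR ha).div_const a
  refine ⟨hm, aemeasurable_firstIntersectionTime hβ₁ hβ₂ hβ hR₁ hR₂ hR one_pos, ?_⟩
  have := Measure.isProbabilityMeasure_map hm
  refine Measure.ext_of_Iic _ _ fun z => ?_
  rw [map_firstIntersectionTime_Iic hβ₁ hβ₂ hβ hR₁ hR₂ hR,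
    Measure.map_apply_of_aemeasurable hm measurableSet_Iic]
  have h := measure_firstIntersectionTime_le hβ₁ hβ₂ hβ hR₁ hR₂ hR ha (z * a)
  rw [mul_div_assoc, div_self ha.ne', mul_one] at h
  rw [← h]
  congr 1
  ext ω
  exact div_le_iff₀ ha

theorem identDistrib_firstIntersectionTime_recursion [IsProbabilityMeasure P]
    (hβ₁ : β₁ ∈ Set.Ioo (0 : ℝ) 1) (hβ₂ : β₂ ∈ Set.Ioo (0 : ℝ) 1) (hβ : 0 < β₁ + β₂ - 1)
    (hR₁ : IsStableRegenerativeSet β₁ R₁ P) (hR₂ : IsStableRegenerativeSet β₂ R₂ P)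
    (hR : IndepFun R₁ R₂ P) {Ω' : Type*} [MeasurableSpace Ω'] {P' : Measure Ω'}
    [IsProbabilityMeasure P'] {S₁ S₂ : Ω' → TopologicalSpace.Closeds ℝ} {B : Ω' → ℝ}
    (hS₁ : IsStableRegenerativeSet β₁ S₁ P') (hS₂ : IsStableRegenerativeSet β₂ S₂ P')
    (hS : IndepFun S₂ S₁ P') (hB : IsStableOvershoot β₁ 1 B P')
    (hBS : IndepFun B (firstIntersectionTime S₂ S₁ 1) P') :
    IdentDistrib (firstIntersectionTime R₁ R₂ 1)
      (fun ω => B ω * (1 + firstIntersectionTime S₂ S₁ 1 ω)) P P' := by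
  have hβ' : 0 < β₂ + β₁ - 1 := by linarith
  have hmR := aemeasurable_firstIntersectionTime hβ₁ hβ₂ hβ hR₁ hR₂ hR one_pos
  have hmS := aemeasurable_firstIntersectionTime hβ₂ hβ₁ hβ' hS₂ hS₁ hS one_pos
  have hmp := hB.aemeasurable.prodMk hmS
  have hg : Measurable fun p : ℝ × ℝ => p.1 * (1 + p.2) := by fun_prop
  have := Measure.isProbabilityMeasure_map hmR
  have := Measure.isProbabilityMeasure_map hmS
  refine ⟨hmR, hg.comp_aemeasurable hmp, ?_⟩
  have hlaw : P'.map (fun ω => B ω * (1 + firstIntersectionTime S₂ S₁ 1 ω)) =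
      ((overshootLaw β₁).prod (P'.map (firstIntersectionTime S₂ S₁ 1))).map
        fun p => p.1 * (1 + p.2) := by
    rw [← hB.map_eq hβ₁, ← (indepFun_iff_map_prod_eq_prod_map_map hB.aemeasurable hmS).mp hBS,
      AEMeasurable.map_map_of_aemeasurable hg.aemeasurable hmp]
    rfl
  rw [hlaw]
  refine Measure.ext_of_Iic _ _ fun x => ?_
  rw [map_firstIntersectionTime_Iic hβ₁ hβ₂ hβ hR₁ hR₂ hR,
    Measure.map_apply hg measurableSet_Iic, Measure.prod_apply (hg measurableSet_Iic),
    ← lintegral_hittingCDF_overshootLaw hβ₁.1 hβ₁.2]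
  refine lintegral_congr_ae ?_
  filter_upwards [ae_overshootLaw_pos β₁] with b hb
  rw [← map_firstIntersectionTime_Iic hβ₂ hβ₁ hβ' hS₂ hS₁ hS]
  congr 1
  ext d
  simp only [Set.mem_preimage, Set.mem_Iic]
  rw [le_sub_iff_add_le, le_div_iff₀ hb, mul_comm, add_comm d]

end Transfer

theorem theoremB1 {Ω : Type*} [MeasurableSpace Ω] (P : Measure Ω) [IsProbabilityMeasure P]
    (β₁ β₂ : ℝ) (hβ₁ : β₁ ∈ Set.Ioo (0 : ℝ) 1) (hβ₂ : β₂ ∈ Set.Ioo (0 : ℝ) 1)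
    (hβ : 0 < β₁ + β₂ - 1)
    (R₁ R₂ : Ω → TopologicalSpace.Closeds ℝ)
    (hR₁ : IsStableRegenerativeSet β₁ R₁ P) (hR₂ : IsStableRegenerativeSet β₂ R₂ P)
    (hR : IndepFun R₁ R₂ P) :
    -- the minimum defining the first intersection time is almost surely attained
    (∀ a : ℝ, 0 < a → ∀ᵐ ω ∂P,
      IsLeast (shiftedIntersection R₁ R₂ a ω) (a + firstIntersectionTime R₁ R₂ a ω)) ∧
    -- recursion
    (∀ (Ω' : Type*) [MeasurableSpace Ω'] (P' : Measure Ω') [IsProbabilityMeasure P']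
      (S₁ S₂ : Ω' → TopologicalSpace.Closeds ℝ) (B : Ω' → ℝ),
      IsStableRegenerativeSet β₁ S₁ P' → IsStableRegenerativeSet β₂ S₂ P' → IndepFun S₂ S₁ P' →
      IsStableOvershoot β₁ 1 B P' → IndepFun B (firstIntersectionTime S₂ S₁ 1) P' →
      IdentDistrib (firstIntersectionTime R₁ R₂ 1)
        (fun ω => B ω * (1 + firstIntersectionTime S₂ S₁ 1 ω)) P P') ∧
    -- scaling
    (∀ a : ℝ, 0 < a →
      IdentDistrib (fun ω => firstIntersectionTime R₁ R₂ a ω / a)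
        (firstIntersectionTime R₁ R₂ 1) P P) ∧
    -- distribution function
    (∀ x : ℝ, 0 < x →
      P.real {ω | firstIntersectionTime R₁ R₂ 1 ω ≤ x} = intersectionCDF β₁ β₂ x 1) ∧
    -- hypergeometric form of the distribution function
    (∃ F : ℂ → ℂ, IsGaussHypergeometric (1 - β₁ : ℝ) (β₂ : ℝ) (2 - β₁ : ℝ) F ∧
      ∀ x a : ℝ, 0 < x → 0 < a →
        (intersectionCDF β₁ β₂ x a : ℂ) =
          (Real.Gamma β₂ / (Real.Gamma (β₁ + β₂ - 1) * Real.Gamma (2 - β₁)) *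
            (a / x) ^ (β₁ - 1) : ℝ) * F (-(x / a) : ℝ)) := by
  refine ⟨fun a ha => ae_isLeast_firstIntersectionTime hβ₁ hβ₂ hβ hR₁ hR₂ hR ha, ?_,
    fun a ha => identDistrib_firstIntersectionTime_div hβ₁ hβ₂ hβ hR₁ hR₂ hR ha,
    fun x hx => ?_, ?_⟩
  · intro Ω' _ P' _ S₁ S₂ B hS₁ hS₂ hS hB hBS
    exact identDistrib_firstIntersectionTime_recursion hβ₁ hβ₂ hβ hR₁ hR₂ hR hS₁ hS₂ hS hB hBS
  · rw [Measure.real, measure_firstIntersectionTime_le hβ₁ hβ₂ hβ hR₁ hR₂ hR one_pos, div_one,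
      intersectionCDF_eq_toReal hβ (by linarith [hβ₁.2, hβ₂.2]) hx]
  · refine ⟨_, isGaussHypergeometric_eulerHypergeometric _ hβ₂.1 (by linarith [hβ₁.2, hβ₂.2]), ?_⟩
    intro x a hx ha
    exact intersectionCDF_eq_eulerHypergeometric (by linarith [hβ₁.2]) hβ₂.1
      (by linarith [hβ₁.2, hβ₂.2]) hx ha
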